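/- Let $X$ be a quasi-compact scheme and let $\mathcal P(X)$ be the exact category of locally free $\mathcal O_X$-modules of finite rank. For an exact category $\mathcal N$, let $B(\mathcal N)$ denote the exact category of bounded acyclic binary complexes in $\mathcal N$: graded objects supported on a finite subset of $[0,\infty)$ with two differentials $d,\tilde d$ of degree $-1$, each of which makes them an acyclic complex in $\mathcal N$; morphisms are degree $0$ maps that commute with both differentials, and short exact sequences are defined degreewise. Put $\mathcal B^0(X)=\mathcal P(X)$ and $\mathcal B^n(X)=B(\mathcal B^{n-1}(X))$, where the $n$-th application of $B$ adds the $n$-th direction. An object of $\mathcal B^n(X)$ is called diagonal if its two differentials agree in at least one direction, and Grayson's $K_n(X)$ is the quotient of the Grothendieck group $K_0(\mathcal B^n(X))$ by the classes of all diagonal objects. Let $\Lambda^r_0=\Lambda^r$ be the $r$-th exterior power functor and, inductively, $\Lambda^r_n=N\,\Lambda^r_{n-1}\,\Gamma$ on $n$-dimensional binary multicomplexes, where $\Gamma$ and $N$ are the functors of the Dold–Kan correspondence, applied in the $n$-th direction to both differentials. (They give binary complexes again, since the degeneracies of $\Gamma$ do not depend on the differential and $N$ is the quotient by degenerate simplices.)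 The exterior power operation $\lambda^r$ on $K_n(X)$ is given on the class of an object $Q$ of $\mathcal B^n(X)$ by $\lambda^r[Q]=[\Lambda^r_n Q]$. For an object $P$ with pairwise commuting automorphisms $A_1,\dots,A_n$, let $[P;A_1,\dots,A_n]$ be the $n$-dimensional binary multicomplex with $P$ at every place of $\{0,1\}^n$ and $0$ elsewhere, whose non-trivial differentials $P\to P$ in direction $i$ are $d^i=A_i$ and $\tilde d^i=1$; its class in $K_n(X)$ is denoted in the same way. The cross-effects of a functor $F$ between abelian categories with $F(0)=0$ are defined by $\mathrm{cr}_1F=F$ and by letting $\mathrm{cr}_{i}F(P_1,\dots,P_i)$ be the canonical direct-sum complement of $\mathrm{cr}_{i-1}F(P_1,P_3,\dots,P_i)\oplus \mathrm{cr}_{i-1}F(P_2,P_3,\dots,P_i)$ in $\mathrm{cr}_{i-1}F(P_1\oplus P_2,P_3,\dots,P_i)$, i.e. the kernel of the map to that direct sum induced by the two projections. **Theorem.** Let $r,n\ge 1$, let $P$ be a locally free $\mathcal O_X$-module of finite rank, and let $A_1,\dots,A_n$ be pairwise commuting automorphisms of $P$. Then the multicomplexes $[P;A_1,\dots,A_n]$,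 $\Lambda^r_n[P;A_1,\dots,A_n]$ and $[\mathrm{cr}_i\Lambda^r(P,\dots,P);B_{i,1},\dots,B_{i,n}]$, $1\le i\le r$, belong to $\mathcal B^n(X)$, and in $K_n(X)$ we have $$\lambda^r[P;A_1,\dots,A_n]=[\Lambda^r_n[P;A_1,\dots,A_n]]=\sum_{i=1}^r(-1)^{i-1}\,[\mathrm{cr}_i\Lambda^r(P,\dots,P);B_{i,1},\dots,B_{i,n}],$$ where $B_{i,1}=\mathrm{cr}_i\Lambda^r(A_1,1,\dots,1)$ and $B_{i,j}=\mathrm{cr}_i\Lambda^r(A_j,\dots,A_j)$ for $j=2,\dots,n$. -/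

import Mathlib

open CategoryTheory Limits AlgebraicGeometry

universe v u

namespace GraysonK

noncomputable section

/-! ### Binary complexes -/

/-- A binary chain complex supported on `[0, ∞)`: a graded object with two differentials, the
top one `dTop` and the bottom one `dBot`. Neither boundedness nor acyclicity is imposed here. -/
structure BinaryComplex (C : Type u) [Category.{v} C] [HasZeroMorphisms C] where
  X : ℕ → C
  dTop (k : ℕ) : X (k + 1) ⟶ X k
  dBot (k : ℕ) : X (k + 1) ⟶ X k
  dTop_comp (k : ℕ) : dTop (k + 1) ≫ dTop k = 0
  dBot_comp (k : ℕ) : dBot (k + 1) ≫ dBot k = 0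

namespace BinaryComplex

section

variable {C : Type u} [Category.{v} C] [HasZeroMorphisms C]

/-- Morphisms of binary complexes: degree `0` maps that commute with both differentials. -/
@[ext]
structure Hom (P Q : BinaryComplex C) where
  f (k : ℕ) : P.X k ⟶ Q.X k
  commTop (k : ℕ) : P.dTop k ≫ f k = f (k + 1) ≫ Q.dTop k
  commBot (k : ℕ) : P.dBot k ≫ f k = f (k + 1) ≫ Q.dBot k

instance : Category (BinaryComplex C) where
  Hom := Hom
  id P := { f := fun k => 𝟙 (P.X k), commTop := by simp, commBot := by simp }
  comp {P Q R} f g :=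
    { f := fun k => f.f k ≫ g.f k
      commTop := fun k => by
        rw [← Category.assoc, f.commTop, Category.assoc, g.commTop, Category.assoc]
      commBot := fun k => by
        rw [← Category.assoc, f.commBot, Category.assoc, g.commBot, Category.assoc] }

@[ext]
theorem hom_ext {P Q : BinaryComplex C} {f g : P ⟶ Q} (h : ∀ k, f.f k = g.f k) : f = g :=
  Hom.ext (funext h)

@[simp] theorem id_f (P : BinaryComplex C) (k : ℕ) : Hom.f (𝟙 P) k = 𝟙 (P.X k) := rfl

@[simp] theorem comp_f {P Q R : BinaryComplex C} (f : P ⟶ Q) (g : Q ⟶ R) (k : ℕ) :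
    (f ≫ g).f k = f.f k ≫ g.f k := rfl

/-- The degree `k` part. -/
def eval (k : ℕ) : BinaryComplex C ⥤ C where
  obj P := P.X k
  map f := f.f k
end

section
variable {C : Type u} [Category.{v} C] [Preadditive C] {P Q : BinaryComplex C}

instance : Zero (P ⟶ Q) := ⟨{ f := fun _ => 0, commTop := by simp, commBot := by simp }⟩
instance : Add (P ⟶ Q) :=
  ⟨fun a b => { f := fun k => a.f k + b.f k, commTop := by simp [Hom.commTop], commBot := by simp [Hom.commBot] }⟩
instance : Neg (P ⟶ Q) :=
  ⟨fun a => { f := fun k => -a.f k, commTop := by simp [Hom.commTop], commBot := by simp [Hom.commBot] }⟩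
instance : Sub (P ⟶ Q) :=
  ⟨fun a b => { f := fun k => a.f k - b.f k, commTop := by simp [Hom.commTop], commBot := by simp [Hom.commBot] }⟩
instance : SMul ℕ (P ⟶ Q) :=
  ⟨fun n a => { f := fun k => n • a.f k, commTop := by simp [Hom.commTop], commBot := by simp [Hom.commBot] }⟩
instance : SMul ℤ (P ⟶ Q) :=
  ⟨fun n a => { f := fun k => n • a.f k, commTop := by simp [Hom.commTop], commBot := by simp [Hom.commBot] }⟩

@[simp] theorem zero_f (k : ℕ) : (0 : P ⟶ Q).f k = 0 := rfl
@[simp] theorem add_f (a b : P ⟶ Q) (k : ℕ) : (a + b).f k = a.f k + b.f k := rfl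

instance : AddCommGroup (P ⟶ Q) :=
  Function.Injective.addCommGroup (fun a : P ⟶ Q => a.f) (fun _ _ h => Hom.ext h)
    rfl (fun _ _ => rfl) (fun _ => rfl) (fun _ _ => rfl) (fun _ _ => rfl) (fun _ _ => rfl)

instance : Preadditive (BinaryComplex C) where

end

section
variable {C : Type u} [Category.{v} C] [HasZeroMorphisms C]

def dNatTop (k : ℕ) : eval (C := C) (k + 1) ⟶ eval k where
  app P := P.dTop k
  naturality _ _ f := (f.commTop k).symm

def dNatBot (k : ℕ) : eval (C := C) (k + 1) ⟶ eval k where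
  app P := P.dBot k
  naturality _ _ f := (f.commBot k).symm

variable {J : Type*} [Category* J] [HasColimitsOfShape J C] (F : J ⥤ BinaryComplex C)

def colimitCocone : Cocone F where
  pt :=
    { X := fun n => colimit (F ⋙ eval n)
      dTop := fun n => colimMap (Functor.whiskerLeft F (dNatTop n))
      dBot := fun n => colimMap (Functor.whiskerLeft F (dNatBot n))
      dTop_comp := fun n => colimit.hom_ext fun j => by
        rw [ι_colimMap_assoc, ι_colimMap, ← Category.assoc, comp_zero]
        exact (congrArg (· ≫ colimit.ι (F ⋙ eval n) j) ((F.obj j).dTop_comp n)).trans zero_comp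
      dBot_comp := fun n => colimit.hom_ext fun j => by
        rw [ι_colimMap_assoc, ι_colimMap, ← Category.assoc, comp_zero]
        exact (congrArg (· ≫ colimit.ι (F ⋙ eval n) j) ((F.obj j).dBot_comp n)).trans zero_comp }
  ι :=
    { app := fun j =>
        { f := fun n => colimit.ι (F ⋙ eval n) j
          commTop := fun n => (ι_colimMap (Functor.whiskerLeft F (dNatTop n)) j).symm
          commBot := fun n => (ι_colimMap (Functor.whiskerLeft F (dNatBot n)) j).symm }
      naturality := fun i j φ => by
        ext n
        exact (colimit.w (F ⋙ eval n) φ).trans (Category.comp_id _).symm }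

def isColimitColimitCocone : IsColimit (colimitCocone F) where
  desc s :=
    { f := fun n => colimit.desc (F ⋙ eval n) ((eval n).mapCocone s)
      commTop := fun n => colimit.hom_ext fun j => by
        refine (ι_colimMap_assoc (Functor.whiskerLeft F (dNatTop n)) j _).trans ?_
        refine (congrArg ((F.obj j).dTop n ≫ ·) (colimit.ι_desc ((eval n).mapCocone s) j)).trans ?_
        refine ((s.ι.app j).commTop n).trans ?_
        exact (colimit.ι_desc_assoc ((eval (n + 1)).mapCocone s) j (s.pt.dTop n)).symm
      commBot := fun n => colimit.hom_ext fun j => by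
        refine (ι_colimMap_assoc (Functor.whiskerLeft F (dNatBot n)) j _).trans ?_
        refine (congrArg ((F.obj j).dBot n ≫ ·) (colimit.ι_desc ((eval n).mapCocone s) j)).trans ?_
        refine ((s.ι.app j).commBot n).trans ?_
        exact (colimit.ι_desc_assoc ((eval (n + 1)).mapCocone s) j (s.pt.dBot n)).symm }
  fac s j := by
    ext n
    exact colimit.ι_desc ((eval n).mapCocone s) j
  uniq s m h := by
    ext n
    refine colimit.hom_ext fun j => ?_
    exact (congrArg (fun g => Hom.f g n) (h j)).trans
      (colimit.ι_desc ((eval n).mapCocone s) j).symm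

instance : HasColimitsOfShape J (BinaryComplex C) :=
  ⟨fun F => ⟨⟨_, isColimitColimitCocone F⟩⟩⟩

end

instance {C : Type u} [Category.{v} C] [HasZeroMorphisms C] [HasFiniteColimits C] :
    HasFiniteColimits (BinaryComplex C) :=
  ⟨fun _ _ => inferInstance⟩

section

variable {C : Type u} [Category.{v} C] [Preadditive C]

/-- The chain complex given by the top differential. -/
def top (P : BinaryComplex C) : ChainComplex C ℕ := ChainComplex.of P.X P.dTop P.dTop_comp

/-- The chain complex given by the bottom differential. -/
def bot (P : BinaryComplex C) : ChainComplex C ℕ := ChainComplex.of P.X P.dBot P.dBot_comp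

end

end BinaryComplex

/-! ### The Dold-Kan correspondence for binary complexes -/

namespace DoldKan

section

open AlgebraicTopology AlgebraicTopology.DoldKan Simplicial

variable {C : Type u} [Category.{v} C] [Preadditive C] [HasFiniteColimits C]
variable {D : Type u} [Category.{v} D] [Preadditive D]

/-- A graded object regarded as a complex with zero differential. -/
def graded (X : ℕ → C) : ChainComplex C ℕ := ChainComplex.of X (fun _ => 0) (by simp)

/-- The degeneracies of `Γ(K)` do not depend on the differential of `K`. -/
theorem map_epi (K : ChainComplex C ℕ) {Δ Δ' : SimplexCategoryᵒᵖ} (θ : Δ ⟶ Δ') [Epi θ.unop] :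
    (Γ₀.obj K).map θ = (Γ₀.obj (graded K.X)).map θ := by
  refine Sigma.hom_ext _ _ fun A => ?_
  have fac : (θ.unop ≫ A.e) ≫ 𝟙 A.1.unop = θ.unop ≫ A.e := Category.comp_id _
  refine (Γ₀.Obj.map_on_summand₀ K A fac).trans ?_
  refine Eq.trans ?_ (Γ₀.Obj.map_on_summand₀ (graded K.X) A fac).symm
  rw [Γ₀.Obj.Termwise.mapMono_id, Γ₀.Obj.Termwise.mapMono_id]
  rfl

theorem gamma_σ (K : ChainComplex C ℕ) {n : ℕ} (i : Fin (n + 1)) :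
    (Γ₀.obj K).σ i = (Γ₀.obj (graded K.X)).σ i :=
  map_epi K (SimplexCategory.σ i).op

/-- A map of graded objects as a chain map between complexes with zero differential. -/
def gradedMap {X Y : ℕ → C} (f : ∀ k, X k ⟶ Y k) : graded X ⟶ graded Y :=
  ChainComplex.ofHom f (by simp [graded])

theorem splitting_inj (K : ChainComplex C ℕ) {Δ : SimplexCategoryᵒᵖ}
    (A : SimplicialObject.Splitting.IndexSet Δ) :
    ((Γ₀.splitting K).cofan Δ).inj A = Sigma.ι (Γ₀.Obj.summand K Δ) A := by
  let i : A.1.unop ⟶ (SimplicialObject.Splitting.IndexSet.id A.1).1.unop := 𝟙 A.1.unop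
  have : Mono i := inferInstanceAs (Mono (𝟙 A.1.unop))
  refine (Γ₀.Obj.map_on_summand₀ K (SimplicialObject.Splitting.IndexSet.id A.1)
    (i := i) (e := A.e) (θ := A.e.op) rfl).trans ?_
  refine (congrArg (· ≫ _) (Γ₀.Obj.Termwise.mapMono_id K A.1.unop)).trans ?_
  exact Category.id_comp _

theorem ι_map_app {K L : ChainComplex C ℕ} (φ : K ⟶ L) (Δ : SimplexCategoryᵒᵖ)
    (A : SimplicialObject.Splitting.IndexSet Δ) :
    Sigma.ι (Γ₀.Obj.summand K Δ) A ≫ (Γ₀.map φ).app Δ =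
      φ.f A.1.unop.len ≫ Sigma.ι (Γ₀.Obj.summand L Δ) A := by
  rw [← splitting_inj, ← splitting_inj]
  exact (Γ₀.splitting K).ι_desc _ _ _

theorem map_app {K L : ChainComplex C ℕ} (φ : K ⟶ L) (Δ : SimplexCategoryᵒᵖ) :
    (Γ₀.map φ).app Δ = (Γ₀.map (gradedMap φ.f)).app Δ := by
  refine Sigma.hom_ext _ _ fun A => ?_
  refine (ι_map_app φ Δ A).trans ?_
  exact (ι_map_app (gradedMap φ.f) Δ A).symm

variable (F : C ⥤ D)

/-- The `i`-th face map of `Γ(K)`; note that `Γ(K)_n` only depends on the graded object `K.X`. -/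
def gammaδ (K : ChainComplex C ℕ) {n : ℕ} (i : Fin (n + 2)) :
    (Γ₀.obj (graded K.X)) _⦋n + 1⦌ ⟶ (Γ₀.obj (graded K.X)) _⦋n⦌ :=
  (Γ₀.obj K).δ i

/-- The alternating sum of the face maps of `F Γ(K)`. -/
def face (K : ChainComplex C ℕ) (n : ℕ) :
    F.obj ((Γ₀.obj (graded K.X)) _⦋n + 1⦌) ⟶ F.obj ((Γ₀.obj (graded K.X)) _⦋n⦌) :=
  ∑ i : Fin (n + 2), (-1 : ℤ) ^ (i : ℕ) • F.map (gammaδ K i)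

/-- The simplicial object `F Γ(K)`. -/
def FG (K : ChainComplex C ℕ) : SimplicialObject D :=
  ((SimplicialObject.whiskering C D).obj F).obj (Γ₀.obj K)

theorem face_eq (K : ChainComplex C ℕ) (n : ℕ) :
    face F K n = ((alternatingFaceMapComplex D).obj (FG F K)).d (n + 1) n := by
  rw [alternatingFaceMapComplex_obj_d]
  rfl

theorem face_face (K : ChainComplex C ℕ) (n : ℕ) : face F K (n + 1) ≫ face F K n = 0 := by
  rw [face_eq, face_eq]
  exact HomologicalComplex.d_comp_d _ _ _ _

theorem face_naturality {K L : ChainComplex C ℕ} (φ : K ⟶ L) (n : ℕ) :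
    face F K n ≫ F.map ((Γ₀.map (gradedMap φ.f)).app (Opposite.op ⦋n⦌)) =
      F.map ((Γ₀.map (gradedMap φ.f)).app (Opposite.op ⦋n + 1⦌)) ≫ face F L n := by
  unfold face
  rw [Preadditive.sum_comp, Preadditive.comp_sum]
  refine Finset.sum_congr rfl fun i _ => ?_
  rw [Preadditive.zsmul_comp, Preadditive.comp_zsmul]
  congr 1
  refine (F.map_comp _ _).symm.trans (Eq.trans ?_ (F.map_comp _ _))
  congr 1
  have h := (Γ₀.map φ).naturality (SimplexCategory.δ i).op
  exact ((congrArg (_ ≫ ·) (map_app φ _)).symm.trans h).trans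
    (congrArg (· ≫ _) (map_app φ _))

variable [HasFiniteColimits D]

/-- The degree `n` part of `N F Γ`, i.e. the quotient of `F (Γ(X)_n)` by the images of the
degeneracies. It only depends on the graded object `X`, not on a differential. -/
def obj (X : ℕ → C) (n : ℕ) : D :=
  match n with
  | 0 => F.obj ((Γ₀.obj (graded X)) _⦋0⦌)
  | n + 1 => cokernel (Sigma.desc fun i : Fin (n + 1) => F.map ((Γ₀.obj (graded X)).σ i))

/-- The projection `F (Γ(X)_n) ⟶ (N F Γ X)_n`. -/
def proj (X : ℕ → C) (n : ℕ) : F.obj ((Γ₀.obj (graded X)) _⦋n⦌) ⟶ obj F X n :=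
  match n with
  | 0 => 𝟙 _
  | _ + 1 => cokernel.π _

instance (X : ℕ → C) (n : ℕ) : Epi (proj F X n) := by
  cases n <;> dsimp only [proj, obj] <;> infer_instance

theorem σ_proj (X : ℕ → C) (n : ℕ) (i : Fin (n + 1)) :
    F.map ((Γ₀.obj (graded X)).σ i) ≫ proj F X (n + 1) = 0 := by
  have h := cokernel.condition
    (Sigma.desc fun i : Fin (n + 1) => F.map ((Γ₀.obj (graded X)).σ i))
  have h' := congrArg (Sigma.ι (fun _ : Fin (n + 1) => F.obj ((Γ₀.obj (graded X)) _⦋n⦌)) i ≫ ·) h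
  refine Eq.trans ?_ (h'.trans comp_zero)
  exact (Sigma.ι_desc_assoc (fun i : Fin (n + 1) => F.map ((Γ₀.obj (graded X)).σ i)) i _).symm

theorem vanish (K : ChainComplex C ℕ) (n : ℕ) :
    DegeneraciesVanish (X := FG F K) (n := n) (proj F K.X n) := by
  cases n with
  | zero => trivial
  | succ n =>
    intro i
    have : (FG F K).σ i = F.map ((Γ₀.obj (graded K.X)).σ i) :=
      congrArg F.map (gamma_σ K i)
    exact (congrArg (· ≫ proj F K.X (n + 1)) this).trans (σ_proj F K.X n i)

theorem PInfty_proj (K : ChainComplex C ℕ) (n : ℕ) :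
    (PInfty (X := FG F K)).f n ≫ proj F K.X n = proj F K.X n := by
  have h := (degeneraciesVanish_iff_QInfty_f_comp (X := FG F K) (proj F K.X n)).1 (vanish F K n)
  have e := congrArg (· ≫ proj F K.X n) (PInfty_f_add_QInfty_f (X := FG F K) n)
  refine Eq.trans ?_ (e.trans (Category.id_comp _))
  refine Eq.trans ?_ (Preadditive.add_comp _ _ _ _ _ _).symm
  refine Eq.trans ?_ (congrArg (_ + ·) h).symm
  exact (add_zero _).symm

theorem σ_face_proj (K : ChainComplex C ℕ) (n : ℕ) (i : Fin (n + 1)) :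
    F.map ((Γ₀.obj (graded K.X)).σ i) ≫ face F K n ≫ proj F K.X n = 0 := by
  have h1 : F.map ((Γ₀.obj (graded K.X)).σ i) = (FG F K).σ i :=
    (congrArg F.map (gamma_σ K i)).symm
  have h2 : (FG F K).σ i ≫ (PInfty (X := FG F K)).f (n + 1) = 0 := σ_comp_PInfty (FG F K) i
  have h3 : (PInfty (X := FG F K)).f (n + 1) ≫
      ((alternatingFaceMapComplex D).obj (FG F K)).d (n + 1) n =
      ((alternatingFaceMapComplex D).obj (FG F K)).d (n + 1) n ≫ (PInfty (X := FG F K)).f n :=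
    (PInfty (X := FG F K)).comm (n + 1) n
  have h4 : (FG F K).σ i ≫ ((alternatingFaceMapComplex D).obj (FG F K)).d (n + 1) n ≫
      (PInfty (X := FG F K)).f n = 0 := by
    refine (congrArg (_ ≫ ·) h3.symm).trans ?_
    refine (Category.assoc _ _ _).symm.trans ?_
    exact (congrArg (· ≫ _) h2).trans zero_comp
  have h5 := congrArg (· ≫ proj F K.X n) h4
  rw [face_eq, h1]
  refine Eq.trans ?_ (h5.trans zero_comp)
  refine Eq.trans ?_ ((Category.assoc _ _ _).trans
    (congrArg ((FG F K).σ i ≫ ·) (Category.assoc _ _ _))).symm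
  exact congrArg (fun t => (FG F K).σ i ≫
    ((alternatingFaceMapComplex D).obj (FG F K)).d (n + 1) n ≫ t) (PInfty_proj F K n).symm

/-- The differential of `N F Γ(K)`, induced by the alternating sum of the faces. -/
def diff (K : ChainComplex C ℕ) (n : ℕ) : obj F K.X (n + 1) ⟶ obj F K.X n :=
  cokernel.desc _ (face F K n ≫ proj F K.X n) (Sigma.hom_ext _ _ fun i => by
    rw [Sigma.ι_desc_assoc, comp_zero]
    exact σ_face_proj F K n i)

theorem proj_diff (K : ChainComplex C ℕ) (n : ℕ) :
    proj F K.X (n + 1) ≫ diff F K n = face F K n ≫ proj F K.X n :=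
  cokernel.π_desc _ _ _

theorem diff_comp_diff (K : ChainComplex C ℕ) (n : ℕ) : diff F K (n + 1) ≫ diff F K n = 0 := by
  rw [← cancel_epi (proj F K.X (n + 2)), ← Category.assoc, proj_diff, Category.assoc, proj_diff,
    ← Category.assoc, face_face, zero_comp, comp_zero]

/-- The functoriality of `N F Γ` in degree `n`. -/
def map {X Y : ℕ → C} (f : ∀ k, X k ⟶ Y k) (n : ℕ) : obj F X n ⟶ obj F Y n :=
  match n with
  | 0 => F.map ((Γ₀.map (gradedMap f)).app _)
  | n + 1 => cokernel.desc _ (F.map ((Γ₀.map (gradedMap f)).app _) ≫ proj F Y (n + 1))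
     (Sigma.hom_ext _ _ fun i => by
      rw [Sigma.ι_desc_assoc, comp_zero, ← Category.assoc, ← F.map_comp,
        show (Γ₀.obj (graded X)).σ i ≫ (Γ₀.map (gradedMap f)).app _ = _ from
          (Γ₀.map (gradedMap f)).naturality (SimplexCategory.σ i).op,
        F.map_comp, Category.assoc]
      exact (congrArg (_ ≫ ·) (σ_proj F Y n i)).trans comp_zero)

theorem proj_map {X Y : ℕ → C} (f : ∀ k, X k ⟶ Y k) (n : ℕ) :
    proj F X n ≫ map F f n = F.map ((Γ₀.map (gradedMap f)).app _) ≫ proj F Y n := by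
  cases n with
  | zero => exact (Category.id_comp _).trans (Category.comp_id _).symm
  | succ n => exact cokernel.π_desc _ _ _

theorem map_id (X : ℕ → C) (n : ℕ) : map F (fun k => 𝟙 (X k)) n = 𝟙 (obj F X n) := by
  rw [← cancel_epi (proj F X n), proj_map, Category.comp_id]
  have : (Γ₀.map (gradedMap fun k => 𝟙 (X k))).app (Opposite.op ⦋n⦌) = 𝟙 _ := by
    refine Sigma.hom_ext _ _ fun A => ?_
    refine (ι_map_app _ _ A).trans ?_
    exact (Category.id_comp _).trans (Category.comp_id _).symm
  rw [this, F.map_id]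
  exact Category.id_comp _

theorem map_comp {X Y Z : ℕ → C} (f : ∀ k, X k ⟶ Y k) (g : ∀ k, Y k ⟶ Z k) (n : ℕ) :
    map F (fun k => f k ≫ g k) n = map F f n ≫ map F g n := by
  rw [← cancel_epi (proj F X n), proj_map, ← Category.assoc, proj_map, Category.assoc, proj_map,
    ← Category.assoc, ← F.map_comp]
  congr 2
  refine Sigma.hom_ext _ _ fun A => ?_
  refine (ι_map_app _ _ A).trans ?_
  refine Eq.trans ?_ (Category.assoc _ _ _)
  refine Eq.trans ?_ (congrArg (· ≫ _) (ι_map_app (gradedMap f) _ A)).symm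
  refine Eq.trans ?_ (Category.assoc _ _ _).symm
  refine Eq.trans ?_ (congrArg (_ ≫ ·) (ι_map_app (gradedMap g) _ A)).symm
  exact Category.assoc _ _ _

theorem diff_naturality {K L : ChainComplex C ℕ} (φ : K ⟶ L) (n : ℕ) :
    diff F K n ≫ map F φ.f n = map F φ.f (n + 1) ≫ diff F L n := by
  rw [← cancel_epi (proj F K.X (n + 1)), ← Category.assoc, proj_diff, Category.assoc, proj_map,
    ← Category.assoc (proj F K.X (n + 1)), proj_map, Category.assoc, proj_diff,
    ← Category.assoc, face_naturality, Category.assoc]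

/-- Forgetting the bottom differential. -/
def topFunctor : BinaryComplex C ⥤ ChainComplex C ℕ where
  obj P := P.top
  map f := ChainComplex.ofHom f.f fun k => by
    simp [BinaryComplex.top, f.commTop]

/-- Forgetting the top differential. -/
def botFunctor : BinaryComplex C ⥤ ChainComplex C ℕ where
  obj P := P.bot
  map f := ChainComplex.ofHom f.f fun k => by
    simp [BinaryComplex.bot, f.commBot]

/-- The functor `N F Γ` on binary complexes: `Γ` is applied to both differentials, then `F`, then
the normalised chain complex functor `N`. Since the degeneracies of the two simplicial objects
agree, the two resulting chain complexes have the same underlying graded object. -/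
def functor : BinaryComplex C ⥤ BinaryComplex D where
  obj P :=
    { X := obj F P.X
      dTop := diff F P.top
      dBot := diff F P.bot
      dTop_comp := diff_comp_diff F P.top
      dBot_comp := diff_comp_diff F P.bot }
  map f :=
    { f := map F f.f
      commTop := diff_naturality F (topFunctor.map f)
      commBot := diff_naturality F (botFunctor.map f) }
  map_id P := BinaryComplex.hom_ext fun n => map_id F P.X n
  map_comp f g := BinaryComplex.hom_ext fun n => map_comp F f.f g.f n

end

end DoldKan

/-! ### Exterior powers of modules over a scheme -/

namespace PresheafExt

section

variable {C : Type*} [Category* C] {R : Cᵒᵖ ⥤ CommRingCat.{u}}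

/-- The alternating map `(m_i) ↦ ∧ m_i|_V` on `M(U)`, for a presheaf of modules `M`. -/
def restrictMk (r : ℕ) (M : PresheafOfModules.{u} (R ⋙ forget₂ CommRingCat RingCat)) {U V : Cᵒᵖ}
    (f : U ⟶ V) :
    ModuleCat.AlternatingMap (R := R.obj U) (M.obj U)
      ((ModuleCat.restrictScalars (R.map f).hom).obj
        (ModuleCat.exteriorPower (R := R.obj V) (M.obj V) r)) r where
  toFun m := ModuleCat.exteriorPower.mk (R := R.obj V) (M := M.obj V) (fun i => M.map f (m i))
  map_update_add' := by
    intro _ m i x y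
    let φ := exteriorPower.ιMulti (R.obj V) r (M := M.obj V)
    have key : ∀ z : M.obj U, (fun j => M.map f (Function.update m i z j)) =
        Function.update (fun j => (M.map f (m j) : M.obj V)) i (M.map f z) := fun z => by
      funext j
      exact Function.apply_update (fun _ => M.map f) m i z j
    change φ _ = φ _ + φ _
    rw [key, key, key]
    refine Eq.trans ?_ (φ.map_update_add _ i _ _)
    congr 2
    exact map_add (M.map f).hom x y
  map_update_smul' := by
    intro _ m i c x
    let φ := exteriorPower.ιMulti (R.obj V) r (M := M.obj V)
    have key : ∀ z : M.obj U, (fun j => M.map f (Function.update m i z j)) =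
        Function.update (fun j => (M.map f (m j) : M.obj V)) i (M.map f z) := fun z => by
      funext j
      exact Function.apply_update (fun _ => M.map f) m i z j
    change φ _ = (R.map f).hom c • φ _
    rw [key, key]
    refine Eq.trans ?_ (φ.map_update_smul _ i _ _)
    congr 2
    exact M.map_smul f c x
  map_eq_zero_of_eq' := by
    intro m i j h hij
    exact (exteriorPower.ιMulti (R.obj V) r (M := M.obj V)).map_eq_zero_of_eq _
      (congrArg (fun z => (M.map f z : M.obj V)) h) hij

/-- The presheaf of modules `U ↦ Λ^r M(U)`. -/
def extObj (r : ℕ) (M : PresheafOfModules.{u} (R ⋙ forget₂ CommRingCat RingCat)) :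
    PresheafOfModules.{u} (R ⋙ forget₂ CommRingCat RingCat) where
  obj U := ModuleCat.exteriorPower (R := R.obj U) (M.obj U) r
  map {U V} f := ModuleCat.exteriorPower.desc (R := R.obj U) (restrictMk r M f)
  map_id U := by
    refine ModuleCat.exteriorPower.hom_ext (R := R.obj U) ?_
    ext m
    refine (ModuleCat.exteriorPower.desc_mk (R := R.obj U) _ m).trans ?_
    change ModuleCat.exteriorPower.mk (R := R.obj U) (M := M.obj U) _ =
      ModuleCat.exteriorPower.mk (R := R.obj U) (M := M.obj U) _
    congr 1
    funext i
    rw [M.map_id]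
    rfl
  map_comp {U V W} f g := by
    refine ModuleCat.exteriorPower.hom_ext (R := R.obj U) ?_
    ext m
    refine (ModuleCat.exteriorPower.desc_mk (R := R.obj U) _ m).trans ?_
    symm
    refine (congrArg (ModuleCat.exteriorPower.desc (R := R.obj V) (restrictMk r M g))
      (ModuleCat.exteriorPower.desc_mk (R := R.obj U) _ m)).trans ?_
    refine (ModuleCat.exteriorPower.desc_mk (R := R.obj V) (restrictMk r M g) _).trans ?_
    change ModuleCat.exteriorPower.mk (R := R.obj W) (M := M.obj W) _ =
      ModuleCat.exteriorPower.mk (R := R.obj W) (M := M.obj W) _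
    congr 1
    funext i
    exact (M.map_comp_apply f g (m i)).symm

/-- The functor `M ↦ (U ↦ Λ^r M(U))` on presheaves of modules. -/
def extFunctor (r : ℕ) : PresheafOfModules.{u} (R ⋙ forget₂ CommRingCat RingCat) ⥤
    PresheafOfModules.{u} (R ⋙ forget₂ CommRingCat RingCat) where
  obj M := extObj r M
  map {M N} φ :=
    { app := fun U => ModuleCat.exteriorPower.map (R := R.obj U) (φ.app U) r
      naturality := fun {U V} f => by
        refine ModuleCat.exteriorPower.hom_ext (R := R.obj U) ?_
        ext m
        refine (congrArg (ModuleCat.exteriorPower.map (R := R.obj V) (φ.app V) r)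
          (ModuleCat.exteriorPower.desc_mk (R := R.obj U) _ m)).trans ?_
        refine (ModuleCat.exteriorPower.map_mk (R := R.obj V) (φ.app V) _).trans ?_
        symm
        refine (congrArg (ModuleCat.exteriorPower.desc (R := R.obj U) (restrictMk r N f))
          (ModuleCat.exteriorPower.map_mk (R := R.obj U) (φ.app U) m)).trans ?_
        refine (ModuleCat.exteriorPower.desc_mk (R := R.obj U) _ _).trans ?_
        change ModuleCat.exteriorPower.mk (R := R.obj V) (M := N.obj V) _ =
          ModuleCat.exteriorPower.mk (R := R.obj V) (M := N.obj V) _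
        congr 1
        funext i
        exact (PresheafOfModules.naturality_apply φ f (m i)).symm }
  map_id M := by
    refine PresheafOfModules.hom_ext fun U => ?_
    exact (ModuleCat.exteriorPower.functor (R := R.obj U) r).map_id _
  map_comp φ ψ := by
    refine PresheafOfModules.hom_ext fun U => ?_
    exact (ModuleCat.exteriorPower.functor (R := R.obj U) r).map_comp _ _

end

end PresheafExt

/-- The sheaf of modules associated with a presheaf of modules on `X`. -/
def sheafify (X : Scheme.{u}) : X.PresheafOfModules ⥤ X.Modules :=
  PresheafOfModules.sheafification (𝟙 X.ringCatSheaf.obj)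

/-- The exterior power functor `Λ^r` on `𝒪_X`-modules: the sheafification of
`U ↦ Λ^r_{𝒪_X(U)} M(U)`. -/
def extPow (X : Scheme.{u}) (r : ℕ) : X.Modules ⥤ X.Modules :=
  Scheme.Modules.toPresheafOfModules X ⋙ PresheafExt.extFunctor (R := X.presheaf) r ⋙ sheafify X

/-- Locally free `𝒪_X`-modules of finite rank, i.e. the objects of `𝒫(X)`. The rank need not be
constant. -/
def IsLocallyFreeFinite {X : Scheme.{u}} (M : X.Modules) : Prop :=
  ∀ x : X, ∃ U : X.Opens, x ∈ U ∧ ∃ m : ℕ,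
    Nonempty (M.restrict U.ι ≅
      SheafOfModules.free (R := (U : Scheme.{u}).ringCatSheaf) (ULift.{u} (Fin m)))

/-! ### Multicomplexes, the category `ℬⁿ(X)` and Grayson's `K_n(X)` -/

/-- A preadditive category with finite colimits, bundled in order to iterate the formation of
binary complexes. -/
structure Amb where
  carrier : Type (u + 1)
  [cat : Category.{u} carrier]
  [pre : Preadditive carrier]
  [colim : HasFiniteColimits carrier]

attribute [instance] Amb.cat Amb.pre Amb.colim

/-- The category of binary complexes in a category. -/
def Amb.binary (A : Amb.{u}) : Amb.{u} := { carrier := BinaryComplex A.carrier }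

/-- The `n`-fold iteration of the formation of binary complexes, starting from `𝒪_X`-modules. -/
def multi (X : Scheme.{u}) : ℕ → Amb.{u}
  | 0 => { carrier := X.Modules }
  | n + 1 => (multi X n).binary

/-- `n`-dimensional binary multicomplexes of arbitrary `𝒪_X`-modules: binary complexes (in the
`n`-th direction) of `(n - 1)`-dimensional ones. -/
abbrev Multi (X : Scheme.{u}) (n : ℕ) : Type (u + 1) := (multi X n).carrier

/-- `P ⟶ Q ⟶ R` is short exact in every multidegree. -/
def IsSES (X : Scheme.{u}) : ∀ (n : ℕ) {P Q R : Multi X n}, (P ⟶ Q) → (Q ⟶ R) → Prop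
  | 0, _, _, _, f, g => ∃ h : f ≫ g = 0, (ShortComplex.mk (C := X.Modules) f g h).ShortExact
  | n + 1, _, _, _, f, g =>
    ∀ k, IsSES X n (BinaryComplex.Hom.f f k) (BinaryComplex.Hom.f g k)

/-- Acyclicity of a complex `⋯ ⟶ X 1 ⟶ X 0 ⟶ 0` in the exact category with objects `mem` and
short exact sequences `ses`: every differential factors as `X (k + 1) ↠ Z k ↣ X k` such that
`Z (k + 1) ↣ X (k + 1) ↠ Z k` is a short exact sequence of the exact category, and `Z 0 = X 0`. -/
def IsAcyclic {C : Type u} [Category.{v} C] (mem : C → Prop)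
    (ses : ∀ {P Q R : C}, (P ⟶ Q) → (Q ⟶ R) → Prop)
    (X : ℕ → C) (d : ∀ k, X (k + 1) ⟶ X k) : Prop :=
  ∃ (Z : ℕ → C) (i : ∀ k, Z k ⟶ X k) (p : ∀ k, X (k + 1) ⟶ Z k),
    (∀ k, mem (Z k)) ∧ (∀ k, d k = p k ≫ i k) ∧ (∀ k, ses (i (k + 1)) (p k)) ∧ IsIso (i 0)

/-- The objects of `ℬⁿ(X)`, the `n`-fold iteration of the formation of bounded acyclic binary
complexes, starting from the exact category `𝒫(X)`. The short exact sequences of `ℬⁿ(X)` are those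
sequences of objects of `ℬⁿ(X)` that are short exact in every multidegree. -/
def IsAcyclicMulti (X : Scheme.{u}) : ∀ n : ℕ, Multi X n → Prop
  | 0 => fun P => IsLocallyFreeFinite (X := X) P
  | n + 1 => fun (P : BinaryComplex (Multi X n)) =>
    (∀ k, IsAcyclicMulti X n (P.X k)) ∧ (∃ N, ∀ k, N ≤ k → IsZero (P.X k)) ∧
      IsAcyclic (IsAcyclicMulti X n) (IsSES X n) P.X P.dTop ∧
      IsAcyclic (IsAcyclicMulti X n) (IsSES X n) P.X P.dBot

/-- The top and bottom differentials agree in a given direction; here directions are numbered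
starting from the outermost one. -/
def IsDiagonalIn (X : Scheme.{u}) : ∀ n : ℕ, Fin n → Multi X n → Prop
  | 0, j => j.elim0
  | n + 1, j => fun (P : BinaryComplex (Multi X n)) =>
    Fin.cases (motive := fun _ => Prop) (P.dTop = P.dBot)
      (fun j' => ∀ k, IsDiagonalIn X n j' (P.X k)) j

/-- The objects of `ℬⁿ(X)`. -/
abbrev BObj (X : Scheme.{u}) (n : ℕ) : Type (u + 1) := {P : Multi X n // IsAcyclicMulti X n P}

/-- The defining relations of `K_n(X)`: `[Q] = [P] + [R]` for short exact sequences
`0 ⟶ P ⟶ Q ⟶ R ⟶ 0` in `ℬⁿ(X)`, and `[P] = 0` if `P` is diagonal. -/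
def relations (X : Scheme.{u}) (n : ℕ) : Set (FreeAbelianGroup (BObj X n)) :=
  {x | ∃ (P Q R : BObj X n) (f : P.1 ⟶ Q.1) (g : Q.1 ⟶ R.1), IsSES X n f g ∧
      x = FreeAbelianGroup.of Q - FreeAbelianGroup.of P - FreeAbelianGroup.of R} ∪
  {x | ∃ P : BObj X n, (∃ j, IsDiagonalIn X n j P.1) ∧ x = FreeAbelianGroup.of P}

/-- Grayson's `K_n(X)`: the quotient of the Grothendieck group of `ℬⁿ(X)` by the classes of diagonal
multicomplexes. -/
abbrev K (X : Scheme.{u}) (n : ℕ) : Type (u + 1) :=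
  FreeAbelianGroup (BObj X n) ⧸ AddSubgroup.closure (relations X n)

/-- The class in `K_n(X)` of an object of `ℬⁿ(X)`. -/
def cls {X : Scheme.{u}} {n : ℕ} (P : Multi X n) (hP : IsAcyclicMulti X n P) : K X n :=
  QuotientAddGroup.mk (FreeAbelianGroup.of ⟨P, hP⟩)

/-! ### Exterior powers of multicomplexes -/

/-- The functor `Λ^r_n`, defined by `Λ^r_0 = Λ^r` and `Λ^r_{n+1} = N Λ^r_n Γ`, where `Γ` and `N` are
the Dold-Kan functors in the outermost direction. -/
def extMulti (X : Scheme.{u}) (r : ℕ) : ∀ n : ℕ, Multi X n ⥤ Multi X n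
  | 0 => extPow X r
  | n + 1 => DoldKan.functor (extMulti X r n)

/-- `lam` is the `r`-th exterior power operation on `K_n(X)`, i.e. the additive map with
`lam [Q] = [Λ^r_n Q]` for every object `Q` of `ℬⁿ(X)`. -/
def IsExteriorPowerOperation (X : Scheme.{u}) (r n : ℕ) (lam : K X n →+ K X n) : Prop :=
  ∀ (Q : Multi X n) (hQ : IsAcyclicMulti X n Q),
    ∃ h : IsAcyclicMulti X n ((extMulti X r n).obj Q),
      lam (cls Q hQ) = cls ((extMulti X r n).obj Q) h

/-! ### Cubes -/

/-- An object with `n` pairwise commuting automorphisms, i.e. an object of `Autⁿ(C)`. -/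
structure CommAut (C : Type u) [Category.{v} C] (n : ℕ) where
  obj : C
  aut : Fin n → Aut obj
  comm : ∀ i j, Commute (aut i) (aut j)

namespace CommAut

variable {C : Type u} [Category.{v} C] {n : ℕ}

/-- Morphisms that commute with the given automorphisms. -/
@[ext]
structure Hom (P Q : CommAut C n) where
  hom : P.obj ⟶ Q.obj
  comm : ∀ i, (P.aut i).hom ≫ hom = hom ≫ (Q.aut i).hom

instance : Category (CommAut C n) where
  Hom := Hom
  id P := { hom := 𝟙 P.obj, comm := by simp }
  comp f g :=
    { hom := f.hom ≫ g.hom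
      comm := fun i => by
        rw [← Category.assoc, f.comm, Category.assoc, g.comm, Category.assoc] }

/-- Forgetting the last automorphism. -/
def init : CommAut C (n + 1) ⥤ CommAut C n where
  obj P := { obj := P.obj, aut := fun i => P.aut i.castSucc, comm := fun _ _ => P.comm _ _ }
  map f := { hom := f.hom, comm := fun _ => f.comm _ }

/-- The last automorphism as an endomorphism in `Autⁿ(C)`. -/
def lastEnd (P : CommAut C (n + 1)) : init.obj P ⟶ init.obj P where
  hom := (P.aut (Fin.last n)).hom
  comm i := congrArg Iso.hom (P.comm (Fin.last n) i.castSucc).eq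

theorem lastEnd_naturality {P Q : CommAut C (n + 1)} (f : P ⟶ Q) :
    lastEnd P ≫ init.map f = init.map f ≫ lastEnd Q :=
  Hom.ext (f.comm (Fin.last n))

end CommAut

namespace BinaryComplex

variable {C : Type u} [Category.{v} C] [HasZeroMorphisms C] [HasZeroObject C]

open ZeroObject

/-- The graded object with `Q` in degrees `0` and `1`. -/
def endX (Q : C) : ℕ → C
  | 0 => Q
  | 1 => Q
  | _ + 2 => 0

/-- The differential given by an endomorphism of `Q`. -/
def endD {Q : C} (a : Q ⟶ Q) : ∀ k, endX Q (k + 1) ⟶ endX Q k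
  | 0 => a
  | _ + 1 => 0

/-- A morphism in degrees `0` and `1`. -/
def endF {Q R : C} (f : Q ⟶ R) : ∀ k, endX Q k ⟶ endX R k
  | 0 => f
  | 1 => f
  | _ + 2 => 0

/-- The binary complex `⋯ ⇉ 0 ⇉ Q ⇉ Q` with top differential `a` and bottom differential `1`. -/
def ofEnd {Q : C} (a : Q ⟶ Q) : BinaryComplex C where
  X := endX Q
  dTop := endD a
  dBot := endD (𝟙 Q)
  dTop_comp _ := zero_comp
  dBot_comp _ := zero_comp

theorem endF_comm {Q R : C} (a : Q ⟶ Q) (b : R ⟶ R) (f : Q ⟶ R) (h : a ≫ f = f ≫ b) (k : ℕ) :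
    endD a k ≫ endF f k = endF f (k + 1) ≫ endD b k :=
  match k with
  | 0 => h
  | _ + 1 => zero_comp.trans comp_zero.symm

/-- Functoriality of `ofEnd`. -/
def ofEndMap {Q R : C} (a : Q ⟶ Q) (b : R ⟶ R) (f : Q ⟶ R) (h : a ≫ f = f ≫ b) :
    ofEnd a ⟶ ofEnd b where
  f := endF f
  commTop := endF_comm a b f h
  commBot := endF_comm (𝟙 Q) (𝟙 R) f (by simp)

end BinaryComplex

theorem Amb.hasZeroObject (A : Amb.{u}) : HasZeroObject A.carrier :=
  hasZeroObject_of_hasInitial_object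

attribute [instance] Amb.hasZeroObject

/-- The functor `(P; A_1, …, A_n) ↦ [P; A_1, …, A_n]` to `n`-dimensional binary multicomplexes. The
multicomplex has `P` at all vertices of the `n`-cube `{0,1}ⁿ` and `0` elsewhere, and in direction
`i` the top and bottom differentials are `A_i` and `1`. -/
def cube (X : Scheme.{u}) : ∀ n : ℕ, CommAut X.Modules n ⥤ Multi X n
  | 0 =>
    { obj := fun P => P.obj
      map := fun f => f.hom }
  | n + 1 =>
    { obj := fun P => BinaryComplex.ofEnd ((cube X n).map P.lastEnd)
      map := fun {P Q} f =>
        BinaryComplex.ofEndMap _ _ ((cube X n).map (CommAut.init.map f)) (by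
          rw [← Functor.map_comp, ← Functor.map_comp, CommAut.lastEnd_naturality])
      map_id := fun P => BinaryComplex.hom_ext fun k => by
        match k with
        | 0 => exact (cube X n).map_id _
        | 1 => exact (cube X n).map_id _
        | k + 2 => exact (isZero_zero _).eq_of_src _ _
      map_comp := fun f g => BinaryComplex.hom_ext fun k => by
        match k with
        | 0 => exact (cube X n).map_comp (CommAut.init.map f) (CommAut.init.map g)
        | 1 => exact (cube X n).map_comp (CommAut.init.map f) (CommAut.init.map g)
        | k + 2 => exact (isZero_zero _).eq_of_src _ _ }

/-! ### Cross-effects -/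

section

variable {C : Type u} [Category.{v} C] [Abelian C] (k : ℕ)

/-- `(P_1, P_2, P_3, …) ↦ (P_1 ⊕ P_2, P_3, …)`. -/
def merge : (Fin (k + 2) → C) ⥤ (Fin (k + 1) → C) :=
  Functor.pi' (Fin.cons (Pi.eval _ 0 ⊞ Pi.eval _ 1) fun j => Pi.eval _ j.succ.succ)

/-- `(P_1, P_2, P_3, …) ↦ (P_1, P_3, …)`. -/
def dropSnd : (Fin (k + 2) → C) ⥤ (Fin (k + 1) → C) :=
  Functor.pi' (Fin.cons (Pi.eval _ 0) fun j => Pi.eval _ j.succ.succ)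

/-- `(P_1, P_2, P_3, …) ↦ (P_2, P_3, …)`. -/
def dropFst : (Fin (k + 2) → C) ⥤ (Fin (k + 1) → C) :=
  Functor.pi' (Fin.cons (Pi.eval _ 1) fun j => Pi.eval _ j.succ.succ)

/-- The projection `(P_1 ⊕ P_2, P_3, …) ⟶ (P_1, P_3, …)`. -/
def mergeFst : merge (C := C) k ⟶ dropSnd k :=
  NatTrans.pi' (Fin.cases (biprod.fst : Pi.eval (fun _ : Fin (k + 2) => C) 0 ⊞ Pi.eval _ 1 ⟶ _)
    fun j => 𝟙 (Pi.eval (fun _ : Fin (k + 2) => C) j.succ.succ))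

/-- The projection `(P_1 ⊕ P_2, P_3, …) ⟶ (P_2, P_3, …)`. -/
def mergeSnd : merge (C := C) k ⟶ dropFst k :=
  NatTrans.pi' (Fin.cases (biprod.snd : Pi.eval (fun _ : Fin (k + 2) => C) 0 ⊞ Pi.eval _ 1 ⟶ _)
    fun j => 𝟙 (Pi.eval (fun _ : Fin (k + 2) => C) j.succ.succ))

/-- The cross-effects of `F`: `crossEffect F k` is `cr_{k+1} F`, a functor of `k + 1` variables.
One has `cr_1 F = F`, and `cr_{i+1} F (P_1, P_2, P_3, …)` is the canonical complement of
`cr_i F (P_1, P_3, …) ⊕ cr_i F (P_2, P_3, …)` in `cr_i F (P_1 ⊕ P_2, P_3, …)`, that is the kernel of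
the map to this direct sum induced by the two projections. -/
def crossEffect {D : Type u} [Category.{v} D] [Abelian D] (F : C ⥤ D) :
    ∀ k : ℕ, (Fin (k + 1) → C) ⥤ D
  | 0 => Pi.eval _ 0 ⋙ F
  | k + 1 => kernel (biprod.lift (Functor.whiskerRight (mergeFst k) (crossEffect F k))
      (Functor.whiskerRight (mergeSnd k) (crossEffect F k)))

end

/-- The automorphism `(a_1, …, a_m)` of `(P, …, P)`. -/
def tupleAut {C : Type u} [Category.{v} C] {P : C} {m : ℕ} (a : Fin m → Aut P) :
    Aut (fun _ : Fin m => P) :=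
  Pi.isoMk a

/-- For `F = cr_{k+1} Λ^r`: the object `F(P, …, P)` together with the automorphisms
`F(A_1, 1, …, 1)` and `F(A_j, …, A_j)` for `j ≥ 2`. (Indices start at `0` in the code.) -/
def crossEffectAut (X : Scheme.{u}) (r k : ℕ) {n : ℕ} (P : CommAut X.Modules n) :
    CommAut X.Modules n where
  obj := (crossEffect (extPow X r) k).obj fun _ => P.obj
  aut j := (crossEffect (extPow X r) k).mapAut (fun _ => P.obj)
    (tupleAut fun t => if (j : ℕ) = 0 ∧ (t : ℕ) ≠ 0 then 1 else P.aut j)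
  comm i j := by
    refine Commute.map ?_ _
    refine Iso.ext (funext fun t => ?_)
    have h : Commute (if (i : ℕ) = 0 ∧ (t : ℕ) ≠ 0 then 1 else P.aut i)
        (if (j : ℕ) = 0 ∧ (t : ℕ) ≠ 0 then 1 else P.aut j) := by
      split_ifs
      · exact Commute.one_left _
      · exact Commute.one_left _
      · exact Commute.one_right _
      · exact P.comm i j
    exact congrArg Iso.hom h.eq

end

end GraysonK

/-!
The proof never computes in `K_n(X)` directly. It works with an arbitrary *additive invariant* `χ`
(`Inv`): a function on the objects of an exact category with directions that is additive on short
exact sequences and vanishes on diagonal objects. The class in `K_n(X)` is such an invariant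
(`clsInv`). The main result on invariants, `Inv.val_extMulti`, is stated for diagrams of arbitrary
shape; this is what makes the induction on `n` possible.

*Two-term complexes.* A binary complex `Y ⟶ Y ⊕ Y ⟶ Y` has two filtrations with two-term
subquotients (`Inv.val_threeTerm`). Comparing them gives `χ[Y; ab] = χ[Y; a] + χ[Y; b]`, and shows
that a shift changes the sign of the value on a two-term complex.

*The case `n = 1`, for a functor `F` of finite degree with `F(0) = 0`.* For an automorphism `a` of
`W`, the `m`-simplices of `Γ[W; a]` form the direct sum of `m + 1` copies of `W`, for which the
components are the vertex `0` and the differences of successive vertices. On the last `m + 1`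
summands of the `(m + 1)`-simplices, the face `δ_0` is `a ⊕ 1 ⊕ ⋯ ⊕ 1`, while the other faces have
first component zero (`gamIncl_gamδ_zero`, `gamIncl_gamδ_succ`). Let `V_m` be the image of the
inclusion-exclusion projector on `F(W^{m+1})`, that is, the cross-effect in `m + 1` variables. Then
`N F Γ[W; a]` is `V_m ⊕ V_{m+1}` in degree `m + 1` (`SimplicialPower.peeling`), and it is filtered
by the two-term complexes `[V_m; a]`, shifted by `m`. Put `f(t) = χ[F(W^{t+1}); F(a ⊕ 1 ⊕ ⋯ ⊕ 1)]`.
By inclusion-exclusion, the value on `[V_m; a]` is the iterated difference `Δ^m f(0)`. Hence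
`χ(N F Γ[W; a]) = ∑_{m<r} (-1)^m Δ^m f(0)` (`Inv.val_normDiagram`). The recursive definition of the
cross-effects shows that `Δ^m f(0)` is also the value on `cr_{m+1} F(W, …, W)` with `a` acting on
the first variable (`Inv.val_crossEffect`).

*The induction on `n`.* By `Inv.val_normDiagram_functor`, for a two-term complex of two-term
complexes given by commuting automorphisms `a` and `b`, the value on `N (N H Γ) Γ` is the same as
the value on the two-term complex obtained by applying `N H Γ` termwise. The reason is that
`N (N H Γ) Γ` leads to an iterated alternating sum of the values for the automorphisms `a` on a row and `b`
on a column of a `(t + 1) × (s + 1)`-grid of copies of `W`. These values are biadditive and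
invariant under permutations of the grid, so that they depend only on the numbers of entries of the
grid and of the intersection of the row and the column (`biadditive_grid`). They are therefore equal
to `φ((t + 1)(s + 1) - 1)`, where `φ(N)` is the value for `a` on the first one of `N + 1` copies and
`b` on all of them. As `φ` is polynomial and the alternating sum is the evaluation at `-1`, the
iterated sum equals the simple one (`altSum_altSum`). Consequently the functor can be applied to the
first `n - 1` directions only, while the last automorphism is carried along as part of the diagram,
which now has the shape `Loop J`.

*The sheaves.* What is needed about locally free sheaves of finite rank is that they are stable
under direct summands, split extensions and exterior powers. This is shown by means of local bases
(`IsBasisOn`). The functor `Λ^r` has degree at most `r` since it comes from an alternating map in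
`r` variables (`degreeLE_extPow`).
-/

namespace GraysonK
noncomputable section

/-! ### Exact structures and additive invariants -/

attribute [local instance] HasFiniteBiproducts.of_hasFiniteCoproducts

/-- The sequence `P ⟶ Q ⟶ R` is split exact. -/
def IsSplit {B : Type*} [Category* B] [Preadditive B] {P Q R : B} (f : P ⟶ Q) (g : Q ⟶ R) : Prop :=
  f ≫ g = 0 ∧ ∃ (r : Q ⟶ P) (s : R ⟶ Q), f ≫ r = 𝟙 P ∧ s ≫ g = 𝟙 R ∧ r ≫ f + g ≫ s = 𝟙 Q

/-- The part of an exact category with directions that matters for additive invariants: a class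
of good objects, a notion of short exact sequence that contains the split ones, and, for every
direction `i`, the class of objects that are diagonal in the direction `i`. -/
structure ExactData (B : Type*) [Category* B] [Preadditive B] where
  good : B → Prop
  ses : ∀ {P Q R : B}, (P ⟶ Q) → (Q ⟶ R) → Prop
  dir : Type
  isDiag : dir → B → Prop
  good_of_retract : ∀ {P Q : B} (i : P ⟶ Q) (p : Q ⟶ P), i ≫ p = 𝟙 P → good Q → good P
  good_of_isZero : ∀ {P : B}, IsZero P → good P
  good_of_isSplit : ∀ {P Q R : B} (f : P ⟶ Q) (g : Q ⟶ R), IsSplit f g → good P → good R → good Q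
  ses_of_isSplit : ∀ {P Q R : B} (f : P ⟶ Q) (g : Q ⟶ R), IsSplit f g → ses f g
  isDiag_of_isZero : ∀ (i : dir) {P : B}, IsZero P → isDiag i P

theorem ExactData.good_of_iso {B : Type*} [Category* B] [Preadditive B] (E : ExactData B) {P Q : B}
    (e : P ≅ Q) (h : E.good Q) : E.good P :=
  E.good_of_retract e.hom e.inv e.hom_inv_id h

/-- An additive invariant: additive on short exact sequences of good objects, and zero on good
diagonal objects. -/
structure Inv {B : Type*} [Category* B] [Preadditive B] (E : ExactData B)
    (A : Type*) [AddCommGroup A] where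
  val : B → A
  add : ∀ {P Q R : B} (f : P ⟶ Q) (g : Q ⟶ R), E.good P → E.good Q → E.good R → E.ses f g →
    val Q = val P + val R
  diag : ∀ (i : E.dir) (P : B), E.good P → E.isDiag i P → val P = 0

section

variable {B : Type*} [Category* B] [Preadditive B] {E : ExactData B}
  {A : Type*} [AddCommGroup A] (χ : Inv E A)

theorem isSplit_of_isIso_left {P Q R : B} (f : P ⟶ Q) (g : Q ⟶ R) [IsIso f] (h : IsZero R) :
    IsSplit f g :=
  ⟨h.eq_of_tgt _ _, inv f, 0, by simp, h.eq_of_src _ _, by simp⟩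

theorem isSplit_of_isIso_right {P Q R : B} (f : P ⟶ Q) (g : Q ⟶ R) [IsIso g] (h : IsZero P) :
    IsSplit f g :=
  ⟨h.eq_of_src _ _, 0, inv g, h.eq_of_src _ _, by simp, by simp⟩

theorem isSplit_of_isZero {P Q R : B} (f : P ⟶ Q) (g : Q ⟶ R) (h1 : IsZero P) (h2 : IsZero Q)
    (h3 : IsZero R) : IsSplit f g :=
  ⟨h1.eq_of_src _ _, 0, 0, h1.eq_of_src _ _, h3.eq_of_src _ _, h2.eq_of_src _ _⟩

theorem Inv.val_isZero {P : B} (h : IsZero P) : χ.val P = 0 := by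
  have hg := E.good_of_isZero h
  have := χ.add (𝟙 P) (𝟙 P) hg hg hg (E.ses_of_isSplit _ _ (isSplit_of_isIso_left _ _ h))
  simpa using this

open ZeroObject in
theorem Inv.val_iso [HasZeroObject B] {P Q : B} (e : P ≅ Q) (h : E.good Q) :
    χ.val P = χ.val Q := by
  have h0 : IsZero (0 : B) := isZero_zero B
  have := χ.add e.hom (0 : Q ⟶ (0 : B)) (E.good_of_iso e h) h (E.good_of_isZero h0)
    (E.ses_of_isSplit _ _ (isSplit_of_isIso_left _ _ h0))
  rw [this, χ.val_isZero h0, add_zero]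

end

/-! ### Contractible complexes and binary complexes -/

/-- The complex `⋯ ⟶ X 1 ⟶ X 0` has a contracting homotopy. -/
def Contractible {B : Type*} [Category* B] [Preadditive B] (X : ℕ → B)
    (d : ∀ k, X (k + 1) ⟶ X k) : Prop :=
  ∃ h : ∀ k, X k ⟶ X (k + 1), h 0 ≫ d 0 = 𝟙 _ ∧
    ∀ k, d k ≫ h k + h (k + 1) ≫ d (k + 1) = 𝟙 _

section

variable {B : Type*} [Category* B] [Preadditive B]

theorem Contractible.retract {X Y : ℕ → B} {d : ∀ k, X (k + 1) ⟶ X k} {d' : ∀ k, Y (k + 1) ⟶ Y k}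
    (i : ∀ k, X k ⟶ Y k) (p : ∀ k, Y k ⟶ X k) (hip : ∀ k, i k ≫ p k = 𝟙 _)
    (hi : ∀ k, d k ≫ i k = i (k + 1) ≫ d' k) (hp : ∀ k, d' k ≫ p k = p (k + 1) ≫ d k)
    (H : Contractible Y d') : Contractible X d := by
  obtain ⟨h, h0, hs⟩ := H
  refine ⟨fun k => i k ≫ h k ≫ p (k + 1), ?_, fun k => ?_⟩
  · rw [Category.assoc, Category.assoc, ← hp, reassoc_of% h0, hip]
  · calc _ = i (k + 1) ≫ (d' k ≫ h k + h (k + 1) ≫ d' (k + 1)) ≫ p (k + 1) := by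
          simp only [Preadditive.add_comp, Preadditive.comp_add, Category.assoc, ← hp,
            reassoc_of% hi k]
      _ = _ := by rw [hs, Category.id_comp, hip]

/-- A degreewise split extension of contractible complexes is contractible: the homotopies of the
ends give an operator `t` of degree one for which `d t + t d` is unipotent. -/
theorem Contractible.ext {X Y Z : ℕ → B} {dX : ∀ k, X (k + 1) ⟶ X k} {dY : ∀ k, Y (k + 1) ⟶ Y k}
    {dZ : ∀ k, Z (k + 1) ⟶ Z k} (f : ∀ k, X k ⟶ Y k) (g : ∀ k, Y k ⟶ Z k)
    (hfg : ∀ k, IsSplit (f k) (g k)) (dY2 : ∀ k, dY (k + 1) ≫ dY k = 0)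
    (hf : ∀ k, dX k ≫ f k = f (k + 1) ≫ dY k) (hg : ∀ k, dY k ≫ g k = g (k + 1) ≫ dZ k)
    (HX : Contractible X dX) (HZ : Contractible Z dZ) : Contractible Y dY := by
  obtain ⟨hX, hX0, hXs⟩ := HX
  obtain ⟨hZ, hZ0, hZs⟩ := HZ
  choose hfg0 r s hr hs hrs using hfg
  let t (k) : Y k ⟶ Y (k + 1) := r k ≫ hX k ≫ f (k + 1) + g k ≫ hZ k ≫ s (k + 1)
  have hft (k) : f k ≫ t k = hX k ≫ f (k + 1) := by
    simp [t, reassoc_of% hr, reassoc_of% hfg0]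
  have htg (k) : t k ≫ g (k + 1) = g k ≫ hZ k := by
    simp [t, hs, hfg0]
  -- a morphism that induces the identity on the ends is unipotent
  have uni {k} (φ : Y k ⟶ Y k) (h1 : f k ≫ φ = f k) (h2 : φ ≫ g k = g k) :
      φ ≫ (𝟙 _ + 𝟙 _ - φ) = 𝟙 _ := by
    have e1 : f k ≫ (φ - 𝟙 _) = 0 := by simp [h1]
    have e2 : (φ - 𝟙 _) ≫ g k = 0 := by simp [h2]
    have e3 : (φ - 𝟙 _) ≫ (φ - 𝟙 _) = 0 := by
      calc _ = (φ - 𝟙 _) ≫ (r k ≫ f k + g k ≫ s k) ≫ (φ - 𝟙 _) := by rw [hrs, Category.id_comp]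
        _ = 0 := by
          rw [Preadditive.add_comp, Preadditive.comp_add, Category.assoc, e1, Category.assoc,
            reassoc_of% e2]
          simp
    simp only [Preadditive.comp_sub, Preadditive.sub_comp, Preadditive.comp_add,
      Category.comp_id, Category.id_comp] at e3 ⊢
    rw [← sub_eq_zero, ← neg_eq_zero, ← e3]
    abel
  let φ0 : Y 0 ⟶ Y 0 := t 0 ≫ dY 0
  let φ (k) : Y (k + 1) ⟶ Y (k + 1) := dY k ≫ t k + t (k + 1) ≫ dY (k + 1)
  have u0 : φ0 ≫ (𝟙 _ + 𝟙 _ - φ0) = 𝟙 _ := by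
    refine uni _ ?_ ?_
    · simp only [φ0, reassoc_of% hft]
      rw [← hf, reassoc_of% hX0]
    · simp only [φ0, Category.assoc, hg]
      rw [reassoc_of% htg, hZ0, Category.comp_id]
  have u (k) : φ k ≫ (𝟙 _ + 𝟙 _ - φ k) = 𝟙 _ := by
    refine uni _ ?_ ?_
    · simp only [φ, Preadditive.comp_add, reassoc_of% hft]
      rw [← reassoc_of% hf, hft, ← hf, ← Category.assoc, ← Category.assoc, ← Preadditive.add_comp,
        hXs, Category.id_comp]
    · simp only [φ, Preadditive.add_comp, Category.assoc, hg, htg]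
      rw [reassoc_of% hg, reassoc_of% htg, ← Preadditive.comp_add, hZs, Category.comp_id]
  have c0 : dY 0 ≫ φ0 = φ 0 ≫ dY 0 := by
    simp [φ0, φ, dY2]
  have c (k) : dY (k + 1) ≫ φ k = φ (k + 1) ≫ dY (k + 1) := by
    simp [φ, dY2, reassoc_of% dY2]
  refine ⟨fun k => t k ≫ (𝟙 _ + 𝟙 _ - φ k), ?_, fun k => ?_⟩
  · have : (𝟙 _ + 𝟙 _ - φ 0) ≫ dY 0 = dY 0 ≫ (𝟙 _ + 𝟙 _ - φ0) := by
      simp [Preadditive.comp_sub, Preadditive.sub_comp, c0]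
    rw [Category.assoc, this, ← Category.assoc]
    exact u0
  · have : (𝟙 _ + 𝟙 _ - φ (k + 1)) ≫ dY (k + 1) = dY (k + 1) ≫ (𝟙 _ + 𝟙 _ - φ k) := by
      simp [Preadditive.comp_sub, Preadditive.sub_comp, c]
    rw [Category.assoc, this, ← Category.assoc, ← Category.assoc, ← Preadditive.add_comp]
    exact u k

namespace BinaryComplex

variable {P Q R : BinaryComplex B}

theorem sum_f {ι : Type*} (s : Finset ι) (a : ι → (P ⟶ Q)) (k : ℕ) :
    (∑ i ∈ s, a i).f k = ∑ i ∈ s, (a i).f k :=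
  map_sum (AddMonoidHom.mk' (fun a : P ⟶ Q => a.f k) fun _ _ => rfl) a s

/-- Isomorphisms of binary complexes from isomorphisms in every degree. -/
def isoMk (e : ∀ k, P.X k ≅ Q.X k) (h1 : ∀ k, P.dTop k ≫ (e k).hom = (e (k + 1)).hom ≫ Q.dTop k)
    (h2 : ∀ k, P.dBot k ≫ (e k).hom = (e (k + 1)).hom ≫ Q.dBot k) : P ≅ Q where
  hom := { f := fun k => (e k).hom, commTop := h1, commBot := h2 }
  inv :=
    { f := fun k => (e k).inv
      commTop := fun k => by rw [Iso.eq_inv_comp, ← reassoc_of% h1, Iso.hom_inv_id, Category.comp_id]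
      commBot := fun k => by rw [Iso.eq_inv_comp, ← reassoc_of% h2, Iso.hom_inv_id, Category.comp_id] }
  hom_inv_id := by ext k; simp
  inv_hom_id := by ext k; simp

theorem isZero_X (h : IsZero P) (k : ℕ) : IsZero (P.X k) := by
  rw [IsZero.iff_id_eq_zero] at h ⊢
  exact congrArg (fun f => Hom.f f k) h

theorem isZero_of_X (h : ∀ k, IsZero (P.X k)) : IsZero P := by
  rw [IsZero.iff_id_eq_zero]
  ext k
  exact (h k).eq_of_src _ _

theorem isSplit_f {f : P ⟶ Q} {g : Q ⟶ R} (h : IsSplit f g) (k : ℕ) : IsSplit (f.f k) (g.f k) := by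
  obtain ⟨h0, r, s, h1, h2, h3⟩ := h
  exact ⟨congrArg (fun f => Hom.f f k) h0, r.f k, s.f k, congrArg (fun f => Hom.f f k) h1,
    congrArg (fun f => Hom.f f k) h2, congrArg (fun f => Hom.f f k) h3⟩

end BinaryComplex

/-- The binary complex is bounded, has good terms and is contractible with respect to both
differentials. -/
def ExactData.BinaryGood (E : ExactData B) (P : BinaryComplex B) : Prop :=
  (∀ k, E.good (P.X k)) ∧ (∃ N, ∀ k, N ≤ k → IsZero (P.X k)) ∧
    Contractible P.X P.dTop ∧ Contractible P.X P.dBot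

theorem ExactData.BinaryGood.ext {E : ExactData B} {P Q R : BinaryComplex B} (f : P ⟶ Q)
    (g : Q ⟶ R) (hs : ∀ k, IsSplit (f.f k) (g.f k)) (hP : E.BinaryGood P)
    (hR : E.BinaryGood R) : E.BinaryGood Q := by
  obtain ⟨h1, ⟨N, hN⟩, h2, h3⟩ := hP
  obtain ⟨h1', ⟨N', hN'⟩, h2', h3'⟩ := hR
  refine ⟨fun k => E.good_of_isSplit _ _ (hs k) (h1 k) (h1' k),
    ⟨max N N', fun k hk => ?_⟩, ?_, ?_⟩
  · obtain ⟨_, r, s, _, _, e⟩ := hs k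
    rw [IsZero.iff_id_eq_zero, ← e, (hN k (le_trans (le_max_left _ _) hk)).eq_of_tgt r 0,
      (hN' k (le_trans (le_max_right _ _) hk)).eq_of_src s 0]
    simp
  · exact Contractible.ext f.f g.f hs Q.dTop_comp f.commTop g.commTop h2 h2'
  · exact Contractible.ext f.f g.f hs Q.dBot_comp f.commBot g.commBot h3 h3'

/-- The exact structure on binary complexes; short exact sequences are defined degreewise. The
direction `none` is the new one. Contractibility is used in place of acyclicity, since all complexes
that occur below are contractible; see `Contractible.isAcyclic`. -/
def ExactData.binary (E : ExactData B) : ExactData (BinaryComplex B) where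
  good := E.BinaryGood
  ses f g := ∀ k, E.ses (f.f k) (g.f k)
  dir := Option E.dir
  isDiag o P := match o with
    | none => P.dTop = P.dBot
    | some i => ∀ k, E.isDiag i (P.X k)
  good_of_retract {P Q} i p h hQ := by
    have h' (k) : i.f k ≫ p.f k = 𝟙 _ := congrArg (fun f => BinaryComplex.Hom.f f k) h
    obtain ⟨h1, ⟨N, hN⟩, h2, h3⟩ := hQ
    refine ⟨fun k => E.good_of_retract _ _ (h' k) (h1 k), ⟨N, fun k hk => ?_⟩, ?_, ?_⟩
    · rw [IsZero.iff_id_eq_zero, ← h' k, (hN k hk).eq_of_tgt (i.f k) 0, zero_comp]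
    · exact h2.retract i.f p.f h' i.commTop p.commTop
    · exact h3.retract i.f p.f h' i.commBot p.commBot
  good_of_isZero {P} h :=
    have hz := BinaryComplex.isZero_X h
    ⟨fun k => E.good_of_isZero (hz k), ⟨0, fun k _ => hz k⟩,
      ⟨fun _ => 0, (hz _).eq_of_src _ _, fun _ => (hz _).eq_of_src _ _⟩,
      ⟨fun _ => 0, (hz _).eq_of_src _ _, fun _ => (hz _).eq_of_src _ _⟩⟩
  good_of_isSplit f g h := .ext f g (BinaryComplex.isSplit_f h)
  ses_of_isSplit f g h k := E.ses_of_isSplit _ _ (BinaryComplex.isSplit_f h k)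
  isDiag_of_isZero o P h := match o with
    | none => funext fun _ => (BinaryComplex.isZero_X h _).eq_of_src _ _
    | some i => fun k => E.isDiag_of_isZero i (BinaryComplex.isZero_X h k)

/-- Additivity only requires that the extension is split in every degree; the complex in the middle
is then automatically good. -/
theorem Inv.val_degreewise {E : ExactData B} {A : Type*} [AddCommGroup A] (χ : Inv E.binary A)
    {P Q R : BinaryComplex B} (f : P ⟶ Q) (g : Q ⟶ R) (hs : ∀ k, IsSplit (f.f k) (g.f k))
    (hP : E.binary.good P) (hR : E.binary.good R) : χ.val Q = χ.val P + χ.val R :=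
  χ.add f g hP (ExactData.BinaryGood.ext f g hs hP hR) hR fun k => E.ses_of_isSplit _ _ (hs k)

end

end
end GraysonK

namespace GraysonK
noncomputable section

/-! ### Two-term complexes, shifts and filtrations -/

open ZeroObject

/-- A functor that preserves good objects, short exact sequences and diagonality (in the sense of
the map `t` on directions). -/
structure ExactData.Preserves {B B' : Type*} [Category* B] [Preadditive B] [Category* B']
    [Preadditive B'] (E : ExactData B) (E' : ExactData B') (Ψ : B ⥤ B') (t : E.dir → E'.dir) :
    Prop where
  good : ∀ P, E.good P → E'.good (Ψ.obj P)
  ses : ∀ {P Q R : B} (f : P ⟶ Q) (g : Q ⟶ R), E.good P → E.good Q → E.good R → E.ses f g →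
    E'.ses (Ψ.map f) (Ψ.map g)
  diag : ∀ (i : E.dir) (P : B), E.good P → E.isDiag i P → E'.isDiag (t i) (Ψ.obj P)

/-- The pullback of an additive invariant along an exact functor. -/
def Inv.comap {B B' : Type*} [Category* B] [Preadditive B] [Category* B'] [Preadditive B']
    {E : ExactData B} {E' : ExactData B'} {A : Type*} [AddCommGroup A] (χ : Inv E' A)
    (Ψ : B ⥤ B') (t : E.dir → E'.dir) (h : E.Preserves E' Ψ t) : Inv E A where
  val P := χ.val (Ψ.obj P)
  add f g hP hQ hR hs := χ.add _ _ (h.good _ hP) (h.good _ hQ) (h.good _ hR) (h.ses f g hP hQ hR hs)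
  diag i P hP hd := χ.diag (t i) _ (h.good _ hP) (h.diag i P hP hd)

section

variable {B : Type*} [Category* B] [Preadditive B] [HasBinaryBiproducts B]

theorem isSplit_inl_snd (Y Z : B) : IsSplit (biprod.inl : Y ⟶ Y ⊞ Z) biprod.snd :=
  ⟨by simp, biprod.fst, biprod.inr, by simp, by simp, biprod.total⟩

theorem isSplit_inr_fst (Y Z : B) : IsSplit (biprod.inr : Z ⟶ Y ⊞ Z) biprod.fst :=
  ⟨by simp, biprod.snd, biprod.inl, by simp, by simp, (add_comm _ _).trans biprod.total⟩

end

theorem isSplit_id_zero {B : Type*} [Category* B] [Preadditive B] (Y : B) {Z : B} (h : IsZero Z)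
    (g : Y ⟶ Z) : IsSplit (𝟙 Y) g :=
  isSplit_of_isIso_left _ _ h

section

variable {B : Type*} [Category* B] [Preadditive B]

/-- A presentation of the terms of a binary complex as `N_{m+1} = V_m ⊕ V_{m+1}`, `N_0 = V_0`, with
injections `k`, `s` and projections `r`, `q`, in such a way that the component `V_m ⟶ V_m` of the
bottom differential `N_{m+1} ⟶ N_m` is the identity. -/
structure Peeling (N : BinaryComplex B) (V : ℕ → B) where
  q (m : ℕ) : N.X m ⟶ V m
  k (m : ℕ) : V m ⟶ N.X (m + 1)
  r (m : ℕ) : N.X (m + 1) ⟶ V m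
  s (m : ℕ) : V m ⟶ N.X m
  k_r (m : ℕ) : k m ≫ r m = 𝟙 _
  s_q (m : ℕ) : s m ≫ q m = 𝟙 _
  k_q (m : ℕ) : k m ≫ q (m + 1) = 0
  total (m : ℕ) : r m ≫ k m + q (m + 1) ≫ s (m + 1) = 𝟙 _
  total_zero : q 0 ≫ s 0 = 𝟙 _
  bot (m : ℕ) : k m ≫ N.dBot m ≫ q m = 𝟙 _

namespace Peeling

variable {N : BinaryComplex B} {V : ℕ → B} (p : Peeling N V)

/-- The component `V_m ⟶ V_m` of the top differential. -/
def β (m : ℕ) : V m ⟶ V m := p.k m ≫ N.dTop m ≫ p.q m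

/-- The quotient of `N` by the two-term complex on `V_0`, shifted down. -/
def quotient : BinaryComplex B where
  X m := match m with
    | 0 => V 1
    | m + 1 => N.X (m + 2)
  dTop m := match m with
    | 0 => N.dTop 1 ≫ p.q 1
    | m + 1 => N.dTop (m + 2)
  dBot m := match m with
    | 0 => N.dBot 1 ≫ p.q 1
    | m + 1 => N.dBot (m + 2)
  dTop_comp m := match m with
    | 0 => (Category.assoc _ _ _).symm.trans ((congrArg (· ≫ _) (N.dTop_comp 1)).trans zero_comp)
    | m + 1 => N.dTop_comp (m + 2)
  dBot_comp m := match m with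
    | 0 => (Category.assoc _ _ _).symm.trans ((congrArg (· ≫ _) (N.dBot_comp 1)).trans zero_comp)
    | m + 1 => N.dBot_comp (m + 2)

/-- The induced presentation of the quotient. -/
def next : Peeling p.quotient (fun m => V (m + 1)) where
  q m := match m with
    | 0 => 𝟙 (V 1)
    | m + 1 => p.q (m + 2)
  k m := p.k (m + 1)
  r m := p.r (m + 1)
  s m := match m with
    | 0 => 𝟙 (V 1)
    | m + 1 => p.s (m + 2)
  k_r m := p.k_r (m + 1)
  s_q m := match m with
    | 0 => Category.id_comp (𝟙 (V 1))
    | m + 1 => p.s_q (m + 2)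
  k_q m := p.k_q (m + 1)
  total m := p.total (m + 1)
  total_zero := Category.id_comp (𝟙 (V 1))
  bot m := match m with
    | 0 => (congrArg (p.k 1 ≫ ·) (Category.comp_id _)).trans (p.bot 1)
    | m + 1 => p.bot (m + 2)

theorem β_next (m : ℕ) : p.next.β m = p.β (m + 1) := match m with
  | 0 => congrArg (p.k 1 ≫ ·) (Category.comp_id _)
  | _ + 1 => rfl

end Peeling

end

section

variable {B : Type*} [Category* B] [Preadditive B] [HasZeroObject B]

namespace BinaryComplex

/-- The shift of a binary complex by one degree, without signs. -/
def shift : BinaryComplex B ⥤ BinaryComplex B where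
  obj P :=
    { X := fun k => match k with
        | 0 => 0
        | k + 1 => P.X k
      dTop := fun k => match k with
        | 0 => 0
        | k + 1 => P.dTop k
      dBot := fun k => match k with
        | 0 => 0
        | k + 1 => P.dBot k
      dTop_comp := fun k => match k with
        | 0 => comp_zero
        | k + 1 => P.dTop_comp k
      dBot_comp := fun k => match k with
        | 0 => comp_zero
        | k + 1 => P.dBot_comp k }
  map f :=
    { f := fun k => match k with
        | 0 => 0
        | k + 1 => f.f k
      commTop := fun k => match k with
        | 0 => zero_comp.trans comp_zero.symm
        | k + 1 => f.commTop k
      commBot := fun k => match k with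
        | 0 => zero_comp.trans comp_zero.symm
        | k + 1 => f.commBot k }
  map_id _ := BinaryComplex.hom_ext fun k => match k with
    | 0 => (isZero_zero B).eq_of_src _ _
    | _ + 1 => rfl
  map_comp _ _ := BinaryComplex.hom_ext fun k => match k with
    | 0 => (isZero_zero B).eq_of_src _ _
    | _ + 1 => rfl

end BinaryComplex

theorem Contractible.shift (P : BinaryComplex B) :
    (Contractible P.X P.dTop → Contractible (BinaryComplex.shift.obj P).X
      (BinaryComplex.shift.obj P).dTop) ∧
    (Contractible P.X P.dBot → Contractible (BinaryComplex.shift.obj P).X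
      (BinaryComplex.shift.obj P).dBot) := by
  constructor
  all_goals
    rintro ⟨h, h0, hs⟩
    refine ⟨fun k => match k with
      | 0 => 0
      | k + 1 => h k, (isZero_zero B).eq_of_src _ _, fun k => ?_⟩
    match k with
    | 0 => exact (congrArg (· + _) comp_zero).trans ((zero_add _).trans h0)
    | k + 1 => exact hs k

theorem ExactData.preserves_shift (E : ExactData B) :
    E.binary.Preserves E.binary BinaryComplex.shift id where
  good P h := by
    obtain ⟨h1, ⟨N, hN⟩, h2, h3⟩ := h
    refine ⟨fun k => ?_, ⟨N + 1, fun k hk => ?_⟩, (Contractible.shift P).1 h2,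
      (Contractible.shift P).2 h3⟩
    · cases k with
      | zero => exact E.good_of_isZero (isZero_zero B)
      | succ k => exact h1 k
    · cases k with
      | zero => omega
      | succ k => exact hN k (by omega)
  ses f g _ _ _ h k := by
    cases k with
    | zero =>
      exact E.ses_of_isSplit (P := (0 : B)) (Q := (0 : B)) (R := (0 : B)) 0 0
        (isSplit_of_isZero _ _ (isZero_zero B) (isZero_zero B) (isZero_zero B))
    | succ k => exact h k
  diag i P _ h := by
    cases i with
    | none =>
      funext k
      cases k with
      | zero => rfl
      | succ k => exact congrFun h k
    | some i =>
      intro k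
      cases k with
      | zero => exact E.isDiag_of_isZero i (isZero_zero B)
      | succ k => exact h k

open BinaryComplex

theorem ExactData.good_ofEnd (E : ExactData B) {Q : B} (a : Q ⟶ Q) [IsIso a] (h : E.good Q) :
    E.binary.good (ofEnd a) := by
  have h0 : IsZero (0 : B) := isZero_zero B
  have key : ∀ (b : Q ⟶ Q), IsIso b → Contractible (endX Q) (endD b) := by
    rintro b ⟨c, hc, hc'⟩
    refine ⟨fun k => match k with
      | 0 => c
      | _ + 1 => 0, hc', fun k => ?_⟩
    match k with
    | 0 => exact (congrArg (_ + ·) zero_comp).trans ((add_zero _).trans hc)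
    | k + 1 => exact h0.eq_of_src _ _
  refine ⟨fun k => ?_, ⟨2, fun k hk => ?_⟩, key a inferInstance,
    key (𝟙 Q) inferInstance⟩
  · match k with
    | 0 => exact h
    | 1 => exact h
    | k + 2 => exact E.good_of_isZero h0
  · match k, hk with
    | k + 2, _ => exact h0

/-- Isomorphisms of two-term complexes. -/
def BinaryComplex.ofEndIso {Q R : B} (a : Q ⟶ Q) (b : R ⟶ R) (e : Q ≅ R)
    (h : a ≫ e.hom = e.hom ≫ b) : ofEnd a ≅ ofEnd b where
  hom := ofEndMap a b e.hom h
  inv := ofEndMap b a e.inv (by rw [Iso.eq_inv_comp, ← reassoc_of% h, e.hom_inv_id, Category.comp_id])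
  hom_inv_id := BinaryComplex.hom_ext fun k => match k with
    | 0 => e.hom_inv_id
    | 1 => e.hom_inv_id
    | _ + 2 => (isZero_zero B).eq_of_src _ _
  inv_hom_id := BinaryComplex.hom_ext fun k => match k with
    | 0 => e.inv_hom_id
    | 1 => e.inv_hom_id
    | _ + 2 => (isZero_zero B).eq_of_src _ _

variable {E : ExactData B} {A : Type*} [AddCommGroup A] (χ : Inv E.binary A)

theorem Inv.val_ofEnd_id {Y : B} (hY : E.good Y) : χ.val (ofEnd (𝟙 Y)) = 0 :=
  χ.diag none _ (E.good_ofEnd _ hY) rfl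

theorem Inv.val_shift_ofEnd_id {Y : B} (hY : E.good Y) : χ.val (shift.obj (ofEnd (𝟙 Y))) = 0 :=
  (χ.comap _ _ E.preserves_shift).val_ofEnd_id hY

section

variable [HasBinaryBiproducts B]

/-- The binary complex `Y ⟶ Y ⊞ Y ⟶ Y` with top differentials `(q', -p')` and `(p, q)`, and with
bottom differentials `(1, -1)` and `(1, 1)`. -/
def threeTerm {Y : B} (p q p' q' : Y ⟶ Y) (h : q' ≫ p = p' ≫ q) : BinaryComplex B where
  X k := match k with
    | 0 => Y
    | 1 => Y ⊞ Y
    | 2 => Y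
    | _ + 3 => 0
  dTop k := match k with
    | 0 => biprod.desc p q
    | 1 => biprod.lift q' (-p')
    | _ + 2 => 0
  dBot k := match k with
    | 0 => biprod.desc (𝟙 Y) (𝟙 Y)
    | 1 => biprod.lift (𝟙 Y) (-𝟙 Y)
    | _ + 2 => 0
  dTop_comp k := match k with
    | 0 => biprod.lift_desc.trans (by rw [h]; simp)
    | 1 => zero_comp
    | _ + 2 => zero_comp
  dBot_comp k := match k with
    | 0 => biprod.lift_desc.trans (by simp)
    | 1 => zero_comp
    | _ + 2 => zero_comp

/-- The complex `threeTerm` has two filtrations with two-term subquotients. -/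
theorem Inv.val_threeTerm {Y : B} (hY : E.good Y) (p q p' q' : Y ⟶ Y) [IsIso p] [IsIso q] [IsIso p']
    [IsIso q'] (h : q' ≫ p = p' ≫ q) :
    χ.val (ofEnd p) + χ.val (shift.obj (ofEnd p')) =
      χ.val (ofEnd q) + χ.val (shift.obj (ofEnd q')) := by
  have h0 : IsZero (0 : B) := isZero_zero B
  have good (a : Y ⟶ Y) [IsIso a] := E.good_ofEnd a hY
  have good' (a : Y ⟶ Y) [IsIso a] := E.preserves_shift.good _ (good a)
  let f1 : ofEnd p ⟶ threeTerm p q p' q' h :=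
    { f := fun k => match k with
        | 0 => 𝟙 Y
        | 1 => biprod.inl
        | _ + 2 => 0
      commTop := fun k => match k with
        | 0 => (Category.comp_id p).trans (biprod.inl_desc _ _).symm
        | 1 => h0.eq_of_src _ _
        | _ + 2 => h0.eq_of_src _ _
      commBot := fun k => match k with
        | 0 => (Category.comp_id _).trans (biprod.inl_desc _ _).symm
        | 1 => h0.eq_of_src _ _
        | _ + 2 => h0.eq_of_src _ _ }
  let g1 : threeTerm p q p' q' h ⟶ shift.obj (ofEnd p') :=
    { f := fun k => match k with
        | 0 => 0
        | 1 => biprod.snd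
        | 2 => -𝟙 Y
        | _ + 3 => 0
      commTop := fun k => match k with
        | 0 => h0.eq_of_tgt _ _
        | 1 => (biprod.lift_snd _ _).trans (by
            change _ = (-𝟙 Y) ≫ p'
            simp)
        | _ + 2 => h0.eq_of_src _ _
      commBot := fun k => match k with
        | 0 => h0.eq_of_tgt _ _
        | 1 => (biprod.lift_snd _ _).trans (by
            change _ = (-𝟙 Y) ≫ 𝟙 Y
            simp)
        | _ + 2 => h0.eq_of_src _ _ }
  let f2 : ofEnd q ⟶ threeTerm p q p' q' h :=
    { f := fun k => match k with
        | 0 => 𝟙 Y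
        | 1 => biprod.inr
        | _ + 2 => 0
      commTop := fun k => match k with
        | 0 => (Category.comp_id q).trans (biprod.inr_desc _ _).symm
        | 1 => h0.eq_of_src _ _
        | _ + 2 => h0.eq_of_src _ _
      commBot := fun k => match k with
        | 0 => (Category.comp_id _).trans (biprod.inr_desc _ _).symm
        | 1 => h0.eq_of_src _ _
        | _ + 2 => h0.eq_of_src _ _ }
  let g2 : threeTerm p q p' q' h ⟶ shift.obj (ofEnd q') :=
    { f := fun k => match k with
        | 0 => 0
        | 1 => biprod.fst
        | 2 => 𝟙 Y
        | _ + 3 => 0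
      commTop := fun k => match k with
        | 0 => h0.eq_of_tgt _ _
        | 1 => (biprod.lift_fst _ _).trans (Category.id_comp q').symm
        | _ + 2 => h0.eq_of_src _ _
      commBot := fun k => match k with
        | 0 => h0.eq_of_tgt _ _
        | 1 => (biprod.lift_fst _ _).trans (Category.id_comp _).symm
        | _ + 2 => h0.eq_of_src _ _ }
  have s1 (k) : IsSplit (f1.f k) (g1.f k) := match k with
    | 0 => isSplit_id_zero Y h0 _
    | 1 => isSplit_inl_snd Y Y
    | 2 => ⟨h0.eq_of_src _ _, 0, -𝟙 Y, h0.eq_of_src _ _,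
        show (-𝟙 Y) ≫ (-𝟙 Y) = 𝟙 Y by simp, show (0 : Y ⟶ (0 : B)) ≫ (0 : (0 : B) ⟶ Y) +
          (-𝟙 Y) ≫ (-𝟙 Y) = 𝟙 Y by simp⟩
    | _ + 3 => isSplit_of_isZero _ _ h0 h0 h0
  have s2 (k) : IsSplit (f2.f k) (g2.f k) := match k with
    | 0 => isSplit_id_zero Y h0 _
    | 1 => isSplit_inr_fst Y Y
    | 2 => ⟨h0.eq_of_src _ _, 0, 𝟙 Y, h0.eq_of_src _ _,
        show 𝟙 Y ≫ 𝟙 Y = 𝟙 Y by simp, show (0 : Y ⟶ (0 : B)) ≫ (0 : (0 : B) ⟶ Y) +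
          𝟙 Y ≫ 𝟙 Y = 𝟙 Y by simp⟩
    | _ + 3 => isSplit_of_isZero _ _ h0 h0 h0
  rw [← χ.val_degreewise f1 g1 s1 (good p) (good' p'),
    ← χ.val_degreewise f2 g2 s2 (good q) (good' q')]

/-- By `Inv.val_threeTerm` with differentials `(1, -a)` and `(a, 1)`. -/
theorem Inv.val_shift_ofEnd {Y : B} (hY : E.good Y) (a : Y ⟶ Y) [IsIso a] :
    χ.val (shift.obj (ofEnd a)) = -χ.val (ofEnd a) := by
  have h := χ.val_threeTerm hY a (𝟙 Y) a (𝟙 Y) (by simp)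
  rw [χ.val_ofEnd_id hY, χ.val_shift_ofEnd_id hY, add_zero] at h
  exact (neg_eq_of_add_eq_zero_right h).symm

/-- By `Inv.val_threeTerm` with differentials `(1, -a)` and `(ab, b)`. -/
theorem Inv.val_ofEnd_comp {Y : B} (hY : E.good Y) (a b : Y ⟶ Y) [IsIso a] [IsIso b] :
    χ.val (ofEnd (a ≫ b)) = χ.val (ofEnd a) + χ.val (ofEnd b) := by
  have h := χ.val_threeTerm hY (a ≫ b) b a (𝟙 Y) (by simp)
  rw [χ.val_shift_ofEnd_id hY, χ.val_shift_ofEnd hY, add_zero, ← sub_eq_add_neg,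
    sub_eq_iff_eq_add] at h
  rw [h, add_comm]

end

namespace Peeling

variable {N : BinaryComplex B} {V : ℕ → B} (p : Peeling N V)

/-- The inclusion of the two-term complex on `V_0`. -/
def incl : ofEnd (p.β 0) ⟶ N where
  f m := match m with
    | 0 => p.s 0
    | 1 => p.k 0
    | _ + 2 => 0
  commTop m := match m with
    | 0 => by
      change (p.k 0 ≫ N.dTop 0 ≫ p.q 0) ≫ p.s 0 = p.k 0 ≫ N.dTop 0
      simp [p.total_zero]
    | _ + 1 => (isZero_zero B).eq_of_src _ _
  commBot m := match m with
    | 0 => by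
      change 𝟙 _ ≫ p.s 0 = p.k 0 ≫ N.dBot 0
      rw [← p.bot 0]
      simp [p.total_zero]
    | _ + 1 => (isZero_zero B).eq_of_src _ _

/-- The projection to the quotient. -/
def toQuotient : N ⟶ shift.obj p.quotient where
  f m := match m with
    | 0 => 0
    | 1 => p.q 1
    | m + 2 => 𝟙 (N.X (m + 2))
  commTop m := match m with
    | 0 => (isZero_zero B).eq_of_tgt _ _
    | 1 => (Category.id_comp _).symm
    | _ + 2 => (Category.comp_id _).trans (Category.id_comp _).symm
  commBot m := match m with
    | 0 => (isZero_zero B).eq_of_tgt _ _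
    | 1 => (Category.id_comp _).symm
    | _ + 2 => (Category.comp_id _).trans (Category.id_comp _).symm

theorem isSplit_incl_toQuotient (m : ℕ) : IsSplit (p.incl.f m) (p.toQuotient.f m) := match m with
  | 0 => ⟨(isZero_zero B).eq_of_tgt _ _, p.q 0, 0, p.s_q 0, (isZero_zero B).eq_of_src _ _,
      (congrArg (p.q 0 ≫ p.s 0 + ·) zero_comp).trans ((add_zero _).trans p.total_zero)⟩
  | 1 => ⟨p.k_q 0, p.r 0, p.s 1, p.k_r 0, p.s_q 1, p.total 0⟩
  | m + 2 => isSplit_of_isIso_right (0 : (0 : B) ⟶ _) (𝟙 (N.X (m + 2))) (isZero_zero B)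

/-- A binary complex with a presentation as above is, up to degreewise split extensions, made up of
shifted two-term complexes. -/
theorem good_and_val [HasBinaryBiproducts B] {E : ExactData B} (p : Peeling N V) (L : ℕ)
    (hL : ∀ m, L ≤ m → IsZero (V m))
    (hV : ∀ m, E.good (V m)) (hβ : ∀ m, IsIso (p.β m)) :
    E.binary.good N ∧ ∀ {A : Type*} [AddCommGroup A] (χ : Inv E.binary A),
      χ.val N = ∑ m ∈ Finset.range L, (-1 : ℤ) ^ m • χ.val (ofEnd (p.β m)) := by
  induction L generalizing N V with
  | zero =>
    have hN : IsZero N := isZero_of_X fun m => by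
      rw [IsZero.iff_id_eq_zero]
      cases m with
      | zero =>
        rw [← p.total_zero, (hL 0 le_rfl).eq_of_tgt (p.q 0) 0, zero_comp]
      | succ m =>
        rw [← p.total m, (hL m (Nat.zero_le _)).eq_of_tgt (p.r m) 0,
          (hL (m + 1) (Nat.zero_le _)).eq_of_tgt (p.q (m + 1)) 0, zero_comp, zero_comp, add_zero]
    exact ⟨E.binary.good_of_isZero hN, fun χ => by rw [χ.val_isZero hN]; rfl⟩
  | succ L ih =>
    have := hβ 0
    have hβ' (m) : IsIso (p.next.β m) := by
      rw [β_next]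
      exact hβ _
    obtain ⟨h1, h2⟩ := ih p.next (fun m hm => hL _ (by omega)) (fun m => hV _) hβ'
    have h3 := E.preserves_shift.good _ h1
    have h4 := E.good_ofEnd (p.β 0) (hV 0)
    refine ⟨.ext p.incl p.toQuotient p.isSplit_incl_toQuotient h4 h3, fun χ => ?_⟩
    rw [χ.val_degreewise p.incl p.toQuotient p.isSplit_incl_toQuotient h4 h3,
      Finset.sum_range_succ', pow_zero, one_smul, add_comm]
    congr 1
    -- the induction hypothesis is applied to the invariant `χ ∘ shift`, which is `-χ` on two-term
    -- complexes
    refine (h2 (χ.comap _ _ E.preserves_shift)).trans (Finset.sum_congr rfl fun m _ => ?_)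
    have := hβ (m + 1)
    change (-1 : ℤ) ^ m • χ.val (shift.obj (ofEnd (p.next.β m))) = _
    rw [p.β_next, χ.val_shift_ofEnd (hV (m + 1)), pow_succ, mul_neg_one, neg_smul, smul_neg]

end Peeling

end

end
end GraysonK

namespace GraysonK
noncomputable section

/-! ### Splittings of idempotents and inclusion-exclusion -/

open BinaryComplex

/-- A splitting of an idempotent `e` as a retraction `π` followed by its section `ι`. -/
structure IdemSplit {B : Type*} [Category* B] {X : B} (e : X ⟶ X) where
  obj : B
  ι : obj ⟶ X
  π : X ⟶ obj
  ι_π : ι ≫ π = 𝟙 _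
  π_ι : π ≫ ι = e

namespace IdemSplit

section

variable {B : Type*} [Category* B] {X : B} {e : X ⟶ X} (s : IdemSplit e)

theorem π_ι_assoc {Y : B} (f : X ⟶ Y) : s.π ≫ s.ι ≫ f = e ≫ f := by
  rw [← Category.assoc, s.π_ι]

theorem ι_comp : s.ι ≫ e = s.ι := by
  refine (congrArg (s.ι ≫ ·) s.π_ι).symm.trans ?_
  exact (reassoc_of% s.ι_π) s.ι

theorem comp_π : e ≫ s.π = s.π := by
  refine (congrArg (· ≫ s.π) s.π_ι).symm.trans ?_
  rw [Category.assoc, s.ι_π, Category.comp_id]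

/-- The endomorphism of the splitting induced by an endomorphism of `X`. -/
def endo (α : X ⟶ X) : s.obj ⟶ s.obj := s.ι ≫ α ≫ s.π

theorem isIso_endo (α : X ⟶ X) [IsIso α] (h : α ≫ e = e ≫ α) : IsIso (s.endo α) := by
  have h' : inv α ≫ e = e ≫ inv α := by
    rw [IsIso.inv_comp_eq, ← Category.assoc, h, Category.assoc, IsIso.hom_inv_id, Category.comp_id]
  refine ⟨s.endo (inv α), ?_, ?_⟩
  · simp only [endo, Category.assoc, s.π_ι_assoc]
    rw [← reassoc_of% h', IsIso.hom_inv_id_assoc, s.comp_π, s.ι_π]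
  · simp only [endo, Category.assoc, s.π_ι_assoc]
    rw [← reassoc_of% h, IsIso.inv_hom_id_assoc, s.comp_π, s.ι_π]

end

variable {B : Type*} [Category* B] [Preadditive B] {X : B} {e : X ⟶ X}

/-- An idempotent splits if the cokernel of its complement exists. -/
def ofCokernel (h : e ≫ e = e) [HasCokernel (𝟙 X - e)] : IdemSplit e where
  obj := cokernel (𝟙 X - e)
  π := cokernel.π _
  ι := cokernel.desc _ e (by simp [h])
  ι_π := by
    have := cokernel.condition (𝟙 X - e)
    rw [Preadditive.sub_comp, Category.id_comp, sub_eq_zero] at this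
    ext
    simp [← this]
  π_ι := by simp

theorem isZero_obj (s : IdemSplit e) (h : e = 0) : IsZero s.obj := by
  subst h
  rw [IsZero.iff_id_eq_zero, ← s.ι_π, ← s.comp_π, zero_comp, comp_zero]

/-- The two-term complexes on the splittings of orthogonal idempotents add up. -/
theorem val_add [HasZeroObject B] {E : ExactData B} {A : Type*} [AddCommGroup A]
    (χ : Inv E.binary A) (hX : E.good X) (α : X ⟶ X) [IsIso α] {e₁ e₂ : X ⟶ X} (he : e = e₁ + e₂)
    (h₁₂ : e₁ ≫ e₂ = 0) (h₂₁ : e₂ ≫ e₁ = 0) (h₁ : α ≫ e₁ = e₁ ≫ α) (h₂ : α ≫ e₂ = e₂ ≫ α)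
    (s : IdemSplit e) (s₁ : IdemSplit e₁) (s₂ : IdemSplit e₂) :
    χ.val (ofEnd (s.endo α)) = χ.val (ofEnd (s₁.endo α)) + χ.val (ofEnd (s₂.endo α)) := by
  have i₁ := s₁.isIso_endo α h₁
  have i₂ := s₂.isIso_endo α h₂
  have a1 : s₁.ι ≫ e = s₁.ι := by
    rw [he, Preadditive.comp_add, s₁.ι_comp, ← s₁.ι_comp, Category.assoc, h₁₂]; simp [s₁.ι_comp]
  have a2 : e ≫ s₂.π = s₂.π := by
    rw [he, Preadditive.add_comp, s₂.comp_π, ← s₂.comp_π, reassoc_of% h₁₂]; simp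
  have b1 : e ≫ s₁.π = s₁.π := by
    rw [he, Preadditive.add_comp, s₁.comp_π, ← s₁.comp_π, reassoc_of% h₂₁]; simp
  have b2 : s₂.ι ≫ e = s₂.ι := by
    rw [he, Preadditive.comp_add, s₂.ι_comp, ← s₂.ι_comp, Category.assoc, h₂₁]; simp
  have c : s₁.ι ≫ s₂.π = 0 := by
    rw [← s₁.ι_comp, ← s₂.comp_π, Category.assoc, reassoc_of% h₁₂]; simp
  have hα : α ≫ e = e ≫ α := by rw [he, Preadditive.comp_add, h₁, h₂, Preadditive.add_comp]
  have sp : IsSplit (s₁.ι ≫ s.π) (s.ι ≫ s₂.π) := by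
    refine ⟨?_, s.ι ≫ s₁.π, s₂.ι ≫ s.π, ?_, ?_, ?_⟩
    · simp only [Category.assoc, s.π_ι_assoc, a2, c]
    · simp only [Category.assoc, s.π_ι_assoc, b1, s₁.ι_π]
    · simp only [Category.assoc, s.π_ι_assoc, a2, s₂.ι_π]
    · simp only [Category.assoc, s₁.π_ι_assoc, s₂.π_ι_assoc]
      rw [← Preadditive.comp_add, ← Preadditive.add_comp, ← he, s.comp_π, s.ι_π]
  have hg := E.good_of_retract s.ι s.π s.ι_π hX
  refine χ.val_degreewise (P := ofEnd (s₁.endo α)) (R := ofEnd (s₂.endo α))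
    (ofEndMap _ _ (s₁.ι ≫ s.π) ?_) (ofEndMap _ _ (s.ι ≫ s₂.π) ?_) (fun k => ?_)
    (E.good_ofEnd _ (E.good_of_retract s₁.ι s₁.π s₁.ι_π hX))
    (E.good_ofEnd _ (E.good_of_retract s₂.ι s₂.π s₂.ι_π hX))
  · simp only [endo, Category.assoc, s₁.π_ι_assoc, s.π_ι_assoc]
    rw [reassoc_of% h₁, reassoc_of% s₁.ι_comp, reassoc_of% a1]
  · simp only [endo, Category.assoc, s₂.π_ι_assoc, s.π_ι_assoc]
    rw [a2, ← reassoc_of% h₂, s₂.comp_π]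
  · match k with
    | 0 => exact sp
    | 1 => exact sp
    | k + 2 => exact isSplit_of_isZero _ _ (isZero_zero B) (isZero_zero B) (isZero_zero B)

end IdemSplit

/-- The alternating sum of `f` over the subsets obtained from `T` by removing elements of `L`. -/
def moebius {I : Type*} [DecidableEq I] {A : Type*} [AddCommGroup A] (f : Finset I → A)
    (L T : Finset I) : A :=
  ∑ S ∈ L.powerset, (-1 : ℤ) ^ S.card • f (T \ S)

theorem moebius_insert {I : Type*} [DecidableEq I] {A : Type*} [AddCommGroup A] (f : Finset I → A)
    {l : I} {L : Finset I} (hl : l ∉ L) (T : Finset I) :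
    moebius f (insert l L) T = moebius (fun T => f T - f (T.erase l)) L T := by
  rw [moebius, Finset.sum_powerset_insert hl, moebius, ← Finset.sum_add_distrib]
  refine Finset.sum_congr rfl fun S hS => ?_
  have : l ∉ S := fun h => hl (Finset.mem_powerset.1 hS h)
  rw [Finset.card_insert_of_notMem this, pow_succ, mul_neg_one, neg_smul, smul_sub, sub_eq_add_neg,
    Finset.sdiff_insert]

/-- Inclusion-exclusion for the two-term complexes on the splittings of a family of commuting
idempotents that is indexed by subsets and takes intersections to composites. -/
theorem val_moebius {B : Type*} [Category* B] [Preadditive B] [HasZeroObject B] [HasCokernels B]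
    {E : ExactData B} {A : Type*} [AddCommGroup A] (χ : Inv E.binary A) {X : B} (hX : E.good X)
    (α : X ⟶ X) [IsIso α] {I : Type*} [DecidableEq I] (L : Finset I) (w : Finset I → (X ⟶ X))
    (hw : ∀ S T, w S ≫ w T = w (S ∩ T)) (hα : ∀ S, α ≫ w S = w S ≫ α) (c : Finset I → A)
    (hc : ∀ T (s : IdemSplit (w T)), χ.val (ofEnd (s.endo α)) = c T) (T : Finset I)
    (s : IdemSplit (moebius w L T)) : χ.val (ofEnd (s.endo α)) = moebius c L T := by
  induction L using Finset.induction_on generalizing w c T with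
  | empty =>
    have h : moebius w ∅ T = w T := by simp [moebius]
    have h' : moebius c ∅ T = c T := by simp [moebius]
    rw [h']
    generalize moebius w ∅ T = e at s h
    subst h
    exact hc T s
  | insert l L hl ih =>
    have h := moebius_insert w hl T
    rw [moebius_insert c hl]
    generalize moebius w (insert l L) T = e at s h
    subst h
    refine ih _ (fun S T => ?_) (fun S => ?_) _ (fun T s => ?_) T s
    · have h1 : S ∩ T.erase l = (S ∩ T).erase l := by ext; grind
      have h2 : S.erase l ∩ T = (S ∩ T).erase l := by ext; grind
      have h3 : S.erase l ∩ T.erase l = (S ∩ T).erase l := by ext; grind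
      simp only [Preadditive.comp_sub, Preadditive.sub_comp, hw, h1, h2, h3]
      abel
    · simp only [Preadditive.comp_sub, Preadditive.sub_comp, hα]
    · let s₁ : IdemSplit (w T) := .ofCokernel (by rw [hw, Finset.inter_self])
      let s₂ : IdemSplit (w (T.erase l)) := .ofCokernel (by rw [hw, Finset.inter_self])
      have h1 : T ∩ T.erase l = T.erase l := by ext; grind
      have h2 : T.erase l ∩ T = T.erase l := by ext; grind
      have := IdemSplit.val_add χ hX α (e := w T) (e₁ := w T - w (T.erase l)) (e₂ := w (T.erase l))
        (by abel) (by simp [hw, h1]) (by simp [hw, h2])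
        (by simp only [Preadditive.comp_sub, Preadditive.sub_comp, hα]) (hα _) s₁ s s₂
      rw [← hc T s₁, ← hc _ s₂, this, add_sub_cancel_right]

/-- If `c` vanishes on the subsets without `0` and depends only on the cardinality of the other
ones, then its alternating sum is an iterated difference. -/
theorem moebius_eq_fwdDiff {A : Type*} [AddCommGroup A] (f : ℕ → A) (m : ℕ)
    (c : Finset (Fin (m + 1)) → A) (h0 : ∀ T, 0 ∉ T → c T = 0)
    (h1 : ∀ T t, 0 ∈ T → T.card = t + 1 → c T = f t) :
    moebius c Finset.univ Finset.univ = (fwdDiff 1)^[m] f 0 := by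
  have hcard : (Finset.univ.erase (0 : Fin (m + 1))).card = m := by simp
  rw [moebius, ← Finset.insert_erase (Finset.mem_univ (0 : Fin (m + 1))),
    Finset.sum_powerset_insert (Finset.notMem_erase _ _), Finset.insert_erase (Finset.mem_univ _),
    Finset.sum_eq_zero (s := Finset.powerset _)
      (f := fun S => (-1 : ℤ) ^ (insert 0 S).card • c (Finset.univ \ insert 0 S))
      fun S _ => by rw [h0 _ (by simp), smul_zero], add_zero, fwdDiff_iter_eq_sum_shift]
  have : ∀ S ∈ (Finset.univ.erase (0 : Fin (m + 1))).powerset,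
      (-1 : ℤ) ^ S.card • c (Finset.univ \ S) = (fun j => (-1 : ℤ) ^ j • f (m - j)) S.card := by
    intro S hS
    have hS' := Finset.mem_powerset.1 hS
    have hle := Finset.card_le_card hS'
    rw [hcard] at hle
    rw [h1 _ (m - S.card)]
    · simp only [Finset.mem_sdiff, Finset.mem_univ, true_and]
      exact fun h => Finset.notMem_erase _ _ (hS' h)
    · rw [Finset.card_sdiff_of_subset (Finset.subset_univ _), Finset.card_univ, Fintype.card_fin]
      omega
  rw [Finset.sum_congr rfl this, Finset.sum_powerset_apply_card
    (fun j => (-1 : ℤ) ^ j • f (m - j)), hcard,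
    ← Finset.sum_range_reflect]
  refine Finset.sum_congr rfl fun k hk => ?_
  have hk' : k ≤ m := by simpa [Nat.lt_succ_iff] using hk
  have e : m + 1 - 1 - k = m - k := by omega
  rw [e, Nat.choose_symm hk', Nat.sub_sub_self hk', zero_add, smul_eq_mul, mul_one, mul_smul,
    smul_comm, natCast_zsmul]

end
end GraysonK

namespace GraysonK
noncomputable section

/-! ### Simplices of the Dold-Kan construction on a two-term complex -/

namespace DoldKan

open BinaryComplex AlgebraicTopology AlgebraicTopology.DoldKan Simplicial ZeroObject

section

variable {C : Type u} [Category.{v} C] [Preadditive C] [HasZeroObject C]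

/-- The two-term chain complex given by an endomorphism. -/
abbrev endComplex {W : C} (a : W ⟶ W) : ChainComplex C ℕ := (ofEnd a).top

/-- The values of a vertex map on the summands: here `n` is the degree of the summand, and `x` is
the vertex of the standard `n`-simplex to which the vertex is mapped. -/
def vertexComp {W : C} (a : W ⟶ W) (n x : ℕ) : endX W n ⟶ W :=
  match n, x with
  | 0, _ => 𝟙 W
  | 1, 0 => 0
  | 1, _ + 1 => a
  | _ + 2, _ => 0

/-- The operator of `Γ` for the inclusion of a vertex `x` into a simplex: only the operator for the
vertex `1` of the `1`-simplex involves the differential. -/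
theorem mapMono_const {W : C} (a : W ⟶ W) (Δ : SimplexCategory) (x : Fin (Δ.len + 1))
    (h : Mono (SimplexCategory.const ⦋0⦌ Δ x)) :
    Γ₀.Obj.Termwise.mapMono (endComplex a) (SimplexCategory.const ⦋0⦌ Δ x) =
      vertexComp a Δ.len (x : ℕ) := by
  induction Δ using SimplexCategory.rec with | _ n
  match n, x, h with
  | 0, x, h =>
    have : SimplexCategory.const ⦋0⦌ ⦋0⦌ x = 𝟙 _ := Subsingleton.elim _ _
    simp only [this]
    exact Γ₀.Obj.Termwise.mapMono_id (endComplex a) ⦋0⦌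
  | 1, 0, h =>
    refine Γ₀.Obj.Termwise.mapMono_eq_zero _ _ ?_ fun h => h.2 rfl
    exact fun h => absurd (congrArg SimplexCategory.len h) (by simp)
  | 1, 1, h =>
    refine (Γ₀.Obj.Termwise.mapMono_δ₀' _ _ ⟨rfl, ?_⟩).trans ?_
    · exact one_ne_zero (α := Fin 2)
    · exact ChainComplex.of_d (endX W) (endD a) 0
  | n + 2, x, h => exact (isZero_zero C).eq_of_src _ _

end

variable {C : Type u} [Category.{v} C] [Preadditive C] [HasFiniteColimits C] [HasZeroObject C]

/-- The `m`-simplices of `Γ` of a two-term complex; they do not depend on the differential. -/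
abbrev gam (m : ℕ) (W : C) : C := (Γ₀.obj (graded (endX W))) _⦋m⦌

/-- The inclusion of a summand of `gam m W`. -/
abbrev gamι {m : ℕ} (W : C) (A : SimplicialObject.Splitting.IndexSet (Opposite.op ⦋m⦌)) :
    endX W A.1.unop.len ⟶ gam m W :=
  Sigma.ι (Γ₀.Obj.summand (graded (endX W)) (Opposite.op ⦋m⦌)) A

theorem gam_hom_ext {m : ℕ} {W Z : C} {f g : gam m W ⟶ Z} (h : ∀ A, gamι W A ≫ f = gamι W A ≫ g) :
    f = g :=
  Sigma.hom_ext _ _ h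

/-- The simplicial operators of `Γ` of a two-term complex. -/
abbrev gamMap {W : C} (a : W ⟶ W) {m n : ℕ} (θ : ⦋n⦌ ⟶ ⦋m⦌) : gam m W ⟶ gam n W :=
  (Γ₀.obj (endComplex a)).map θ.op

theorem gamMap_comp {W : C} (a : W ⟶ W) {l m n : ℕ} (θ : ⦋n⦌ ⟶ ⦋m⦌) (θ' : ⦋m⦌ ⟶ ⦋l⦌) :
    gamMap a θ' ≫ gamMap a θ = gamMap a (θ ≫ θ') :=
  ((Γ₀.obj (endComplex a)).map_comp θ'.op θ.op).symm

/-- The identification of `Γ₀` with the object in degree `0`. -/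
def toBase (W : C) : gam 0 W ⟶ W := Sigma.desc fun A => vertexComp (𝟙 W) A.1.unop.len 0

/-- The vertices of a simplex of `Γ` of a two-term complex. -/
def vertex {W : C} (a : W ⟶ W) {m : ℕ} (k : Fin (m + 1)) : gam m W ⟶ W :=
  gamMap a (SimplexCategory.const ⦋0⦌ ⦋m⦌ k) ≫ toBase W

theorem gamMap_vertex {W : C} (a : W ⟶ W) {m n : ℕ} (θ : ⦋n⦌ ⟶ ⦋m⦌) (k : Fin (n + 1)) :
    gamMap a θ ≫ vertex a k = vertex a (θ.toOrderHom k) := by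
  rw [vertex, ← Category.assoc, gamMap_comp]
  rfl

/-- The vertex `k`, restricted to the summand of a surjection `e`, only depends on the value `e(k)`.
-/
theorem gamι_vertex {W : C} (a : W ⟶ W) {m : ℕ} (k : Fin (m + 1))
    (A : SimplicialObject.Splitting.IndexSet (Opposite.op ⦋m⦌)) :
    gamι W A ≫ vertex a k = vertexComp a A.1.unop.len (A.e.toOrderHom k : ℕ) := by
  let i : ⦋0⦌ ⟶ A.1.unop := SimplexCategory.const ⦋0⦌ A.1.unop (A.e.toOrderHom k)
  have hi : Mono i := by
    rw [SimplexCategory.mono_iff_injective]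
    intro x y _
    exact Subsingleton.elim (α := Fin 1) x y
  have fac : 𝟙 ⦋0⦌ ≫ i = (SimplexCategory.const ⦋0⦌ ⦋m⦌ k).op.unop ≫ A.e := by
    rw [Category.id_comp]; rfl
  have h := Γ₀.Obj.map_on_summand₀ (endComplex a) A fac
  have h1 : gamι W A ≫ vertex a k = (Γ₀.Obj.Termwise.mapMono (endComplex a) i ≫
      gamι W (SimplicialObject.Splitting.IndexSet.mk (𝟙 ⦋0⦌))) ≫ toBase W :=
    (Category.assoc _ _ _).symm.trans (congrArg (· ≫ toBase W) h)
  have h2 : gamι W (SimplicialObject.Splitting.IndexSet.mk (𝟙 ⦋0⦌)) ≫ toBase W = 𝟙 W :=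
    Sigma.ι_desc (fun A : SimplicialObject.Splitting.IndexSet (Opposite.op ⦋0⦌) => vertexComp (𝟙 W) A.1.unop.len 0) _
  refine (h1.trans (Category.assoc _ _ _)).trans ?_
  refine (congrArg (Γ₀.Obj.Termwise.mapMono (endComplex a) i ≫ ·) h2).trans ?_
  refine (Category.comp_id _).trans ?_
  exact mapMono_const a A.1.unop _ hi

/-- The surjection onto the `1`-simplex that takes the value `0` exactly on `0, …, l`. -/
def cut {m : ℕ} (l : Fin m) : ⦋m⦌ ⟶ ⦋1⦌ :=
  SimplexCategory.mkHom ⟨fun v : Fin (m + 1) => if v ≤ l.castSucc then (0 : Fin 2) else 1, by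
    intro x y h
    dsimp only
    split_ifs with h1 h2
    · exact le_rfl
    · exact Fin.zero_le _
    · exact absurd (h.trans ‹_›) h1
    · exact le_rfl⟩

instance {m : ℕ} (l : Fin m) : Epi (cut l) := by
  rw [SimplexCategory.epi_iff_surjective]
  intro (x : Fin 2)
  match x with
  | 0 => exact ⟨(0 : Fin (m + 1)), (if_pos (Fin.zero_le _) :
      (if (0 : Fin (m + 1)) ≤ l.castSucc then (0 : Fin 2) else 1) = 0)⟩
  | 1 => exact ⟨l.succ, if_neg (by simp)⟩

instance (m : ℕ) : Epi (SimplexCategory.const ⦋m⦌ ⦋0⦌ 0) := by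
  rw [SimplexCategory.epi_iff_surjective]
  exact fun x => ⟨(0 : Fin (m + 1)), Subsingleton.elim (α := Fin 1) _ _⟩

/-- Every surjection onto the `1`-simplex is of the form `cut l`. -/
theorem exists_cut {m : ℕ} (e : ⦋m⦌ ⟶ ⦋1⦌) [Epi e] : ∃ l, e = cut l := by
  have hs := SimplexCategory.epi_iff_surjective.1 (‹Epi e›)
  have he : ∀ v : Fin (m + 1), ∀ w, v ≤ w → (e.toOrderHom v : Fin 2) ≤ e.toOrderHom w :=
    fun v w h => e.toOrderHom.monotone h
  obtain ⟨v0, hv0⟩ := hs (0 : Fin 2)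
  obtain ⟨v1, hv1⟩ := hs (1 : Fin 2)
  let S : Finset (Fin (m + 1)) := {v | (e.toOrderHom v : Fin 2) = 1}
  have hS : S.Nonempty := ⟨v1, by simpa [S] using hv1⟩
  have hmin : (e.toOrderHom (S.min' hS) : Fin 2) = 1 := by
    have := S.min'_mem hS
    simpa [S] using this
  have hne : S.min' hS ≠ 0 := by
    intro h
    have := he (S.min' hS) v0 (h ▸ Fin.zero_le _)
    rw [hmin] at this
    have h2 : (e.toOrderHom v0 : Fin 2) = 0 := hv0
    rw [h2] at this
    exact absurd this (by decide)
  obtain ⟨l, hl⟩ := Fin.exists_succ_eq.2 hne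
  have hd0 : ∀ x : Fin 2, ¬x = 0 → x = 1 := by decide
  have hd1 : ∀ x : Fin 2, 1 ≤ x → x = 1 := by decide
  refine ⟨l, ?_⟩
  ext v : 3
  change (e.toOrderHom v : Fin 2) = if v ≤ l.castSucc then (0 : Fin 2) else 1
  split_ifs with h
  · by_contra hc
    have h1 : (e.toOrderHom v : Fin 2) = 1 := hd0 _ hc
    have := S.min'_le v (by simpa [S] using h1)
    rw [← hl] at this
    have h3 := this.trans h
    simp [Fin.le_def] at h3
  · have h1 := he (S.min' hS) v (by rw [← hl]; simp only [not_le, Fin.le_def] at h ⊢; simpa using h)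
    rw [hmin] at h1
    exact hd1 _ h1

/-- The projections of `Γ` of a two-term complex to the copies of the object: the vertex `0`, and
the differences of successive vertices. -/
def ρ (W : C) {m : ℕ} : Fin (m + 1) → (gam m W ⟶ W) :=
  Fin.cases (vertex (𝟙 W) 0) fun l => vertex (𝟙 W) l.succ - vertex (𝟙 W) l.castSucc

/-- The inclusions of the non-zero summands. -/
def inc (W : C) {m : ℕ} : Fin (m + 1) → (W ⟶ gam m W) :=
  Fin.cases (gamι W (SimplicialObject.Splitting.IndexSet.mk (SimplexCategory.const ⦋m⦌ ⦋0⦌ 0)))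
    fun l => gamι W (SimplicialObject.Splitting.IndexSet.mk (cut l))

theorem inc_zero_vertex {W : C} (a : W ⟶ W) {m : ℕ} (k : Fin (m + 1)) :
    inc W 0 ≫ vertex a k = 𝟙 W :=
  gamι_vertex a k (SimplicialObject.Splitting.IndexSet.mk (SimplexCategory.const ⦋m⦌ ⦋0⦌ 0))

theorem inc_succ_vertex {W : C} (a : W ⟶ W) {m : ℕ} (l : Fin m) (k : Fin (m + 1)) :
    inc W l.succ ≫ vertex a k = if k ≤ l.castSucc then 0 else a := by
  refine (gamι_vertex a k (SimplicialObject.Splitting.IndexSet.mk (cut l))).trans ?_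
  change vertexComp a 1 ((if k ≤ l.castSucc then (0 : Fin 2) else 1 : Fin 2) : ℕ) = _
  split_ifs <;> rfl

theorem inc_ρ_self (W : C) {m : ℕ} (j : Fin (m + 1)) : inc W j ≫ ρ W j = 𝟙 W := by
  induction j using Fin.cases with
  | zero => exact inc_zero_vertex _ _
  | succ j =>
    refine (Preadditive.comp_sub _ _ _).trans ?_
    rw [inc_succ_vertex, inc_succ_vertex, if_neg (by simp), if_pos le_rfl, sub_zero]

theorem inc_ρ_ne (W : C) {m : ℕ} {j k : Fin (m + 1)} (h : j ≠ k) : inc W j ≫ ρ W k = 0 := by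
  induction k using Fin.cases with
  | zero =>
    obtain ⟨l, rfl⟩ := Fin.exists_succ_eq.2 h
    exact (inc_succ_vertex _ _ _).trans (if_pos (Fin.zero_le _))
  | succ k =>
    refine (Preadditive.comp_sub _ _ _).trans ?_
    induction j using Fin.cases with
    | zero => rw [inc_zero_vertex, inc_zero_vertex, sub_self]
    | succ j =>
      have hne : (j : ℕ) ≠ k := fun e => h (congrArg Fin.succ (Fin.ext e))
      rw [inc_succ_vertex, inc_succ_vertex]
      by_cases h1 : k.castSucc ≤ j.castSucc
      · have h2 : k.succ ≤ j.castSucc := by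
          simp only [Fin.le_def, Fin.val_castSucc, Fin.val_succ] at h1 ⊢
          omega
        rw [if_pos h1, if_pos h2, sub_self]
      · have h2 : ¬ k.succ ≤ j.castSucc := by
          simp only [Fin.le_def, Fin.val_castSucc, Fin.val_succ] at h1 ⊢
          omega
        rw [if_neg h1, if_neg h2, sub_self]

/-- The summands of `gam m W` are indexed by the surjections from `[m]`. The non-zero ones belong to
`[m] ⟶ [0]` and to the `m` surjections onto `[1]`, so that `ρ` and `inc` describe all of them. -/
theorem ρ_inc_total (W : C) (m : ℕ) : ∑ j : Fin (m + 1), ρ W j ≫ inc W j = 𝟙 (gam m W) := by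
  have key (j : Fin (m + 1)) : inc W j ≫ ∑ k : Fin (m + 1), ρ W k ≫ inc W k = inc W j := by
    rw [Preadditive.comp_sum, Finset.sum_eq_single j, ← Category.assoc, inc_ρ_self,
      Category.id_comp]
    · intro k _ hk
      rw [← Category.assoc, inc_ρ_ne W hk.symm, zero_comp]
    · simp
  refine gam_hom_ext fun A => Eq.trans ?_ (Category.comp_id _).symm
  obtain ⟨⟨Δ⟩, e, he⟩ := A
  induction Δ using SimplexCategory.rec with | _ n
  match n, e, he with
  | 0, e, he =>
    obtain rfl : e = SimplexCategory.const ⦋m⦌ ⦋0⦌ 0 := Subsingleton.elim _ _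
    exact key 0
  | 1, e, he =>
    obtain ⟨l, rfl⟩ := exists_cut e
    exact key l.succ
  | n + 2, e, he => exact (isZero_zero C).eq_of_src _ _

/-- The vertex `0` does not depend on the differential. -/
theorem vertex_zero {W : C} (a b : W ⟶ W) (m : ℕ) :
    (vertex a 0 : gam m W ⟶ W) = vertex b 0 := by
  rw [← Category.id_comp (vertex a 0), ← Category.id_comp (vertex b 0), ← ρ_inc_total,
    Preadditive.sum_comp, Preadditive.sum_comp]
  refine Finset.sum_congr rfl fun j _ => ?_
  rw [Category.assoc, Category.assoc]
  congr 1
  induction j using Fin.cases with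
  | zero => rw [inc_zero_vertex, inc_zero_vertex]
  | succ j => rw [inc_succ_vertex, inc_succ_vertex, if_pos (Fin.zero_le _), if_pos (Fin.zero_le _)]

/-- The components `ρ` are defined with the differential `1`. In the presence of a differential `a`,
the differences of successive vertices are multiplied by `a`. -/
theorem vertex_sub_vertex {W : C} (a : W ⟶ W) {m : ℕ} (l : Fin m) :
    (vertex a l.succ - vertex a l.castSucc : gam m W ⟶ W) = ρ W l.succ ≫ a := by
  rw [← Category.id_comp (_ - _), ← Category.id_comp (ρ W _ ≫ a), ← ρ_inc_total,
    Preadditive.sum_comp, Preadditive.sum_comp]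
  refine Finset.sum_congr rfl fun j _ => ?_
  rw [Category.assoc, Category.assoc]
  congr 1
  rw [Preadditive.comp_sub, ← Category.assoc (inc W j)]
  refine Eq.trans ?_ (congrArg (· ≫ a) (Preadditive.comp_sub _ _ _)).symm
  induction j using Fin.cases with
  | zero => simp [inc_zero_vertex]
  | succ j =>
    simp only [inc_succ_vertex]
    split_ifs <;> simp

end DoldKan

end
end GraysonK

namespace GraysonK
noncomputable section

/-! ### Powers of an object -/

open BinaryComplex ZeroObject

/-- A presentation of `Z` as the direct sum of copies of `W` indexed by `I`. -/
structure Power {B : Type*} [Category* B] [Preadditive B] (I : Type*) [Fintype I] (W Z : B) where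
  ρ : I → (Z ⟶ W)
  inc : I → (W ⟶ Z)
  inc_ρ_self (i : I) : inc i ≫ ρ i = 𝟙 W
  inc_ρ_ne {i j : I} (h : i ≠ j) : inc i ≫ ρ j = 0
  total : ∑ i, ρ i ≫ inc i = 𝟙 Z

namespace Power

section

variable {B : Type*} [Category* B] [Preadditive B] {I : Type*} [Fintype I]
  {W Z : B} (P : Power I W Z)

include P in
theorem eq_sum {Y : B} (f : Y ⟶ Z) : f = ∑ i, (f ≫ P.ρ i) ≫ P.inc i := by
  conv_lhs => rw [← Category.comp_id f, ← P.total, Preadditive.comp_sum]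
  simp only [Category.assoc]

theorem hom_ext {Y : B} {f g : Y ⟶ Z} (h : ∀ i, f ≫ P.ρ i = g ≫ P.ρ i) : f = g := by
  rw [P.eq_sum f, P.eq_sum g]
  simp only [h]

/-- The morphism with the given components. -/
def lift {Y : B} (f : I → (Y ⟶ W)) : Y ⟶ Z := ∑ i, f i ≫ P.inc i

theorem lift_ρ {Y : B} (f : I → (Y ⟶ W)) (i : I) : P.lift f ≫ P.ρ i = f i := by
  rw [lift, Preadditive.sum_comp, Finset.sum_eq_single i]
  · rw [Category.assoc, P.inc_ρ_self, Category.comp_id]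
  · intro j _ hj
    rw [Category.assoc, P.inc_ρ_ne hj, comp_zero]
  · simp

/-- The diagonal endomorphism with the given components. -/
def diag (f : I → (W ⟶ W)) : Z ⟶ Z := P.lift fun i => P.ρ i ≫ f i

theorem diag_ρ (f : I → (W ⟶ W)) (i : I) : P.diag f ≫ P.ρ i = P.ρ i ≫ f i := P.lift_ρ _ _

theorem diag_comp (f g : I → (W ⟶ W)) : P.diag f ≫ P.diag g = P.diag fun i => f i ≫ g i :=
  P.hom_ext fun i => by
    rw [Category.assoc, diag_ρ, ← Category.assoc, diag_ρ, diag_ρ, Category.assoc]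

theorem diag_one : P.diag (fun _ => 𝟙 W) = 𝟙 Z :=
  P.hom_ext fun i => by rw [diag_ρ, Category.comp_id, Category.id_comp]

theorem isIso_diag (f : I → (W ⟶ W)) (h : ∀ i, IsIso (f i)) : IsIso (P.diag f) :=
  ⟨P.diag fun i => inv (f i), by simp [diag_comp, diag_one], by simp [diag_comp, diag_one]⟩

variable [DecidableEq I]

/-- The endomorphism that is `a` on the summand `i` and the identity on the other ones. -/
def act (i : I) (a : W ⟶ W) : Z ⟶ Z := P.diag fun j => if j = i then a else 𝟙 W

instance isIso_act (i : I) (a : W ⟶ W) [IsIso a] : IsIso (P.act i a) :=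
  P.isIso_diag _ fun j => by split_ifs <;> infer_instance

/-- The projector onto the summands in `S`. -/
def proj (S : Finset I) : Z ⟶ Z := P.diag fun i => if i ∈ S then 𝟙 W else 0

theorem proj_comp (S T : Finset I) : P.proj S ≫ P.proj T = P.proj (S ∩ T) := by
  rw [proj, proj, diag_comp]
  congr 1
  funext i
  by_cases h1 : i ∈ S <;> by_cases h2 : i ∈ T <;> simp [h1, h2]

theorem proj_univ : P.proj Finset.univ = 𝟙 Z := by simp [proj, diag_one]

theorem proj_ρ_notMem {S : Finset I} {i : I} (h : i ∉ S) : P.proj S ≫ P.ρ i = 0 := by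
  rw [proj, diag_ρ, if_neg h, comp_zero]

theorem act_comm_proj (i : I) (a : W ⟶ W) (S : Finset I) :
    P.act i a ≫ P.proj S = P.proj S ≫ P.act i a := by
  rw [proj, act, diag_comp, diag_comp]
  congr 1
  funext j
  split_ifs <;> simp

theorem proj_eq_sum (S : Finset I) : P.proj S = ∑ i ∈ S, P.ρ i ≫ P.inc i := by
  rw [proj, diag, lift, ← Finset.sum_subset (Finset.subset_univ S)]
  · refine Finset.sum_congr rfl fun i hi => ?_
    rw [if_pos hi, Category.comp_id]
  · intro i _ hi
    rw [if_neg hi, comp_zero, zero_comp]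

/-- The alternating sum `∑ (-1) ^ |S| Φ(p_{I \ S})` of the images of the projectors under a functor.
It is the projector onto the cross-effect of `Φ`. -/
def mob {D : Type*} [Category* D] [Preadditive D] (Φ : B ⥤ D) : Φ.obj Z ⟶ Φ.obj Z :=
  moebius (fun S => Φ.map (P.proj S)) Finset.univ Finset.univ

/-- The projector onto the cross-effect kills everything that factors through a proper partial sum.
-/
theorem map_mob_eq_zero {D : Type*} [Category* D] [Preadditive D] (Φ : B ⥤ D) {Y : B} (f : Y ⟶ Z)
    (i : I) (h : f ≫ P.ρ i = 0) : Φ.map f ≫ P.mob Φ = 0 := by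
  rw [mob]
  nth_rw 1 [← Finset.insert_erase (Finset.mem_univ i)]
  rw [moebius_insert _ (Finset.notMem_erase _ _), moebius, Preadditive.comp_sum]
  refine Finset.sum_eq_zero fun S _ => ?_
  have : f ≫ P.proj (Finset.univ \ S) = f ≫ P.proj ((Finset.univ \ S).erase i) := by
    refine P.hom_ext fun j => ?_
    simp only [Category.assoc, proj, diag_ρ]
    by_cases hj : j = i
    · subst hj
      simp [reassoc_of% h]
    · simp [hj]
  rw [Preadditive.comp_zsmul, Preadditive.comp_sub, ← Φ.map_comp, this, Φ.map_comp, sub_self,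
    smul_zero]

theorem map_proj_comm {D : Type*} [Category* D] (Φ : B ⥤ D) (S T : Finset I) :
    Φ.map (P.proj S) ≫ Φ.map (P.proj T) = Φ.map (P.proj (S ∩ T)) := by
  rw [← Φ.map_comp, proj_comp]

/-- All terms of the alternating sum except the one for `S = ∅`, which is the identity, are killed
by the projector. -/
theorem mob_idem {D : Type*} [Category* D] [Preadditive D] (Φ : B ⥤ D) :
    P.mob Φ ≫ P.mob Φ = P.mob Φ := by
  have h : P.mob Φ ≫ P.mob Φ = 𝟙 _ ≫ P.mob Φ := by
    conv_lhs => enter [1]; rw [mob, moebius, ← Finset.insert_erase (Finset.empty_mem_powerset _)]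
    rw [Finset.sum_insert (Finset.notMem_erase _ _), Preadditive.add_comp, Preadditive.sum_comp,
      Finset.sum_eq_zero]
    · simp [proj_univ]
    · intro S hS
      obtain ⟨i, hi⟩ := Finset.nonempty_iff_ne_empty.2 (Finset.mem_erase.1 hS).1
      rw [Preadditive.zsmul_comp, P.map_mob_eq_zero Φ _ i (P.proj_ρ_notMem (by simpa using hi)),
        smul_zero]
  rw [h, Category.id_comp]

end

end Power

/-- A functor is of degree at most `r` if its cross-effects in more than `r` variables vanish. This
is expressed by alternating sums of values on partial sums of `m + 1 > r` morphisms. -/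
def DegreeLE {C D : Type*} [Category* C] [Preadditive C] [Category* D] [Preadditive D] (r : ℕ)
    (G : C ⥤ D) : Prop :=
  ∀ m, r ≤ m → ∀ {X Y : C} (f : Fin (m + 1) → (X ⟶ Y)),
    moebius (fun S => G.map (∑ i ∈ S, f i)) Finset.univ Finset.univ = 0

theorem Power.mob_eq_zero {C D : Type*} [Category* C] [Preadditive C] [Category* D] [Preadditive D]
    {r : ℕ} {G : C ⥤ D} (hG : DegreeLE r G) {m : ℕ} (hm : r ≤ m) {W Z : C}
    (P : Power (Fin (m + 1)) W Z) : P.mob G = 0 := by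
  simp only [mob, proj_eq_sum]
  exact hG m hm _

/-! ### Normalised complexes of functors on a simplicial object made up of powers -/

/-- The formal properties of the simplicial objects `Γ[W; α]`, of the functor `Φ`, and of the binary
complex `N Φ Γ[W; α]` from which the filtration of the latter is obtained. The object `Z m` of
`m`-simplices is the power `W^{m+1}`; the degeneracy `σ i` misses the summand `i + 1`, and
everything that misses this summand is in the image of `σ i`. The properties of faces are stated on
the last `m + 1` summands of `Z (m + 1)`. -/
structure SimplicialPower {C D : Type*} [Category* C] [Preadditive C] [Category* D] [Preadditive D]
    (Φ : C ⥤ D) {W : C} (α : W ⟶ W) (N : BinaryComplex D) where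
  Z : ℕ → C
  P (m : ℕ) : Power (Fin (m + 1)) W (Z m)
  σ (m : ℕ) (i : Fin (m + 1)) : Z m ⟶ Z (m + 1)
  δTop (m : ℕ) (i : Fin (m + 2)) : Z (m + 1) ⟶ Z m
  δBot (m : ℕ) (i : Fin (m + 2)) : Z (m + 1) ⟶ Z m
  p (m : ℕ) : Φ.obj (Z m) ⟶ N.X m
  σ_ρ (m : ℕ) (i : Fin (m + 1)) : σ m i ≫ (P (m + 1)).ρ i.succ = 0
  factor (m : ℕ) (i : Fin (m + 1)) {Y : C} (f : Y ⟶ Z (m + 1))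
    (h : f ≫ (P (m + 1)).ρ i.succ = 0) : (f ≫ δBot m i.succ) ≫ σ m i = f
  δTop_zero (m : ℕ) :
    (P (m + 1)).lift (Fin.cases 0 (P m).ρ) ≫ δTop m 0 = (P m).act 0 α
  δBot_zero (m : ℕ) : (P (m + 1)).lift (Fin.cases 0 (P m).ρ) ≫ δBot m 0 = 𝟙 _
  δTop_succ (m : ℕ) (i : Fin (m + 1)) :
    (P (m + 1)).lift (Fin.cases 0 (P m).ρ) ≫ δTop m i.succ ≫ (P m).ρ 0 = 0
  δBot_succ (m : ℕ) (i : Fin (m + 1)) :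
    (P (m + 1)).lift (Fin.cases 0 (P m).ρ) ≫ δBot m i.succ ≫ (P m).ρ 0 = 0
  epi_p (m : ℕ) : Epi (p m)
  σ_p (m : ℕ) (i : Fin (m + 1)) : Φ.map (σ m i) ≫ p (m + 1) = 0
  desc_zero {V : D} (φ : Φ.obj (Z 0) ⟶ V) : ∃ q, p 0 ≫ q = φ
  desc_succ (m : ℕ) {V : D} (φ : Φ.obj (Z (m + 1)) ⟶ V) (h : ∀ i, Φ.map (σ m i) ≫ φ = 0) :
    ∃ q, p (m + 1) ≫ q = φ
  p_dTop (m : ℕ) : p (m + 1) ≫ N.dTop m =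
    (∑ i : Fin (m + 2), (-1 : ℤ) ^ (i : ℕ) • Φ.map (δTop m i)) ≫ p m
  p_dBot (m : ℕ) : p (m + 1) ≫ N.dBot m =
    (∑ i : Fin (m + 2), (-1 : ℤ) ^ (i : ℕ) • Φ.map (δBot m i)) ≫ p m

namespace SimplicialPower

variable {C D : Type*} [Category* C] [Preadditive C] [Category* D] [Preadditive D]
  {Φ : C ⥤ D} {W : C} {α : W ⟶ W} {N : BinaryComplex D} (T : SimplicialPower Φ α N)

/-- The inclusion of `Z_m` into `Z_{m+1}` as the last `m + 1` summands. -/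
def incl (m : ℕ) : T.Z m ⟶ T.Z (m + 1) := (T.P (m + 1)).lift (Fin.cases 0 (T.P m).ρ)

theorem incl_ρ_zero (m : ℕ) : T.incl m ≫ (T.P (m + 1)).ρ 0 = 0 := Power.lift_ρ _ _ _

theorem incl_ρ_succ (m : ℕ) (i : Fin (m + 1)) :
    T.incl m ≫ (T.P (m + 1)).ρ i.succ = (T.P m).ρ i := Power.lift_ρ _ _ _

/-- The projection of `Z_{m+1}` onto the last `m + 1` summands. -/
def drop (m : ℕ) : T.Z (m + 1) ⟶ T.Z m := (T.P m).lift fun i => (T.P (m + 1)).ρ i.succ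

theorem drop_ρ (m : ℕ) (i : Fin (m + 1)) : T.drop m ≫ (T.P m).ρ i = (T.P (m + 1)).ρ i.succ :=
  Power.lift_ρ _ _ _

theorem incl_drop (m : ℕ) : T.incl m ≫ T.drop m = 𝟙 _ :=
  (T.P m).hom_ext fun i => by rw [Category.assoc, drop_ρ, incl_ρ_succ, Category.id_comp]

/-- A morphism whose component `i + 1` vanishes factors through a degeneracy, hence its image under
`Φ` vanishes in the quotient by the degeneracies. -/
theorem map_p_eq_zero (m : ℕ) (i : Fin (m + 1)) {Y : C} (f : Y ⟶ T.Z (m + 1))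
    (h : f ≫ (T.P (m + 1)).ρ i.succ = 0) : Φ.map f ≫ T.p (m + 1) = 0 := by
  rw [← T.factor m i f h, Φ.map_comp, Category.assoc, T.σ_p, comp_zero]

variable (s : ∀ m, IdemSplit ((T.P m).mob Φ))

theorem map_π_eq_zero (m : ℕ) {Y : C} (f : Y ⟶ T.Z m) (i : Fin (m + 1))
    (h : f ≫ (T.P m).ρ i = 0) : Φ.map f ≫ (s m).π = 0 := by
  rw [← (s m).comp_π, ← Category.assoc, (T.P m).map_mob_eq_zero Φ f i h, zero_comp]

/-- The projection to the cross-effect factors through the quotient by the degeneracies. -/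
theorem exists_q (m : ℕ) : ∃ q, T.p m ≫ q = (s m).π := by
  cases m with
  | zero => exact T.desc_zero _
  | succ m => exact T.desc_succ m _ fun i => T.map_π_eq_zero s _ _ _ (T.σ_ρ m i)

/-- The projection to the cross-effect of the last `m + 1` summands factors through the quotient by
the degeneracies. -/
theorem exists_r (m : ℕ) : ∃ r, T.p (m + 1) ≫ r = Φ.map (T.drop m) ≫ (s m).π :=
  T.desc_succ m _ fun i => by
    rw [← Category.assoc, ← Φ.map_comp]
    exact T.map_π_eq_zero s _ _ i (by rw [Category.assoc, drop_ρ, T.σ_ρ])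

/-- The projector onto the part of `Z_{m+1}` that involves all but the first summand, and the
projector onto the part that involves all summands, add up to the identity modulo degeneracies. -/
theorem mob_p (m : ℕ) : (Φ.map (T.drop m) ≫ (T.P m).mob Φ ≫ Φ.map (T.incl m) +
    (T.P (m + 1)).mob Φ) ≫ T.p (m + 1) = T.p (m + 1) := by
  -- the first projector is the part of the alternating sum for the second in which `0` is removed
  have h1 : Φ.map (T.drop m) ≫ (T.P m).mob Φ ≫ Φ.map (T.incl m) =
      ∑ S ∈ (Finset.univ.erase (0 : Fin (m + 2))).powerset,
        (-1 : ℤ) ^ S.card • Φ.map ((T.P (m + 1)).proj (Finset.univ \ insert 0 S)) := by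
    rw [Power.mob, moebius, Preadditive.sum_comp, Preadditive.comp_sum]
    refine Finset.sum_bij (fun S _ => S.map (Fin.succEmb _)) ?_ ?_ ?_ ?_
    · intro S _
      rw [Finset.mem_powerset]
      intro x hx
      obtain ⟨y, _, rfl⟩ := Finset.mem_map.1 hx
      exact Finset.mem_erase.2 ⟨Fin.succ_ne_zero _, Finset.mem_univ _⟩
    · exact fun S _ S' _ h => Finset.map_injective _ h
    · intro S hS
      refine ⟨Finset.univ.filter fun i => i.succ ∈ S, by simp, ?_⟩
      ext x
      induction x using Fin.cases with
      | zero =>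
        have : (0 : Fin (m + 2)) ∉ S := fun h => Finset.notMem_erase _ _ (Finset.mem_powerset.1 hS h)
        simp [this]
      | succ x => simp
    · intro S _
      rw [Finset.card_map, Preadditive.zsmul_comp, Preadditive.comp_zsmul, ← Φ.map_comp,
        ← Φ.map_comp]
      congr 2
      refine (T.P (m + 1)).hom_ext fun j => ?_
      rw [Category.assoc, Category.assoc, Power.proj, Power.proj, Power.diag_ρ]
      induction j using Fin.cases with
      | zero => simp [incl_ρ_zero]
      | succ j =>
        rw [incl_ρ_succ, Power.diag_ρ, ← Category.assoc, drop_ρ]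
        simp
  have h2 : (T.P (m + 1)).mob Φ = ∑ S ∈ (Finset.univ.erase (0 : Fin (m + 2))).powerset,
        (-1 : ℤ) ^ S.card • Φ.map ((T.P (m + 1)).proj (Finset.univ \ S)) -
      ∑ S ∈ (Finset.univ.erase (0 : Fin (m + 2))).powerset,
        (-1 : ℤ) ^ S.card • Φ.map ((T.P (m + 1)).proj (Finset.univ \ insert 0 S)) := by
    rw [Power.mob, moebius]
    nth_rw 1 [← Finset.insert_erase (Finset.mem_univ (0 : Fin (m + 2)))]
    rw [Finset.sum_powerset_insert (Finset.notMem_erase _ _), sub_eq_add_neg,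
      ← Finset.sum_neg_distrib]
    congr 1
    refine Finset.sum_congr rfl fun S hS => ?_
    have : (0 : Fin (m + 2)) ∉ S := fun h => Finset.notMem_erase _ _ (Finset.mem_powerset.1 hS h)
    rw [Finset.card_insert_of_notMem this, pow_succ, mul_neg_one, neg_smul]
  rw [h1, h2, add_sub_cancel, Preadditive.sum_comp,
    Finset.sum_eq_single_of_mem ∅ (Finset.empty_mem_powerset _)]
  · simp [Power.proj_univ]
  · intro S hS hne
    obtain ⟨i, hi⟩ := Finset.nonempty_iff_ne_empty.2 hne
    have h0 := (Finset.mem_erase.1 (Finset.mem_powerset.1 hS hi)).1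
    obtain ⟨i, rfl⟩ := Fin.exists_succ_eq.2 h0
    rw [Preadditive.zsmul_comp, T.map_p_eq_zero m i _ (Power.proj_ρ_notMem _ (by simpa using hi)),
      smul_zero]

/-- Between the cross-effects, only the face `δ_0` contributes to the differential. -/
theorem sum_faces (m : ℕ) (δ : Fin (m + 2) → (T.Z (m + 1) ⟶ T.Z m)) (a : T.Z m ⟶ T.Z m)
    (h0 : T.incl m ≫ δ 0 = a) (hs : ∀ i : Fin (m + 1), T.incl m ≫ δ i.succ ≫ (T.P m).ρ 0 = 0) :
    (s m).ι ≫ Φ.map (T.incl m) ≫ (∑ i : Fin (m + 2), (-1 : ℤ) ^ (i : ℕ) • Φ.map (δ i)) ≫ (s m).π =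
      (s m).endo (Φ.map a) := by
  rw [Preadditive.sum_comp, Preadditive.comp_sum, Fin.sum_univ_succ, Finset.sum_eq_zero]
  · rw [Fin.val_zero, pow_zero, one_smul, ← Category.assoc (Φ.map _), ← Φ.map_comp, h0, add_zero]
    rfl
  · intro i _
    rw [Preadditive.zsmul_comp, Preadditive.comp_zsmul, ← Category.assoc (Φ.map _), ← Φ.map_comp,
      T.map_π_eq_zero s m _ 0 (by rw [Category.assoc]; exact hs i), smul_zero]

/-- The presentation of the terms of `N Φ Γ[W; α]` by means of the cross-effects of `Φ`. -/
def peeling (h : ∀ X Y : C, Φ.map (0 : X ⟶ Y) = 0) : Peeling N (fun m => (s m).obj) where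
  q m := (T.exists_q s m).choose
  k m := (s m).ι ≫ Φ.map (T.incl m) ≫ T.p (m + 1)
  r m := (T.exists_r s m).choose
  s m := (s m).ι ≫ T.p m
  k_r m := by
    rw [Category.assoc, Category.assoc, (T.exists_r s m).choose_spec, ← Category.assoc (Φ.map _),
      ← Φ.map_comp, incl_drop, Φ.map_id, Category.id_comp, (s m).ι_π]
  s_q m := by rw [Category.assoc, (T.exists_q s m).choose_spec, (s m).ι_π]
  k_q m := by
    rw [Category.assoc, Category.assoc, (T.exists_q s _).choose_spec,
      T.map_π_eq_zero s _ _ 0 (T.incl_ρ_zero m), comp_zero]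
  total m := by
    have := T.epi_p (m + 1)
    rw [← cancel_epi (T.p (m + 1)), Preadditive.comp_add, ← Category.assoc,
      (T.exists_r s m).choose_spec, ← Category.assoc (T.p (m + 1)),
      (T.exists_q s (m + 1)).choose_spec, Category.comp_id]
    refine Eq.trans ?_ (T.mob_p m)
    rw [Preadditive.add_comp]
    simp only [Category.assoc]
    rw [(s m).π_ι_assoc, (s (m + 1)).π_ι_assoc]
  total_zero := by
    have := T.epi_p 0
    rw [← cancel_epi (T.p 0), ← Category.assoc, (T.exists_q s 0).choose_spec, (s 0).π_ι_assoc,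
      Category.comp_id]
    have h0 : (T.P 0).proj ∅ = 0 := (T.P 0).hom_ext fun i => by
      rw [Power.proj_ρ_notMem _ (Finset.notMem_empty i), zero_comp]
    have h1 : (Finset.univ : Finset (Fin 1)) = insert 0 ∅ := rfl
    have h2 : (T.P 0).mob Φ = 𝟙 _ := by
      rw [Power.mob]
      nth_rw 1 [h1]
      rw [moebius_insert _ (Finset.notMem_empty _)]
      simp only [moebius, Finset.powerset_empty, Finset.sum_singleton, Finset.sdiff_empty,
        Finset.card_empty, pow_zero, one_smul]
      rw [Power.proj_univ, show (Finset.univ : Finset (Fin 1)).erase 0 = ∅ from rfl, h0, h,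
        Φ.map_id, sub_zero]
    rw [h2, Category.id_comp]
  bot m := by
    rw [Category.assoc, Category.assoc, ← Category.assoc (T.p (m + 1)), T.p_dBot, Category.assoc,
      (T.exists_q s m).choose_spec, T.sum_faces s m _ _ (T.δBot_zero m) (T.δBot_succ m),
      IdemSplit.endo, Φ.map_id, Category.id_comp, (s m).ι_π]

theorem peeling_β (h : ∀ X Y : C, Φ.map (0 : X ⟶ Y) = 0) (m : ℕ) :
    (T.peeling s h).β m = (s m).endo (Φ.map ((T.P m).act 0 α)) := by
  change ((s m).ι ≫ Φ.map (T.incl m) ≫ T.p (m + 1)) ≫ N.dTop m ≫ (T.exists_q s m).choose = _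
  rw [Category.assoc, Category.assoc, ← Category.assoc (T.p (m + 1)), T.p_dTop, Category.assoc,
    (T.exists_q s m).choose_spec, T.sum_faces s m _ _ (T.δTop_zero m) (T.δTop_succ m)]

end SimplicialPower

/-! ### Values of additive invariants on normalised complexes -/

instance BinaryComplex.hasZeroObject {B : Type u} [Category.{v} B] [Preadditive B]
    [HasZeroObject B] : HasZeroObject (BinaryComplex B) :=
  ⟨⟨{ X := fun _ => 0
      dTop := fun _ => 0
      dBot := fun _ => 0
      dTop_comp := fun _ => zero_comp
      dBot_comp := fun _ => zero_comp }, isZero_of_X fun _ => isZero_zero B⟩⟩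

section

variable {C D : Type*} [Category* C] [Preadditive C] [Category* D] [Preadditive D]
  [HasZeroObject D] {Φ : C ⥤ D} {E : ExactData D} {A : Type*} [AddCommGroup A]
  (χ : Inv E.binary A) {W : C} {α : W ⟶ W}

/-- On a partial sum without the first summand, `α` acts as the identity, so that the two-term
complex is diagonal. -/
theorem Power.val_proj_notMem {m : ℕ} {Z : C} (P : Power (Fin (m + 1)) W Z)
    (hZ : E.good (Φ.obj Z)) {S : Finset (Fin (m + 1))} (hS : 0 ∉ S)
    (s : IdemSplit (Φ.map (P.proj S))) : χ.val (ofEnd (s.endo (Φ.map (P.act 0 α)))) = 0 := by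
  have h : P.act 0 α ≫ P.proj S = P.proj S := P.hom_ext fun i => by
    rw [Category.assoc, Power.proj, Power.act, Power.diag_ρ, ← Category.assoc, Power.diag_ρ]
    by_cases hi : i = 0
    · subst hi
      simp [hS]
    · simp [hi]
  have h' : s.endo (Φ.map (P.act 0 α)) = 𝟙 _ := by
    rw [IdemSplit.endo, ← s.comp_π, ← Category.assoc (Φ.map _), ← Φ.map_comp, h, s.comp_π, s.ι_π]
  rw [h']
  exact χ.val_ofEnd_id (E.good_of_retract s.ι s.π s.ι_π hZ)

/-- A partial sum of `t + 1` summands that contains the first one looks like any other power with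
`t + 1` factors. -/
theorem Power.val_proj_mem [IsIso α] {m t : ℕ} {Z Z' : C} (P : Power (Fin (m + 1)) W Z)
    (P' : Power (Fin (t + 1)) W Z') (hZ : E.good (Φ.obj Z)) {S : Finset (Fin (m + 1))}
    (hS : 0 ∈ S) (ht : S.card = t + 1) (s : IdemSplit (Φ.map (P.proj S))) :
    E.good (Φ.obj Z') ∧
      χ.val (ofEnd (s.endo (Φ.map (P.act 0 α)))) = χ.val (ofEnd (Φ.map (P'.act 0 α))) := by
  let e := S.orderEmbOfFin ht
  have he : e 0 = 0 := by
    have h1 : e 0 = S.min' ⟨0, hS⟩ := S.orderEmbOfFin_zero ht (Nat.succ_pos t)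
    rw [h1]
    exact le_antisymm (S.min'_le 0 hS) (Fin.zero_le _)
  have hmem (j) : e j ∈ S := S.orderEmbOfFin_mem ht j
  let a : Z ⟶ Z' := P'.lift fun j => P.ρ (e j)
  let b : Z' ⟶ Z := ∑ j, P'.ρ j ≫ P.inc (e j)
  have hba : b ≫ a = 𝟙 _ := P'.hom_ext fun i => by
    rw [Category.assoc, Power.lift_ρ, Preadditive.sum_comp, Finset.sum_eq_single i]
    · rw [Category.assoc, P.inc_ρ_self, Category.comp_id, Category.id_comp]
    · intro j _ hj
      rw [Category.assoc, P.inc_ρ_ne (fun h => hj (e.injective h)), comp_zero]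
    · simp
  have hab : a ≫ b = P.proj S := by
    rw [Preadditive.comp_sum, P.proj_eq_sum]
    refine Finset.sum_bij (fun j _ => e j) (fun j _ => hmem j) (fun _ _ _ _ h => e.injective h)
      (fun i hi => ?_) (fun j _ => ?_)
    · have : i ∈ Set.range e := by rw [Finset.range_orderEmbOfFin]; exact hi
      obtain ⟨j, hj⟩ := this
      exact ⟨j, Finset.mem_univ _, hj⟩
    · rw [← Category.assoc, Power.lift_ρ]
  have hact : a ≫ P'.act 0 α = P.act 0 α ≫ a := P'.hom_ext fun j => by
    rw [Category.assoc, Category.assoc, Power.act, Power.act, Power.diag_ρ, Power.lift_ρ,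
      Power.diag_ρ, ← Category.assoc, Power.lift_ρ]
    congr 1
    by_cases hj : j = 0
    · subst hj
      simp [he]
    · have : e j ≠ 0 := fun h => hj (e.injective (h.trans he.symm))
      simp [hj, this]
  have hpa : P.proj S ≫ a = a := by rw [← hab, Category.assoc, hba, Category.comp_id]
  have hbp : b ≫ P.proj S = b := by rw [← hab, ← Category.assoc, hba, Category.id_comp]
  have hg : E.good (Φ.obj Z') := E.good_of_retract (Φ.map b) (Φ.map a)
    (by rw [← Φ.map_comp, hba, Φ.map_id]) hZ
  let iso : s.obj ≅ Φ.obj Z' :=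
    { hom := s.ι ≫ Φ.map a
      inv := Φ.map b ≫ s.π
      hom_inv_id := by
        rw [Category.assoc, ← Category.assoc (Φ.map a), ← Φ.map_comp, hab, s.comp_π, s.ι_π]
      inv_hom_id := by
        rw [Category.assoc, s.π_ι_assoc, ← Φ.map_comp, hpa, ← Φ.map_comp, hba, Φ.map_id] }
  refine ⟨hg, χ.val_iso (ofEndIso _ _ iso ?_) (E.good_ofEnd _ hg)⟩
  change (s.ι ≫ _ ≫ s.π) ≫ s.ι ≫ Φ.map a = (s.ι ≫ Φ.map a) ≫ _
  rw [Category.assoc, Category.assoc, Category.assoc, s.π_ι_assoc, ← Φ.map_comp, ← Φ.map_comp, hpa,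
    ← Φ.map_comp, hact]

/-- The class of the endomorphism of a power of `W` given by `α` on the first summand does not
depend on the choice of the power. -/
theorem Power.val_act [IsIso α] {t : ℕ} {Z Z' : C} (P : Power (Fin (t + 1)) W Z)
    (P' : Power (Fin (t + 1)) W Z') (hZ : E.good (Φ.obj Z)) :
    E.good (Φ.obj Z') ∧
      χ.val (ofEnd (Φ.map (P.act 0 α))) = χ.val (ofEnd (Φ.map (P'.act 0 α))) := by
  let s : IdemSplit (Φ.map (P.proj Finset.univ)) :=
    { obj := Φ.obj Z
      ι := 𝟙 _
      π := 𝟙 _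
      ι_π := Category.id_comp _
      π_ι := by rw [P.proj_univ, Φ.map_id, Category.id_comp] }
  have h := P.val_proj_mem χ P' (α := α) hZ (Finset.mem_univ 0) (by simp) s
  have h' : s.endo (Φ.map (P.act 0 α)) = Φ.map (P.act 0 α) := by
    change 𝟙 _ ≫ _ ≫ 𝟙 _ = _
    rw [Category.id_comp, Category.comp_id]
  rwa [h'] at h

variable [HasCokernels D]

/-- The values on the complements of the cross-effects are iterated differences. -/
theorem SimplicialPower.val_endo {N : BinaryComplex D} (T : SimplicialPower Φ α N) [IsIso α]
    (hT : ∀ m, E.good (Φ.obj (T.Z m))) (m : ℕ) (s : IdemSplit ((T.P m).mob Φ)) :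
    χ.val (ofEnd (s.endo (Φ.map ((T.P m).act 0 α)))) =
      (fwdDiff 1)^[m] (fun t => χ.val (ofEnd (Φ.map ((T.P t).act 0 α)))) 0 := by
  let c (S : Finset (Fin (m + 1))) : A := χ.val (ofEnd ((IdemSplit.ofCokernel
    ((T.P m).map_proj_comm Φ S S |>.trans (by rw [Finset.inter_self]))).endo
      (Φ.map ((T.P m).act 0 α))))
  have hc (S) (s : IdemSplit (Φ.map ((T.P m).proj S))) :
      χ.val (ofEnd (s.endo (Φ.map ((T.P m).act 0 α)))) = c S := by
    by_cases h0 : 0 ∈ S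
    · have hcard : S.card = (S.card - 1) + 1 := by
        have := Finset.card_pos.2 ⟨0, h0⟩
        omega
      exact ((T.P m).val_proj_mem χ (T.P (S.card - 1)) (hT m) h0 hcard s).2.trans
        ((T.P m).val_proj_mem χ (T.P (S.card - 1)) (hT m) h0 hcard _).2.symm
    · exact ((T.P m).val_proj_notMem χ (hT m) h0 s).trans
        ((T.P m).val_proj_notMem χ (hT m) h0 _).symm
  rw [← moebius_eq_fwdDiff _ m c (fun S h0 => (T.P m).val_proj_notMem χ (hT m) h0 _)
    (fun S t h0 ht => ((T.P m).val_proj_mem χ (T.P t) (hT m) h0 ht _).2)]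
  refine val_moebius χ (hT m) _ Finset.univ _ ((T.P m).map_proj_comm Φ) (fun S => ?_) c hc _ s
  rw [← Φ.map_comp, ← Φ.map_comp, (T.P m).act_comm_proj]

/-- The differences of high order are values on cross-effects that vanish. -/
theorem SimplicialPower.fwdDiff_eq_zero {N : BinaryComplex D} (T : SimplicialPower Φ α N) [IsIso α]
    {r : ℕ} (hr : DegreeLE r Φ) (hT : ∀ m, E.good (Φ.obj (T.Z m))) {m : ℕ} (hm : r ≤ m) :
    (fwdDiff 1)^[m] (fun t => χ.val (ofEnd (Φ.map ((T.P t).act 0 α)))) 0 = 0 := by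
  let s : IdemSplit ((T.P m).mob Φ) := .ofCokernel ((T.P m).mob_idem Φ)
  have hz : IsZero s.obj := s.isZero_obj (Power.mob_eq_zero hr hm _)
  rw [← T.val_endo χ hT m s]
  refine χ.val_isZero (isZero_of_X fun k => ?_)
  match k with
  | 0 => exact hz
  | 1 => exact hz
  | k + 2 => exact isZero_zero D

variable [HasBinaryBiproducts D]

/-- The value on `N Φ Γ[W; α]` for a functor `Φ` of finite degree. -/
theorem SimplicialPower.good_and_val {N : BinaryComplex D} (T : SimplicialPower Φ α N) [IsIso α]
    (h0 : ∀ X Y : C, Φ.map (0 : X ⟶ Y) = 0) {r : ℕ} (hr : DegreeLE r Φ)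
    (hT : ∀ m, E.good (Φ.obj (T.Z m))) :
    E.binary.good N ∧ ∀ {A : Type*} [AddCommGroup A] (χ : Inv E.binary A),
      χ.val N = ∑ m ∈ Finset.range r, (-1 : ℤ) ^ m •
        (fwdDiff 1)^[m] (fun t => χ.val (ofEnd (Φ.map ((T.P t).act 0 α)))) 0 := by
  let s (m) : IdemSplit ((T.P m).mob Φ) := .ofCokernel ((T.P m).mob_idem Φ)
  have hz (m) (hm : r ≤ m) : IsZero (s m).obj := (s m).isZero_obj (Power.mob_eq_zero hr hm _)
  have hiso (m) : IsIso (((T.peeling s h0)).β m) := by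
    rw [T.peeling_β s h0]
    refine (s m).isIso_endo _ ?_
    simp only [Power.mob, moebius, Preadditive.comp_sum, Preadditive.sum_comp,
      Preadditive.comp_zsmul, Preadditive.zsmul_comp, ← Φ.map_comp, (T.P m).act_comm_proj]
  obtain ⟨h1, h2⟩ := (T.peeling s h0).good_and_val r hz
    (fun m => E.good_of_retract (s m).ι (s m).π (s m).ι_π (hT m)) hiso
  refine ⟨h1, fun χ => (h2 χ).trans (Finset.sum_congr rfl fun m _ => ?_)⟩
  rw [T.peeling_β s h0, T.val_endo χ hT]

end

end
end GraysonK

namespace GraysonK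
noncomputable section

/-! ### Diagrams of binary complexes -/

open BinaryComplex ZeroObject

attribute [local instance] HasFiniteBiproducts.of_hasFiniteCoproducts
  HasBinaryBiproducts.of_hasBinaryCoproducts

section

variable {J : Type*} [Category* J] {D : Type*} [Category* D] [Preadditive D]

theorem app_isSplit {F G H : J ⥤ D} {f : F ⟶ G} {g : G ⟶ H} (h : IsSplit f g) (j : J) :
    IsSplit (f.app j) (g.app j) := by
  obtain ⟨h0, r, s, h1, h2, h3⟩ := h
  exact ⟨congrArg (fun f => NatTrans.app f j) h0, r.app j, s.app j,
    congrArg (fun f => NatTrans.app f j) h1, congrArg (fun f => NatTrans.app f j) h2,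
    congrArg (fun f => NatTrans.app f j) h3⟩

theorem isZero_app {F : J ⥤ D} (h : IsZero F) (j : J) : IsZero (F.obj j) := by
  rw [IsZero.iff_id_eq_zero] at h ⊢
  exact congrArg (fun f => NatTrans.app f j) h

variable (J) in
/-- The objectwise exact structure on diagrams. -/
def ExactData.functor (E : ExactData D) : ExactData (J ⥤ D) where
  good F := ∀ j, E.good (F.obj j)
  ses f g := ∀ j, E.ses (f.app j) (g.app j)
  dir := E.dir
  isDiag i F := ∀ j, E.isDiag i (F.obj j)
  good_of_retract i p h hQ j :=
    E.good_of_retract (i.app j) (p.app j) (congrArg (fun f => NatTrans.app f j) h) (hQ j)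
  good_of_isZero h j := E.good_of_isZero (isZero_app h j)
  good_of_isSplit _ _ h hP hR j := E.good_of_isSplit _ _ (app_isSplit h j) (hP j) (hR j)
  ses_of_isSplit _ _ h j := E.ses_of_isSplit _ _ (app_isSplit h j)
  isDiag_of_isZero i _ h j := E.isDiag_of_isZero i (isZero_app h j)

theorem Contractible.app {X : ℕ → J ⥤ D} {d : ∀ k, X (k + 1) ⟶ X k} (h : Contractible X d) (j : J) :
    Contractible (fun k => (X k).obj j) (fun k => (d k).app j) := by
  obtain ⟨h, h0, hs⟩ := h
  exact ⟨fun k => (h k).app j, congrArg (fun f => NatTrans.app f j) h0,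
    fun k => congrArg (fun f => NatTrans.app f j) (hs k)⟩

namespace BinaryComplex

/-- A binary complex of diagrams as a diagram of binary complexes. -/
def ofDiagrams : BinaryComplex (J ⥤ D) ⥤ (J ⥤ BinaryComplex D) where
  obj N :=
    { obj := fun j =>
        { X := fun k => (N.X k).obj j
          dTop := fun k => (N.dTop k).app j
          dBot := fun k => (N.dBot k).app j
          dTop_comp := fun k => congrArg (fun f => NatTrans.app f j) (N.dTop_comp k)
          dBot_comp := fun k => congrArg (fun f => NatTrans.app f j) (N.dBot_comp k) }
      map := fun f =>
        { f := fun k => (N.X k).map f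
          commTop := fun k => ((N.dTop k).naturality f).symm
          commBot := fun k => ((N.dBot k).naturality f).symm }
      map_id := fun j => BinaryComplex.hom_ext fun k => (N.X k).map_id j
      map_comp := fun f g => BinaryComplex.hom_ext fun k => (N.X k).map_comp f g }
  map φ :=
    { app := fun j =>
        { f := fun k => (φ.f k).app j
          commTop := fun k => congrArg (fun f => NatTrans.app f j) (φ.commTop k)
          commBot := fun k => congrArg (fun f => NatTrans.app f j) (φ.commBot k) }
      naturality := fun _ _ f => BinaryComplex.hom_ext fun k => (φ.f k).naturality f }

/-- A diagram of binary complexes as a binary complex of diagrams. -/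
def toDiagrams (F : J ⥤ BinaryComplex D) : BinaryComplex (J ⥤ D) where
  X k := F ⋙ eval k
  dTop k := Functor.whiskerLeft F (dNatTop k)
  dBot k := Functor.whiskerLeft F (dNatBot k)
  dTop_comp k := NatTrans.ext (funext fun j => (F.obj j).dTop_comp k)
  dBot_comp k := NatTrans.ext (funext fun j => (F.obj j).dBot_comp k)

end BinaryComplex

theorem ExactData.preserves_ofDiagrams (E : ExactData D) :
    (E.functor J).binary.Preserves (E.binary.functor J) ofDiagrams id where
  good P h j := by
    obtain ⟨h1, ⟨N, hN⟩, h2, h3⟩ := h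
    exact ⟨fun k => h1 k j, ⟨N, fun k hk => isZero_app (hN k hk) j⟩, h2.app j, h3.app j⟩
  ses f g _ _ _ h j k := h k j
  diag i P _ h := by
    cases i with
    | none => exact fun j => funext fun k => congrArg (fun f => NatTrans.app f j) (congrFun h k)
    | some i => exact fun j k => h k j

section

variable [HasZeroObject D]

/-- The diagram of two-term complexes given by an endomorphism of a diagram. -/
def endDiagram {W : J ⥤ D} (α : W ⟶ W) : J ⥤ BinaryComplex D where
  obj j := ofEnd (α.app j)
  map f := ofEndMap _ _ (W.map f) (α.naturality f).symm
  map_id j := BinaryComplex.hom_ext fun k => match k with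
    | 0 => W.map_id j
    | 1 => W.map_id j
    | _ + 2 => (isZero_zero D).eq_of_src _ _
  map_comp f g := BinaryComplex.hom_ext fun k => match k with
    | 0 => W.map_comp f g
    | 1 => W.map_comp f g
    | _ + 2 => (isZero_zero D).eq_of_src _ _

/-- The two ways to form the diagram of two-term complexes agree up to the choice of the zero
objects. -/
def ofDiagramsOfEnd {W : J ⥤ D} (α : W ⟶ W) : ofDiagrams.obj (ofEnd α) ≅ endDiagram α :=
  NatIso.ofComponents (fun j => BinaryComplex.isoMk
    (fun k => match k with
      | 0 => Iso.refl _
      | 1 => Iso.refl _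
      | _ + 2 => (isZero_app (isZero_zero (J ⥤ D)) j).iso (isZero_zero D))
    (fun k => match k with
      | 0 => (Category.comp_id _).trans (Category.id_comp _).symm
      | _ + 1 => (isZero_app (isZero_zero (J ⥤ D)) j).eq_of_src _ _)
    (fun k => match k with
      | 0 => (Category.comp_id _).trans (Category.id_comp _).symm
      | _ + 1 => (isZero_app (isZero_zero (J ⥤ D)) j).eq_of_src _ _))
    (fun _ => BinaryComplex.hom_ext fun k => match k with
      | 0 => (Category.comp_id _).trans (Category.id_comp _).symm
      | 1 => (Category.comp_id _).trans (Category.id_comp _).symm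
      | _ + 2 => (isZero_app (isZero_zero (J ⥤ D)) _).eq_of_src _ _)

theorem ExactData.good_endDiagram (E : ExactData D) {W : J ⥤ D} (α : W ⟶ W) [IsIso α]
    (hW : (E.functor J).good W) : (E.binary.functor J).good (endDiagram α) :=
  fun j => E.good_ofEnd (α.app j) (hW j)

theorem Inv.val_ofDiagrams_ofEnd {E : ExactData D} {A : Type*} [AddCommGroup A]
    (χ : Inv (E.binary.functor J) A) {W : J ⥤ D} (α : W ⟶ W) [IsIso α]
    (hW : (E.functor J).good W) :
    χ.val (ofDiagrams.obj (ofEnd α)) = χ.val (endDiagram α) :=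
  χ.val_iso (ofDiagramsOfEnd α) (E.good_endDiagram α hW)

end

end

/-! ### The simplicial objects of two-term complexes in diagrams -/

theorem Power.lift_app {B J : Type*} [Category* B] [Preadditive B] [Category* J] {I : Type*}
    [Fintype I] {V W Z : J ⥤ B} (P : Power I W Z) (f : I → (V ⟶ W)) (j : J) :
    (P.lift f).app j = ∑ i, (f i).app j ≫ (P.inc i).app j := by
  rw [Power.lift, NatTrans.app_sum]
  rfl

namespace DoldKan

open AlgebraicTopology AlgebraicTopology.DoldKan Simplicial

variable {C : Type u} [Category.{v} C] [Preadditive C] [HasFiniteColimits C] [HasZeroObject C]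
variable {D : Type u} [Category.{v} D] [Preadditive D] [HasFiniteColimits D]

/-- `gam m W` is the direct sum of `m + 1` copies of `W`. -/
def gamPower (W : C) (m : ℕ) : Power (Fin (m + 1)) W (gam m W) where
  ρ := ρ W
  inc := inc W
  inc_ρ_self := inc_ρ_self W
  inc_ρ_ne := inc_ρ_ne W
  total := ρ_inc_total W m

/-- The degeneracies. -/
abbrev gamσ (W : C) {m : ℕ} (i : Fin (m + 1)) : gam m W ⟶ gam (m + 1) W :=
  (Γ₀.obj (graded (endX W))).σ i

/-- The faces. -/
abbrev gamδ {W : C} (a : W ⟶ W) {m : ℕ} (i : Fin (m + 2)) : gam (m + 1) W ⟶ gam m W :=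
  gammaδ (endComplex a) i

theorem gamσ_vertex {W : C} (a : W ⟶ W) {m : ℕ} (i : Fin (m + 1)) (k : Fin (m + 2)) :
    gamσ W i ≫ vertex a k = vertex a (i.predAbove k) := by
  refine (congrArg (· ≫ vertex a k) (gamma_σ (endComplex a) i)).symm.trans ?_
  exact gamMap_vertex a (SimplexCategory.σ i) k

theorem gamδ_vertex {W : C} (a : W ⟶ W) {m : ℕ} (i : Fin (m + 2)) (k : Fin (m + 1)) :
    gamδ a i ≫ vertex a k = vertex a (i.succAbove k) :=
  gamMap_vertex a (SimplexCategory.δ i) k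

theorem gamσ_ρ (W : C) {m : ℕ} (i : Fin (m + 1)) : gamσ W i ≫ ρ W i.succ = 0 := by
  refine (Preadditive.comp_sub _ _ _).trans ?_
  rw [gamσ_vertex, gamσ_vertex, Fin.predAbove_succ_self, Fin.predAbove_castSucc_self, sub_self]

/-- A morphism to `gam m W` is determined by its vertices if the differential is invertible. -/
theorem hom_ext_vertex {W : C} (a : W ⟶ W) [IsIso a] {m : ℕ} {Y : C} {f g : Y ⟶ gam m W}
    (h : ∀ k, f ≫ vertex a k = g ≫ vertex a k) : f = g := by
  refine (gamPower W m).hom_ext fun i => ?_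
  change f ≫ ρ W i = g ≫ ρ W i
  induction i using Fin.cases with
  | zero =>
    change f ≫ vertex (𝟙 W) 0 = g ≫ vertex (𝟙 W) 0
    rw [vertex_zero (𝟙 W) a, h]
  | succ i =>
    rw [← cancel_mono a, Category.assoc, Category.assoc, ← vertex_sub_vertex a i,
      Preadditive.comp_sub, Preadditive.comp_sub, h, h]

/-- If two successive vertices agree, then the simplex is degenerate. -/
theorem factor_gamσ {W Y : C} {m : ℕ} (i : Fin (m + 1)) (f : Y ⟶ gam (m + 1) W)
    (h : f ≫ ρ W i.succ = 0) : (f ≫ gamδ (𝟙 W) i.succ) ≫ gamσ W i = f := by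
  refine hom_ext_vertex (𝟙 W) fun k => ?_
  rw [Category.assoc, Category.assoc, gamσ_vertex, gamδ_vertex]
  by_cases hk : k = i.succ
  · subst hk
    rw [Fin.predAbove_succ_self, Fin.succAbove_succ_self]
    refine (sub_eq_zero.1 ?_).symm
    rw [← Preadditive.comp_sub]
    exact h
  · rw [Fin.succ_succAbove_predAbove hk]

/-- The inclusion of `gam m W` into `gam (m + 1) W` as the last `m + 1` summands. -/
abbrev gamIncl (W : C) (m : ℕ) : gam m W ⟶ gam (m + 1) W :=
  (gamPower W (m + 1)).lift (Fin.cases 0 (ρ W))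

theorem gamIncl_ρ_succ (W : C) {m : ℕ} (i : Fin (m + 1)) :
    gamIncl W m ≫ ρ W i.succ = ρ W i :=
  (gamPower W (m + 1)).lift_ρ _ i.succ

theorem gamIncl_vertex_zero {W : C} (a : W ⟶ W) (m : ℕ) :
    gamIncl W m ≫ vertex a 0 = 0 := by
  rw [vertex_zero a (𝟙 W)]
  exact (gamPower W (m + 1)).lift_ρ _ 0

/-- The face `δ_0` shifts the vertices by one. On a simplex with vertex `0` equal to zero, the first
component of the face is therefore the vertex `1`, which is `a` times the first difference, while
the other differences are unchanged. -/
theorem gamIncl_gamδ_zero {W : C} (a : W ⟶ W) [IsIso a] (m : ℕ) :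
    gamIncl W m ≫ gamδ a 0 = (gamPower W m).act 0 a := by
  refine hom_ext_vertex a fun k => ?_
  rw [Category.assoc, gamδ_vertex, Fin.zero_succAbove]
  have hact (i : Fin (m + 1)) : (gamPower W m).act 0 a ≫ ρ W i =
      ρ W i ≫ if i = 0 then a else 𝟙 W := (gamPower W m).diag_ρ _ i
  have hs (k : Fin (m + 1)) : (gamIncl W m ≫ vertex a k.succ : gam m W ⟶ W) =
      gamIncl W m ≫ vertex a k.castSucc + ρ W k ≫ a := by
    rw [← gamIncl_ρ_succ, Category.assoc, ← vertex_sub_vertex a k, Preadditive.comp_sub]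
    abel
  induction k using Fin.induction with
  | zero =>
    rw [hs]
    refine (congrArg (· + ρ W 0 ≫ a) (gamIncl_vertex_zero a m)).trans ?_
    rw [zero_add, vertex_zero a (𝟙 W)]
    exact ((hact 0).trans (by rw [if_pos rfl])).symm
  | succ k ih =>
    have h1 : (vertex a k.succ : gam m W ⟶ W) = vertex a k.castSucc + ρ W k.succ ≫ a := by
      rw [← vertex_sub_vertex a k]
      abel
    rw [hs, ← Fin.succ_castSucc, ih, h1, Preadditive.comp_add, ← Category.assoc, hact,
      if_neg (Fin.succ_ne_zero k), Category.comp_id]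

/-- The faces other than `δ_0` keep the vertex `0`. -/
theorem gamIncl_gamδ_succ {W : C} (a : W ⟶ W) {m : ℕ} (i : Fin (m + 1)) :
    gamIncl W m ≫ gamδ a i.succ ≫ ρ W 0 = 0 := by
  change gamIncl W m ≫ gamδ a i.succ ≫ vertex (𝟙 W) 0 = 0
  rw [vertex_zero (𝟙 W) a, gamδ_vertex, Fin.succ_succAbove_zero, gamIncl_vertex_zero]

/-- Functoriality of `gam m`. -/
abbrev gamHom {W W' : C} (f : W ⟶ W') (m : ℕ) : gam m W ⟶ gam m W' :=
  (Γ₀.map (gradedMap (endF f))).app (Opposite.op ⦋m⦌)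

/-- `gam m` as a functor. -/
def gamFunctor (m : ℕ) : C ⥤ C where
  obj W := gam m W
  map f := gamHom f m
  map_id W := by
    refine gam_hom_ext fun A => (ι_map_app _ _ A).trans ?_
    refine Eq.trans ?_ (Category.comp_id _).symm
    refine (congrArg (· ≫ _) (?_ : endF (𝟙 W) _ = 𝟙 _)).trans (Category.id_comp _)
    generalize A.1.unop.len = n
    match n with
    | 0 => rfl
    | 1 => rfl
    | n + 2 => exact (isZero_zero C).eq_of_src _ _
  map_comp f g := by
    refine gam_hom_ext fun A => (ι_map_app _ _ A).trans ?_
    refine Eq.trans ?_ (Category.assoc _ _ _)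
    refine Eq.trans ?_ (congrArg (· ≫ _) (ι_map_app (gradedMap (endF f)) _ A)).symm
    refine Eq.trans ?_ (Category.assoc _ _ _).symm
    refine Eq.trans ?_ (congrArg (_ ≫ ·) (ι_map_app (gradedMap (endF g)) _ A)).symm
    refine Eq.trans ?_ (Category.assoc _ _ _)
    refine congrArg (· ≫ _) (?_ : endF (f ≫ g) _ = endF f _ ≫ endF g _)
    generalize A.1.unop.len = n
    match n with
    | 0 => rfl
    | 1 => rfl
    | n + 2 => exact (isZero_zero C).eq_of_src _ _

theorem gamHom_vertex {W W' : C} (f : W ⟶ W') {m : ℕ} (k : Fin (m + 1)) :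
    gamHom f m ≫ vertex (𝟙 W') k = vertex (𝟙 W) k ≫ f := by
  refine gam_hom_ext fun A => ?_
  refine (Category.assoc _ _ _).symm.trans (Eq.trans ?_ (Category.assoc _ _ _))
  refine (congrArg (· ≫ vertex (𝟙 W') k) (ι_map_app (gradedMap (endF f)) _ A)).trans ?_
  refine (Category.assoc _ _ _).trans ?_
  refine (congrArg (_ ≫ ·) (gamι_vertex (𝟙 W') k A)).trans ?_
  refine Eq.trans ?_ (congrArg (· ≫ f) (gamι_vertex (𝟙 W) k A)).symm
  change endF f A.1.unop.len ≫ _ = _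
  generalize (A.e.toOrderHom k : ℕ) = x
  generalize A.1.unop.len = n
  match n, x with
  | 0, _ => exact (Category.comp_id f).trans (Category.id_comp f).symm
  | 1, 0 => exact comp_zero.trans zero_comp.symm
  | 1, _ + 1 => exact (Category.comp_id f).trans (Category.id_comp f).symm
  | n + 2, _ => exact (isZero_zero C).eq_of_src _ _

theorem gamHom_ρ {W W' : C} (f : W ⟶ W') {m : ℕ} (k : Fin (m + 1)) :
    gamHom f m ≫ ρ W' k = ρ W k ≫ f := by
  induction k using Fin.cases with
  | zero => exact gamHom_vertex f 0
  | succ k =>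
    refine (Preadditive.comp_sub _ _ _).trans ?_
    refine Eq.trans ?_ (Preadditive.sub_comp _ _ _).symm
    rw [gamHom_vertex, gamHom_vertex]

theorem gamδ_naturality {W W' : C} (a : W ⟶ W) (b : W' ⟶ W') (f : W ⟶ W') (h : a ≫ f = f ≫ b)
    {m : ℕ} (i : Fin (m + 2)) : gamδ a i ≫ gamHom f m = gamHom f (m + 1) ≫ gamδ b i := by
  let φ : endComplex a ⟶ endComplex b := topFunctor.map (ofEndMap a b f h)
  have h := (Γ₀.map φ).naturality (SimplexCategory.δ i).op
  exact ((congrArg (_ ≫ ·) (map_app φ _)).symm.trans h).trans (congrArg (· ≫ _) (map_app φ _))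

theorem exists_desc (G : C ⥤ D) (W : C) {m : ℕ} {V : D} (φ : G.obj (gam (m + 1) W) ⟶ V)
    (h : ∀ i, G.map (gamσ W i) ≫ φ = 0) : ∃ q, proj G (endX W) (m + 1) ≫ q = φ :=
  ⟨cokernel.desc _ φ (Sigma.hom_ext _ _ fun i => by rw [Sigma.ι_desc_assoc, comp_zero, h]),
    cokernel.π_desc _ _ _⟩

section

variable {J : Type*} [Category* J] (G : C ⥤ D) {W : J ⥤ C} (α : W ⟶ W)

/-- The diagram of the binary complexes `N G Γ[W; α]`. -/
def normDiagram : J ⥤ BinaryComplex D := endDiagram α ⋙ functor G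

/-- The diagram of the `m`-simplices is a power of the given diagram. -/
def gamDiagramPower (W : J ⥤ C) (m : ℕ) : Power (Fin (m + 1)) W (W ⋙ gamFunctor m) where
  ρ i :=
    { app := fun j => ρ (W.obj j) i
      naturality := fun _ _ f => gamHom_ρ (W.map f) i }
  inc i :=
    { app := fun j => inc (W.obj j) i
      naturality := fun j j' f => (gamPower (W.obj j') m).hom_ext fun k => by
        change (W.map f ≫ inc (W.obj j') i) ≫ ρ (W.obj j') k =
          (inc (W.obj j) i ≫ gamHom (W.map f) m) ≫ ρ (W.obj j') k
        rw [Category.assoc, Category.assoc, gamHom_ρ]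
        by_cases h : i = k
        · subst h
          rw [inc_ρ_self, Category.comp_id, ← Category.assoc, inc_ρ_self, Category.id_comp]
        · rw [inc_ρ_ne _ h, ← Category.assoc, inc_ρ_ne _ h, comp_zero, zero_comp] }
  inc_ρ_self i := NatTrans.ext (funext fun j => inc_ρ_self (W.obj j) i)
  inc_ρ_ne h := NatTrans.ext (funext fun j => inc_ρ_ne (W.obj j) h)
  total := NatTrans.ext (funext fun j => by
    rw [NatTrans.app_sum]
    exact ρ_inc_total (W.obj j) m)

theorem act_app (m : ℕ) (j : J) :
    ((gamDiagramPower W m).act 0 α).app j = (gamPower (W.obj j) m).act 0 (α.app j) := by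
  rw [Power.act, Power.diag, Power.lift_app]
  refine Finset.sum_congr rfl fun i _ => ?_
  by_cases h : i = 0
  · simp only [if_pos h]
    rfl
  · simp only [if_neg h]
    rfl

theorem incl_app (m : ℕ) (j : J) :
    ((gamDiagramPower W (m + 1)).lift (Fin.cases 0 (gamDiagramPower W m).ρ)).app j =
      gamIncl (W.obj j) m := by
  rw [Power.lift_app]
  refine Finset.sum_congr rfl fun i _ => ?_
  induction i using Fin.cases <;> rfl

/-- The properties of the binary complex `N G Γ[W; α]` of diagrams. -/
def simplicialPower [IsIso α] :
    SimplicialPower ((Functor.whiskeringRight J C D).obj G) α (toDiagrams (normDiagram G α)) where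
  Z m := W ⋙ gamFunctor m
  P := gamDiagramPower W
  σ m i :=
    { app := fun j => gamσ (W.obj j) i
      naturality := fun _ _ f =>
        ((Γ₀.map (gradedMap (endF (W.map f)))).naturality (SimplexCategory.σ i).op).symm }
  δTop m i :=
    { app := fun j => gamδ (α.app j) i
      naturality := fun _ _ f => (gamδ_naturality _ _ _ (α.naturality f).symm i).symm }
  δBot m i :=
    { app := fun j => gamδ (𝟙 _) i
      naturality := fun _ _ f => (gamδ_naturality _ _ _
        ((Category.id_comp _).trans (Category.comp_id _).symm) i).symm }
  p m :=
    { app := fun j => proj G (endX (W.obj j)) m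
      naturality := fun _ _ f => (proj_map G (endF (W.map f)) m).symm }
  σ_ρ m i := NatTrans.ext (funext fun j => gamσ_ρ (W.obj j) i)
  factor m i _ f h := NatTrans.ext (funext fun j =>
    factor_gamσ i (f.app j) (congrArg (fun f => NatTrans.app f j) h))
  δTop_zero m := NatTrans.ext (funext fun j => by
    rw [act_app, NatTrans.comp_app, incl_app]
    exact gamIncl_gamδ_zero (α.app j) m)
  δBot_zero m := NatTrans.ext (funext fun j => by
    rw [NatTrans.comp_app, incl_app]
    refine (gamIncl_gamδ_zero (𝟙 (W.obj j)) m).trans ?_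
    simp only [Power.act, ite_self]
    exact Power.diag_one _)
  δTop_succ m i := NatTrans.ext (funext fun j => by
    rw [NatTrans.comp_app, incl_app]
    exact gamIncl_gamδ_succ (α.app j) i)
  δBot_succ m i := NatTrans.ext (funext fun j => by
    rw [NatTrans.comp_app, incl_app]
    exact gamIncl_gamδ_succ (𝟙 (W.obj j)) i)
  epi_p m := by
    have : ∀ j, Epi (proj G (endX (W.obj j)) m) := fun j => inferInstance
    exact @NatTrans.epi_of_epi_app _ _ _ _ _ _ _ this
  σ_p m i := NatTrans.ext (funext fun j => σ_proj G (endX (W.obj j)) m i)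
  desc_zero φ := ⟨{ app := fun j => φ.app j, naturality := fun _ _ f => φ.naturality f },
    NatTrans.ext (funext fun _ => Category.id_comp _)⟩
  desc_succ m _ φ h := by
    choose q hp using fun j => exists_desc G (W.obj j) (φ.app j) fun i =>
      congrArg (fun f => NatTrans.app f j) (h i)
    refine ⟨{ app := q, naturality := fun j j' f => ?_ }, NatTrans.ext (funext hp)⟩
    refine (cancel_epi (proj G (endX (W.obj j)) (m + 1))).1 ?_
    refine (Category.assoc _ _ _).symm.trans ?_
    refine (congrArg (· ≫ _) (proj_map G (endF (W.map f)) (m + 1))).trans ?_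
    refine (Category.assoc _ _ _).trans ((congrArg (_ ≫ ·) (hp j')).trans ?_)
    refine (φ.naturality f).trans ?_
    exact (congrArg (· ≫ _) (hp j)).symm.trans (Category.assoc _ _ _)
  p_dTop m := NatTrans.ext (funext fun j => by
    rw [NatTrans.comp_app, NatTrans.comp_app, NatTrans.app_sum]
    exact proj_diff G (endComplex (α.app j)) m)
  p_dBot m := NatTrans.ext (funext fun j => by
    rw [NatTrans.comp_app, NatTrans.comp_app, NatTrans.app_sum]
    exact proj_diff G (endComplex (𝟙 (W.obj j))) m)

end

end DoldKan

theorem moebius_app {J : Type*} [Category* J] {B : Type*} [Category* B] [Preadditive B]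
    {I : Type*} [DecidableEq I] {F F' : J ⥤ B} (w : Finset I → (F ⟶ F')) (L T : Finset I) (j : J) :
    (moebius w L T).app j = moebius (fun S => (w S).app j) L T := by
  rw [moebius, NatTrans.app_sum]
  rfl

theorem DegreeLE.whiskeringRight {J : Type*} [Category* J] {C D : Type*} [Category* C]
    [Preadditive C] [Category* D] [Preadditive D] {r : ℕ} {G : C ⥤ D} (hG : DegreeLE r G) :
    DegreeLE r ((Functor.whiskeringRight J C D).obj G) := by
  intro m hm X Y f
  refine NatTrans.ext (funext fun j => ?_)
  rw [moebius_app]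
  refine Eq.trans ?_ (hG m hm fun i => (f i).app j)
  congr 1
  funext S
  change G.map ((∑ i ∈ S, f i).app j) = _
  rw [NatTrans.app_sum]

section

variable {C : Type u} [Category.{v} C] [Preadditive C] [HasFiniteColimits C] [HasZeroObject C]
  {D : Type u} [Category.{v} D] [Preadditive D] [HasZeroObject D]
  {J : Type*} [Category* J] {E : ExactData D} {G : C ⥤ D} {W : J ⥤ C} (α : W ⟶ W) [IsIso α]

/-- The function whose iterated differences give the value of an invariant on `N G Γ[W; α]`. -/
def Inv.powerVal {A : Type*} [AddCommGroup A] (χ : Inv (E.binary.functor J) A) (G : C ⥤ D)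
    {W : J ⥤ C} (α : W ⟶ W) (t : ℕ) : A :=
  χ.val (endDiagram (Functor.whiskerRight ((DoldKan.gamDiagramPower W t).act 0 α) G))

theorem isIso_whiskerRight {B B' : Type*} [Category* B] [Category* B'] (G : B ⥤ B')
    {F F' : J ⥤ B} (φ : F ⟶ F') [IsIso φ] : IsIso (Functor.whiskerRight φ G) :=
  inferInstanceAs (IsIso (((Functor.whiskeringRight J B B').obj G).map φ))

/-- The function `powerVal` may be computed with any power in place of the simplices of `Γ`. -/
theorem Inv.powerVal_eq {A : Type*} [AddCommGroup A] (χ : Inv (E.binary.functor J) A)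
    (hW : ∀ m j, E.good (G.obj (DoldKan.gam m (W.obj j)))) {t : ℕ} {Z : J ⥤ C}
    (P : Power (Fin (t + 1)) W Z) :
    (E.functor J).good (Z ⋙ G) ∧
      χ.val (endDiagram (Functor.whiskerRight (P.act 0 α) G)) = χ.powerVal G α t := by
  let Φ := (Functor.whiskeringRight J C D).obj G
  have i1 := isIso_whiskerRight G (P.act 0 α)
  have i2 := isIso_whiskerRight G ((DoldKan.gamDiagramPower W t).act 0 α)
  obtain ⟨h1, h2⟩ := Power.val_act (Φ := Φ) (α := α) (χ.comap _ _ E.preserves_ofDiagrams)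
    (DoldKan.gamDiagramPower W t) P (hW t)
  refine ⟨h1, ?_⟩
  exact ((χ.val_ofDiagrams_ofEnd (Functor.whiskerRight (P.act 0 α) G) h1).symm.trans h2.symm).trans
    (χ.val_ofDiagrams_ofEnd _ (hW t))

theorem Inv.powerVal_comap {A : Type*} [AddCommGroup A] (χ : Inv (E.binary.functor J) A)
    (hW : ∀ m j, E.good (G.obj (DoldKan.gam m (W.obj j)))) :
    (fun t => (χ.comap _ _ E.preserves_ofDiagrams).val (ofEnd
      (((Functor.whiskeringRight J C D).obj G).map ((DoldKan.gamDiagramPower W t).act 0 α)))) =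
      χ.powerVal G α :=
  funext fun t =>
    have := isIso_whiskerRight G ((DoldKan.gamDiagramPower W t).act 0 α)
    χ.val_ofDiagrams_ofEnd (Functor.whiskerRight ((DoldKan.gamDiagramPower W t).act 0 α) G) (hW t)

variable [HasFiniteColimits D]

/-- The binary complex `N G Γ[W; α]` is bounded and contractible for a functor `G` of finite degree.
-/
theorem good_normDiagram (h0 : ∀ X Y : C, G.map (0 : X ⟶ Y) = 0) {r : ℕ} (hr : DegreeLE r G)
    (hW : ∀ m j, E.good (G.obj (DoldKan.gam m (W.obj j)))) :
    (E.binary.functor J).good (DoldKan.normDiagram G α) :=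
  E.preserves_ofDiagrams.good _ (SimplicialPower.good_and_val.{_, _, _, _, 0}
    (DoldKan.simplicialPower G α) (E := E.functor J)
    (fun _ _ => NatTrans.ext (funext fun _ => h0 _ _)) hr.whiskeringRight hW).1

/-- The value of an additive invariant on `N G Γ[W; α]`. -/
theorem Inv.val_normDiagram {A : Type*} [AddCommGroup A] (χ : Inv (E.binary.functor J) A)
    (h0 : ∀ X Y : C, G.map (0 : X ⟶ Y) = 0) {r : ℕ} (hr : DegreeLE r G)
    (hW : ∀ m j, E.good (G.obj (DoldKan.gam m (W.obj j)))) :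
    χ.val (DoldKan.normDiagram G α) =
      ∑ m ∈ Finset.range r, (-1 : ℤ) ^ m • (fwdDiff 1)^[m] (χ.powerVal G α) 0 := by
  have h := ((DoldKan.simplicialPower G α).good_and_val (E := E.functor J)
    (fun _ _ => NatTrans.ext (funext fun _ => h0 _ _)) hr.whiskeringRight hW).2
      (χ.comap _ _ E.preserves_ofDiagrams)
  rwa [← χ.powerVal_comap α hW]

/-- For a functor of degree at most `r`, the function `powerVal` is polynomial of degree less than
`r`. -/
theorem Inv.fwdDiff_powerVal {A : Type*} [AddCommGroup A] (χ : Inv (E.binary.functor J) A)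
    {r : ℕ} (hr : DegreeLE r G)
    (hW : ∀ m j, E.good (G.obj (DoldKan.gam m (W.obj j)))) {m : ℕ} (hm : r ≤ m) :
    (fwdDiff 1)^[m] (χ.powerVal G α) 0 = 0 := by
  have h := (DoldKan.simplicialPower G α).fwdDiff_eq_zero (E := E.functor J)
      (χ.comap _ _ E.preserves_ofDiagrams) hr.whiskeringRight hW hm
  rwa [← χ.powerVal_comap α hW]

end

end
end GraysonK

namespace GraysonK
noncomputable section

/-! ### Diagrams with an automorphism -/

open BinaryComplex ZeroObject

attribute [local instance] HasFiniteBiproducts.of_hasFiniteCoproducts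
  HasBinaryBiproducts.of_hasBinaryCoproducts

/-- The category whose diagrams are the diagrams of shape `J` with an automorphism: the product of
`J` with the group `ℤ`. -/
abbrev Loop (J : Type*) : Type _ := SingleObj (Multiplicative ℤ) × J

instance isIso_aut_hom {B : Type*} [Category* B] {R : B} (x : Aut R) : IsIso x.hom :=
  Iso.isIso_hom x

namespace Loop

section

variable {J : Type*} [Category* J] {D : Type*} [Category* D]

/-- The inclusion of `J`. -/
def incl : J ⥤ Loop J where
  obj j := (SingleObj.star _, j)
  map f := (𝟙 _, f)

/-- The automorphism given by the generator. -/
def aut (R : Loop J ⥤ D) : Aut (incl ⋙ R) :=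
  NatIso.ofComponents (fun j => R.mapIso
    (Iso.prod (asIso (X := SingleObj.star (Multiplicative ℤ)) (Y := SingleObj.star _)
      (Multiplicative.ofAdd (1 : ℤ))) (Iso.refl j))) fun {j j'} f => by
    change R.map _ ≫ R.map _ = R.map _ ≫ R.map _
    rw [← R.map_comp, ← R.map_comp]
    congr 1
    refine Prod.ext ?_ ?_
    · exact (Category.id_comp _).trans (Category.comp_id _).symm
    · exact (Category.comp_id _).trans (Category.id_comp _).symm

theorem aut_naturality {R S : Loop J ⥤ D} (φ : R ⟶ S) :
    (aut R).hom ≫ Functor.whiskerLeft incl φ = Functor.whiskerLeft incl φ ≫ (aut S).hom :=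
  NatTrans.ext (funext fun _ => φ.naturality _)

/-- The diagram on `Loop J` given by a diagram with an automorphism. -/
def diagram (R : J ⥤ D) (b : Aut R) : Loop J ⥤ D where
  obj p := R.obj p.2
  map {p q} f :=
    (b ^ (Multiplicative.toAdd (show Multiplicative ℤ from f.1))).hom.app p.2 ≫ R.map f.2
  map_id p := by
    change (b ^ (0 : ℤ)).hom.app p.2 ≫ R.map (𝟙 _) = _
    rw [zpow_zero, R.map_id]
    exact Category.id_comp _
  map_comp {p q s} f g := by
    have key (m n : ℤ) : (b ^ (m + n)).hom = (b ^ n).hom ≫ (b ^ m).hom :=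
      congrArg Iso.hom (zpow_add b m n)
    change (b ^ ((Multiplicative.toAdd (show Multiplicative ℤ from g.1)) +
      (Multiplicative.toAdd (show Multiplicative ℤ from f.1)))).hom.app p.2 ≫
        R.map (f.2 ≫ g.2) = _
    rw [key, NatTrans.comp_app, R.map_comp, Category.assoc, Category.assoc,
      NatTrans.naturality_assoc]

/-- Restricting `diagram R b` gives back `R`. -/
def inclDiagram (R : J ⥤ D) (b : Aut R) : incl ⋙ diagram R b ≅ R :=
  NatIso.ofComponents (fun j => Iso.refl _) fun {j j'} f => by
    change ((b ^ (0 : ℤ)).hom.app j ≫ R.map f) ≫ 𝟙 _ = 𝟙 _ ≫ R.map f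
    rw [zpow_zero, Category.comp_id]
    rfl

theorem aut_diagram (R : J ⥤ D) (b : Aut R) :
    (aut (diagram R b)).hom ≫ (inclDiagram R b).hom = (inclDiagram R b).hom ≫ b.hom :=
  NatTrans.ext (funext fun j => by
    change ((b ^ (1 : ℤ)).hom.app j ≫ R.map (𝟙 j)) ≫ 𝟙 _ = 𝟙 _ ≫ b.hom.app j
    rw [zpow_one, R.map_id, Category.id_comp, Category.comp_id, Category.comp_id])

/-- An automorphism that commutes with the given one. -/
def map {R : J ⥤ D} {a b : Aut R} (h : Commute a b) : Aut (diagram R b) :=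
  NatIso.ofComponents (fun p => a.app p.2) fun {p q} f => by
    have h' : ∀ n : ℤ, (b ^ n).hom ≫ a.hom = a.hom ≫ (b ^ n).hom :=
      fun n => congrArg Iso.hom (h.zpow_right n).eq
    change ((b ^ _).hom.app p.2 ≫ R.map f.2) ≫ a.hom.app q.2 =
      a.hom.app p.2 ≫ (b ^ _).hom.app p.2 ≫ R.map f.2
    rw [Category.assoc, a.hom.naturality, ← Category.assoc, ← NatTrans.comp_app, h',
      NatTrans.comp_app, Category.assoc]

end

end Loop

section

variable {J : Type*} [Category* J] {D : Type*} [Category* D] [Preadditive D] [HasZeroObject D]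

/-- Functoriality of the diagram of two-term complexes. -/
def endDiagramMap {W W' : J ⥤ D} {α : W ⟶ W} {β : W' ⟶ W'} (f : W ⟶ W') (h : α ≫ f = f ≫ β) :
    endDiagram α ⟶ endDiagram β where
  app j := ofEndMap _ _ (f.app j) (congrArg (fun f => NatTrans.app f j) h)
  naturality _ _ g := BinaryComplex.hom_ext fun k => match k with
    | 0 => f.naturality g
    | 1 => f.naturality g
    | _ + 2 => (isZero_zero D).eq_of_src _ _

theorem endDiagram_hom_ext {W W' : J ⥤ D} {α : W ⟶ W} {β : W' ⟶ W'}
    {f g : endDiagram α ⟶ endDiagram β} (h0 : ∀ j, (f.app j).f 0 = (g.app j).f 0)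
    (h1 : ∀ j, (f.app j).f 1 = (g.app j).f 1) : f = g :=
  NatTrans.ext (funext fun j => BinaryComplex.hom_ext fun k => match k with
    | 0 => h0 j
    | 1 => h1 j
    | _ + 2 => (isZero_zero D).eq_of_src _ _)

/-- Functoriality of the diagram of two-term complexes for isomorphisms. -/
def endDiagramIso {W W' : J ⥤ D} {α : W ⟶ W} {β : W' ⟶ W'} (e : W ≅ W')
    (h : α ≫ e.hom = e.hom ≫ β) : endDiagram α ≅ endDiagram β where
  hom := endDiagramMap e.hom h
  inv := endDiagramMap e.inv (by rw [Iso.eq_inv_comp, ← reassoc_of% h, e.hom_inv_id, Category.comp_id])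
  hom_inv_id := endDiagram_hom_ext (fun j => e.hom_inv_id_app j) (fun j => e.hom_inv_id_app j)
  inv_hom_id := endDiagram_hom_ext (fun j => e.inv_hom_id_app j) (fun j => e.inv_hom_id_app j)

instance {W W' : J ⥤ D} {α : W ⟶ W} {β : W' ⟶ W'} (f : W ⟶ W') (h : α ≫ f = f ≫ β) [IsIso f] :
    IsIso (endDiagramMap f h) :=
  (endDiagramIso (asIso f) h).isIso_hom

variable {E : ExactData D} {A : Type*} [AddCommGroup A]

theorem Inv.val_endDiagram_iso (χ : Inv (E.binary.functor J) A) {W W' : J ⥤ D} {α : W ⟶ W}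
    {β : W' ⟶ W'} [IsIso β] (hW' : (E.functor J).good W') (e : W ≅ W')
    (h : α ≫ e.hom = e.hom ≫ β) : χ.val (endDiagram α) = χ.val (endDiagram β) :=
  χ.val_iso (endDiagramIso e h) (E.good_endDiagram β hW')

/-- The rule `[ab] = [a] + [b]` for diagrams. -/
theorem Inv.val_endDiagram_comp [HasFiniteColimits D] (χ : Inv (E.binary.functor J) A) {W : J ⥤ D}
    (hW : (E.functor J).good W) (α β : W ⟶ W) [IsIso α] [IsIso β] :
    χ.val (endDiagram (α ≫ β)) = χ.val (endDiagram α) + χ.val (endDiagram β) := by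
  have h := (χ.comap _ _ E.preserves_ofDiagrams).val_ofEnd_comp hW α β
  exact ((χ.val_ofDiagrams_ofEnd (α ≫ β) hW).symm.trans h).trans
    (congrArg₂ _ (χ.val_ofDiagrams_ofEnd α hW) (χ.val_ofDiagrams_ofEnd β hW))

/-- The diagram of two-term complexes on a diagram with an automorphism. -/
def Loop.toEnd : (Loop J ⥤ D) ⥤ (J ⥤ BinaryComplex D) where
  obj R := endDiagram (Loop.aut R).hom
  map φ := endDiagramMap (Functor.whiskerLeft Loop.incl φ) (Loop.aut_naturality φ)
  map_id _ := endDiagram_hom_ext (fun _ => rfl) (fun _ => rfl)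
  map_comp _ _ := endDiagram_hom_ext (fun _ => rfl) (fun _ => rfl)

theorem ExactData.preserves_toEnd (E : ExactData D) :
    (E.functor (Loop J)).Preserves (E.binary.functor J) Loop.toEnd some where
  good _ h := E.good_endDiagram _ fun _ => h _
  ses _ _ _ _ _ h _ k := match k with
    | 0 => h _
    | 1 => h _
    | _ + 2 => E.ses_of_isSplit _ _
        (isSplit_of_isZero _ _ (isZero_zero D) (isZero_zero D) (isZero_zero D))
  diag i _ _ h _ k := match k with
    | 0 => h _
    | 1 => h _
    | _ + 2 => E.isDiag_of_isZero i (isZero_zero D)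

/-- The additive invariant of diagrams with an automorphism that is induced by an additive invariant
of diagrams of binary complexes. -/
def Inv.loop (χ : Inv (E.binary.functor J) A) : Inv (E.functor (Loop J)) A :=
  χ.comap _ _ E.preserves_toEnd

/-- The value of the induced invariant, in terms of any description of the underlying diagram and of
its automorphism. -/
theorem Inv.val_loop (χ : Inv (E.binary.functor J) A) (R : Loop J ⥤ D) {S : J ⥤ D} {s : S ⟶ S}
    [IsIso s] (e : Loop.incl ⋙ R ≅ S) (h : (Loop.aut R).hom ≫ e.hom = e.hom ≫ s)
    (hS : (E.functor J).good S) : χ.loop.val R = χ.val (endDiagram s) :=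
  χ.val_endDiagram_iso hS e h

/-! ### Pairs of commuting automorphisms -/

/-- The value on the diagram of double complexes given by two commuting automorphisms. -/
def Inv.val₂ (χ : Inv (E.binary.binary.functor J) A) {R : J ⥤ D} (x y : Aut R)
    (h : Commute x y) : A :=
  χ.val (endDiagram (endDiagramMap (α := x.hom) (β := x.hom) y.hom (congrArg Iso.hom h.eq.symm)))

theorem Inv.val₂_iso (χ : Inv (E.binary.binary.functor J) A) {R R' : J ⥤ D} {x y : Aut R}
    {x' y' : Aut R'} (h : Commute x y) (h' : Commute x' y') (hR : (E.functor J).good R') (e : R ≅ R')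
    (hx : x.hom ≫ e.hom = e.hom ≫ x'.hom) (hy : y.hom ≫ e.hom = e.hom ≫ y'.hom) :
    χ.val₂ x y h = χ.val₂ x' y' h' :=
  χ.val_endDiagram_iso (E.good_endDiagram _ hR) (endDiagramIso e hx)
    (endDiagram_hom_ext (fun j => congrArg (fun f => NatTrans.app f j) hy)
      (fun j => congrArg (fun f => NatTrans.app f j) hy))

theorem Inv.val₂_mul_right [HasFiniteColimits D] (χ : Inv (E.binary.binary.functor J) A) {R : J ⥤ D}
    (hR : (E.functor J).good R) (x y z : Aut R) (hy : Commute x y) (hz : Commute x z) :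
    χ.val₂ x (y * z) (hy.mul_right hz) = χ.val₂ x y hy + χ.val₂ x z hz := by
  have h := χ.val_endDiagram_comp (E.good_endDiagram x.hom hR)
    (endDiagramMap (α := x.hom) (β := x.hom) z.hom (congrArg Iso.hom hz.eq.symm))
    (endDiagramMap (α := x.hom) (β := x.hom) y.hom (congrArg Iso.hom hy.eq.symm))
  rw [add_comm] at h
  refine Eq.trans ?_ h
  unfold Inv.val₂
  congr 2
  exact endDiagram_hom_ext (fun _ => rfl) (fun _ => rfl)

/-- The diagram of two-term complexes, restricted from `Loop J`. -/
def Loop.inclEndDiagram {R : J ⥤ D} {a b : Aut R} (h : Commute a b) :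
    Loop.incl ⋙ endDiagram (Loop.map h).hom ≅ endDiagram a.hom :=
  NatIso.ofComponents (fun _ => Iso.refl _) fun f => BinaryComplex.hom_ext fun k =>
    match k with
    | 0 => (Loop.inclDiagram R b).hom.naturality f
    | 1 => (Loop.inclDiagram R b).hom.naturality f
    | _ + 2 => (isZero_zero D).eq_of_src _ _

theorem Loop.aut_inclEndDiagram {R : J ⥤ D} {a b : Aut R} (h : Commute a b) :
    (Loop.aut (endDiagram (Loop.map h).hom)).hom ≫ (Loop.inclEndDiagram h).hom =
      (Loop.inclEndDiagram h).hom ≫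
        endDiagramMap (α := a.hom) (β := a.hom) b.hom (congrArg Iso.hom h.eq.symm) :=
  NatTrans.ext (funext fun j => BinaryComplex.hom_ext fun k => match k with
    | 0 => congrArg (fun f => NatTrans.app f j) (Loop.aut_diagram R b)
    | 1 => congrArg (fun f => NatTrans.app f j) (Loop.aut_diagram R b)
    | _ + 2 => (isZero_zero D).eq_of_src _ _)

/-- The second automorphism may be regarded as a part of the diagram. -/
theorem Inv.val₂_eq_loop (χ : Inv (E.binary.binary.functor J) A) {R : J ⥤ D}
    (hR : (E.functor J).good R) (x y : Aut R) (h : Commute x y) :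
    χ.val₂ x y h = χ.loop.val (endDiagram (Loop.map h).hom) :=
  (χ.val_loop _ (Loop.inclEndDiagram h) (Loop.aut_inclEndDiagram h)
    (E.good_endDiagram x.hom hR)).symm

/-- Additivity in the inner direction follows from additivity in the outer one, once the other
automorphism is regarded as a part of the diagram. -/
theorem Inv.val₂_mul_left [HasFiniteColimits D] (χ : Inv (E.binary.binary.functor J) A) {R : J ⥤ D}
    (hR : (E.functor J).good R) (x y z : Aut R) (hx : Commute x z) (hy : Commute y z) :
    χ.val₂ (x * y) z (hx.mul_left hy) = χ.val₂ x z hx + χ.val₂ y z hy := by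
  rw [χ.val₂_eq_loop hR, χ.val₂_eq_loop hR, χ.val₂_eq_loop hR]
  have h := χ.loop.val_endDiagram_comp (W := Loop.diagram R z) (fun p => hR p.2)
    (Loop.map hy).hom (Loop.map hx).hom
  rw [add_comm] at h
  refine Eq.trans ?_ h
  congr 2

end

end
end GraysonK

namespace GraysonK
noncomputable section

/-! ### Pairs of automorphisms of powers -/

open BinaryComplex ZeroObject

attribute [local instance] HasFiniteBiproducts.of_hasFiniteCoproducts
  HasBinaryBiproducts.of_hasBinaryCoproducts

/-- A biadditive function of pairs of subsets that is invariant under permutations depends only on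
the cardinality of the product of the subsets and on the cardinality of their intersection. This is
the special case of a horizontal and a vertical line in a grid. -/
theorem biadditive_grid {M : Type*} [AddCommGroup M] {I I' : Type*} [Fintype I] [DecidableEq I]
    [Fintype I'] [DecidableEq I'] (ψ : Finset (I × I') → Finset (I × I') → M)
    (h0 : ∀ T, ψ ∅ T = 0) (h0' : ∀ S, ψ S ∅ = 0)
    (h1 : ∀ i S T, i ∉ S → ψ (insert i S) T = ψ {i} T + ψ S T)
    (h1' : ∀ i S T, i ∉ T → ψ S (insert i T) = ψ S {i} + ψ S T)
    (hσ : ∀ (σ : Equiv.Perm (I × I')) i j, ψ {σ i} {σ j} = ψ {i} {j}) (x : I) (y : I') :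
    ψ (Finset.univ.filter fun p => p.1 = x) (Finset.univ.filter fun p => p.2 = y) =
      ψ {(x, y)} Finset.univ := by
  have hl (S T) : ψ S T = ∑ i ∈ S, ψ {i} T := by
    induction S using Finset.induction_on with
    | empty => exact h0 T
    | insert i S hi ih => rw [h1 i S T hi, Finset.sum_insert hi, ih]
  have hr (S T) : ψ S T = ∑ i ∈ T, ψ S {i} := by
    induction T using Finset.induction_on with
    | empty => exact h0' S
    | insert i T hi ih => rw [h1' i S T hi, Finset.sum_insert hi, ih]
  -- permutations act transitively on the pairs of equal and on the pairs of distinct elements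
  have hsym (i j i' j' : I × I') (h : i = j ↔ i' = j') : ψ {i} {j} = ψ {i'} {j'} := by
    by_cases hij : i = j
    · have hij' := h.1 hij
      subst hij hij'
      rw [← hσ (Equiv.swap i i') i i, Equiv.swap_apply_left]
    · have hij' : i' ≠ j' := fun e => hij (h.2 e)
      let τ := Equiv.swap i i'
      have hτ : τ j ≠ i' := fun e => hij (τ.injective ((Equiv.swap_apply_left i i').trans e.symm))
      rw [← hσ (τ.trans (Equiv.swap (τ j) j')) i j]
      simp only [Equiv.trans_apply, Equiv.swap_apply_left]
      rw [show τ i = i' from Equiv.swap_apply_left i i', Equiv.swap_apply_of_ne_of_ne hτ.symm hij']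
  rw [hl, hr {(x, y)}, Fintype.sum_prod_type_right]
  have e1 : (Finset.univ.filter fun p : I × I' => p.1 = x) =
      Finset.univ.map (Function.Embedding.sectR x I') := by
    ext ⟨p, q⟩
    simp [eq_comm]
  have e2 : (Finset.univ.filter fun p : I × I' => p.2 = y) =
      Finset.univ.map (Function.Embedding.sectL I y) := by
    ext ⟨p, q⟩
    simp [eq_comm]
  rw [e1, Finset.sum_map]
  refine Finset.sum_congr rfl fun q _ => ?_
  rw [hr, e2, Finset.sum_map]
  refine Finset.sum_congr rfl fun p _ => hsym _ _ _ _ ?_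
  simp only [Function.Embedding.sectR_apply, Function.Embedding.sectL_apply, Prod.mk.injEq]
  exact ⟨fun h => ⟨h.1, h.2.symm⟩, fun h => ⟨h.1, h.2.symm⟩⟩

namespace Power

section

variable {B : Type*} [Category* B] [Preadditive B] {I I' : Type*} [Fintype I] [Fintype I']
  {W Z Z' : B}

/-- A power of a power. -/
def comp [DecidableEq I'] (P' : Power I' Z Z') (P : Power I W Z) : Power (I' × I) W Z' where
  ρ p := P'.ρ p.1 ≫ P.ρ p.2
  inc p := P.inc p.2 ≫ P'.inc p.1
  inc_ρ_self p := by
    rw [Category.assoc, reassoc_of% P'.inc_ρ_self, P.inc_ρ_self]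
  inc_ρ_ne {p q} h := by
    by_cases h1 : p.1 = q.1
    · have h2 : p.2 ≠ q.2 := fun h2 => h (Prod.ext h1 h2)
      rw [Category.assoc, h1, reassoc_of% P'.inc_ρ_self, P.inc_ρ_ne h2]
    · rw [Category.assoc, reassoc_of% P'.inc_ρ_ne h1, zero_comp, comp_zero]
  total := by
    rw [Fintype.sum_prod_type, ← P'.total]
    refine Finset.sum_congr rfl fun i _ => ?_
    conv_rhs => rw [← Category.id_comp (P'.inc i), ← P.total, Preadditive.sum_comp,
      Preadditive.comp_sum]
    simp only [Category.assoc]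

/-- Two powers with the same number of factors are isomorphic. -/
def iso (P : Power I W Z) (P' : Power I' W Z') (e : I ≃ I') : Z ≅ Z' where
  hom := P'.lift fun i => P.ρ (e.symm i)
  inv := P.lift fun i => P'.ρ (e i)
  hom_inv_id := P.hom_ext fun i => by
    rw [Category.assoc, lift_ρ, lift_ρ, Equiv.symm_apply_apply, Category.id_comp]
  inv_hom_id := P'.hom_ext fun i => by
    rw [Category.assoc, lift_ρ, lift_ρ, Equiv.apply_symm_apply, Category.id_comp]

theorem iso_hom_ρ (P : Power I W Z) (P' : Power I' W Z') (e : I ≃ I') (i : I') :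
    (P.iso P' e).hom ≫ P'.ρ i = P.ρ (e.symm i) := P'.lift_ρ _ _

/-- Diagonal automorphisms of a power. -/
def diagAut (P : Power I W Z) : (I → Aut W) →* Aut Z where
  toFun f :=
    { hom := P.diag fun i => (f i).hom
      inv := P.diag fun i => (f i).inv
      hom_inv_id := by
        rw [P.diag_comp]
        exact (congrArg P.diag (funext fun i => Iso.hom_inv_id (f i))).trans P.diag_one
      inv_hom_id := by
        rw [P.diag_comp]
        exact (congrArg P.diag (funext fun i => Iso.inv_hom_id (f i))).trans P.diag_one }
  map_one' := Iso.ext P.diag_one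
  map_mul' f g := Iso.ext (P.diag_comp (fun i => (g i).hom) fun i => (f i).hom).symm

theorem diagAut_hom (P : Power I W Z) (f : I → Aut W) :
    (P.diagAut f).hom = P.diag fun i => (f i).hom := rfl

theorem diagAut_ρ (P : Power I W Z) (f : I → Aut W) (i : I) :
    (P.diagAut f).hom ≫ P.ρ i = P.ρ i ≫ (f i).hom := P.diag_ρ _ i

theorem diagAut_iso (P : Power I W Z) (P' : Power I' W Z') (e : I ≃ I') (f : I → Aut W)
    (f' : I' → Aut W) (h : ∀ i, f i = f' (e i)) :
    (P.diagAut f).hom ≫ (P.iso P' e).hom = (P.iso P' e).hom ≫ (P'.diagAut f').hom :=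
  P'.hom_ext fun i => by
    rw [Category.assoc, Category.assoc, iso_hom_ρ, diagAut_ρ, diagAut_ρ, ← Category.assoc,
      iso_hom_ρ, h, Equiv.apply_symm_apply]

theorem comp_diagAut [DecidableEq I'] (P' : Power I' Z Z') (P : Power I W Z)
    (f : I' → I → Aut W) :
    P'.diagAut (fun i => P.diagAut (f i)) = (P'.comp P).diagAut fun p => f p.1 p.2 :=
  Iso.ext ((P'.comp P).hom_ext fun p => by
    rw [diagAut_ρ]
    change _ ≫ P'.ρ p.1 ≫ P.ρ p.2 = (P'.ρ p.1 ≫ P.ρ p.2) ≫ _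
    rw [← Category.assoc, diagAut_ρ, Category.assoc, Category.assoc, diagAut_ρ])

theorem commute_diagAut (P : Power I W Z) {f g : I → Aut W} (h : ∀ i, Commute (f i) (g i)) :
    Commute (P.diagAut f) (P.diagAut g) :=
  Commute.map (funext fun i => (h i).eq : f * g = g * f) P.diagAut

end

end Power

/-- The automorphism `a` on the indices in `S`, and `1` elsewhere. -/
def select {G : Type*} [Group G] {I : Type*} [DecidableEq I] (a : G) (S : Finset I) : I → G :=
  fun i => if i ∈ S then a else 1

theorem select_commute {G : Type*} [Group G] {I : Type*} [DecidableEq I] {a b : G}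
    (h : Commute a b) (S T : Finset I) (i : I) : Commute (select a S i) (select b T i) := by
  unfold select
  split_ifs
  exacts [h, Commute.one_right _, Commute.one_left _, Commute.one_left _]

theorem select_insert {G : Type*} [Group G] {I : Type*} [DecidableEq I] (a : G) {i : I}
    {S : Finset I} (hi : i ∉ S) : select a (insert i S) = select a {i} * select a S := by
  funext j
  simp only [select, Pi.mul_apply, Finset.mem_insert, Finset.mem_singleton]
  by_cases h : j = i
  · subst h
    simp [hi]
  · simp [h]

theorem select_empty {G : Type*} [Group G] {I : Type*} [DecidableEq I] (a : G) :
    select a (∅ : Finset I) = 1 := by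
  funext j
  simp [select]

section

variable {J : Type*} [Category* J] {C : Type*} [Category* C] [Preadditive C]
  {D : Type*} [Category* D] [Preadditive D] [HasZeroObject D] {E : ExactData D} {A : Type*}
  [AddCommGroup A] (χ : Inv (E.binary.binary.functor J) A)

theorem Inv.val₂_congr {R : J ⥤ D} {x x' y y' : Aut R} (h : Commute x y) (h' : Commute x' y')
    (hx : x = x') (hy : y = y') : χ.val₂ x y h = χ.val₂ x' y' h' := by
  subst hx hy
  rfl

theorem Inv.val₂_one_left [HasFiniteColimits D] {R : J ⥤ D} (hR : (E.functor J).good R) (y : Aut R)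
    (h : Commute 1 y) : χ.val₂ 1 y h = 0 := by
  have := χ.val₂_mul_left hR 1 1 y h h
  rw [χ.val₂_congr _ h (one_mul 1) rfl] at this
  simpa using this

theorem Inv.val₂_one_right [HasFiniteColimits D] {R : J ⥤ D} (hR : (E.functor J).good R) (x : Aut R)
    (h : Commute x 1) : χ.val₂ x 1 h = 0 := by
  have := χ.val₂_mul_right hR x 1 1 h h
  rw [χ.val₂_congr _ h rfl (one_mul 1)] at this
  simpa using this

/-- The automorphism of `Z ⋙ G` induced by an automorphism of `Z`. -/
abbrev whiskerAut (G : C ⥤ D) {Z : J ⥤ C} : Aut Z →* Aut (Z ⋙ G) :=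
  ((Functor.whiskeringRight J C D).obj G).mapAut Z

variable (G : C ⥤ D) {W : J ⥤ C} {a b : Aut W} (hab : Commute a b)

/-- The value for diagonal automorphisms of a power is invariant under renumbering the factors. -/
theorem Inv.val₂_diagAut_iso {I I' : Type*} [Fintype I] [Fintype I'] {Z Z' : J ⥤ C}
    (P : Power I W Z) (P' : Power I' W Z') (hZ : (E.functor J).good (Z' ⋙ G)) (e : I ≃ I')
    {f g : I → Aut W} {f' g' : I' → Aut W} (hf : ∀ i, f i = f' (e i)) (hg : ∀ i, g i = g' (e i))
    (h : ∀ i, Commute (f i) (g i)) (h' : ∀ i, Commute (f' i) (g' i)) :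
    χ.val₂ (whiskerAut G (P.diagAut f)) (whiskerAut G (P.diagAut g))
      ((P.commute_diagAut h).map _) =
    χ.val₂ (whiskerAut G (P'.diagAut f')) (whiskerAut G (P'.diagAut g'))
      ((P'.commute_diagAut h').map _) := by
  let Φ := (Functor.whiskeringRight J C D).obj G
  refine χ.val₂_iso _ _ hZ (Φ.mapIso (P.iso P' e)) ?_ ?_
  · exact ((Φ.map_comp _ _).symm.trans (congrArg Φ.map (P.diagAut_iso P' e f f' hf))).trans
      (Φ.map_comp _ _)
  · exact ((Φ.map_comp _ _).symm.trans (congrArg Φ.map (P.diagAut_iso P' e g g' hg))).trans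
      (Φ.map_comp _ _)

include hab in
/-- The value for the automorphisms `a` on a row and `b` on a column of a grid. -/
theorem Inv.val₂_grid [HasFiniteColimits D] {s t N : ℕ} {Z Z' Z'' : J ⥤ C}
    (P : Power (Fin (t + 1)) W Z) (P' : Power (Fin (s + 1)) Z Z') (P'' : Power (Fin (N + 1)) W Z'')
    (hN : N + 1 = (t + 1) * (s + 1)) (hZ : (E.functor J).good (Z'' ⋙ G))
    (h : Commute (whiskerAut G (P'.diagAut fun q => if q = 0 then P.diagAut (fun _ => a) else 1))
      (whiskerAut G (P'.diagAut fun _ => P.diagAut fun p => if p = 0 then b else 1)))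
    (h' : Commute (whiskerAut G (P''.diagAut fun q => if q = 0 then a else 1))
      (whiskerAut G (P''.diagAut fun _ => b))) :
    χ.val₂ _ _ h = χ.val₂ _ _ h' := by
  let Q := P'.comp P
  let e0 : Fin (s + 1) × Fin (t + 1) ≃ Fin (N + 1) := Fintype.equivFinOfCardEq (by
    rw [Fintype.card_prod, Fintype.card_fin, Fintype.card_fin, hN, mul_comm])
  -- a numbering of the grid that starts with the intersection of the row and the column
  let e := e0.trans (Equiv.swap (e0 (0, 0)) 0)
  have he : e (0, 0) = 0 := Equiv.swap_apply_left _ _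
  have hQ : (E.functor J).good (Z' ⋙ G) := (E.functor J).good_of_iso
    (((Functor.whiskeringRight J C D).obj G).mapIso (Q.iso P'' e)) hZ
  have hc (S T : Finset (Fin (s + 1) × Fin (t + 1))) := Q.commute_diagAut (select_commute hab S T)
  let ψ (S T : Finset (Fin (s + 1) × Fin (t + 1))) : A :=
    χ.val₂ (whiskerAut G (Q.diagAut (select a S))) (whiskerAut G (Q.diagAut (select b T)))
      ((hc S T).map _)
  have key := biadditive_grid ψ (fun T => ?_) (fun S => ?_) (fun i S T hi => ?_)
    (fun i S T hi => ?_) (fun σ i j => ?_) 0 0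
  · refine Eq.trans ?_ (key.trans ?_)
    · refine χ.val₂_congr _ _ (congrArg _ ?_) (congrArg _ ?_)
      · refine Eq.trans ?_ ((P'.comp_diagAut P fun q _ => if q = 0 then a else 1).trans ?_)
        · congr 1
          funext q
          split_ifs
          · rfl
          · exact (map_one P.diagAut).symm
        · congr 1
          funext p
          simp [select]
      · refine (P'.comp_diagAut P fun _ p => if p = 0 then b else 1).trans ?_
        congr 1
        funext p
        simp [select]
    · refine χ.val₂_diagAut_iso G Q P'' hZ e (fun i => ?_) (fun i => ?_)
        (select_commute hab _ _) (fun i => ?_)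
      · have : e i = 0 ↔ i = (0, 0) := by rw [← he, e.apply_eq_iff_eq]
        simp [select, this]
      · simp [select]
      · split_ifs
        · exact hab
        · exact Commute.one_left _
  · exact (χ.val₂_congr _ (Commute.one_left _) (by rw [select_empty, map_one, map_one]) rfl).trans
      (χ.val₂_one_left hQ _ _)
  · exact (χ.val₂_congr _ (Commute.one_right _) rfl (by rw [select_empty, map_one, map_one])).trans
      (χ.val₂_one_right hQ _ _)
  · refine Eq.trans ?_ (χ.val₂_mul_left hQ _ _ _ ((hc {i} T).map _) ((hc S T).map _))
    exact χ.val₂_congr _ _ (by rw [select_insert a hi, map_mul, map_mul]) rfl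
  · refine Eq.trans ?_ (χ.val₂_mul_right hQ _ _ _ ((hc S {i}).map _) ((hc S T).map _))
    exact χ.val₂_congr _ _ rfl (by rw [select_insert b hi, map_mul, map_mul])
  · exact (χ.val₂_diagAut_iso G Q Q hQ σ (fun k => by simp [select]) (fun k => by simp [select])
      (select_commute hab _ _) (select_commute hab _ _)).symm

end

/-! ### Alternating sums of differences -/

section

variable {A : Type*} [AddCommGroup A]

/-- For a polynomial function `f` of degree less than `r`, this is the value of `f` at `-1`, by
Newton's formula and `(-1 choose m) = (-1)^m`; see `altSum_eval`. -/
def altSum (r : ℕ) (f : ℕ → A) : A := ∑ m ∈ Finset.range r, (-1 : ℤ) ^ m • (fwdDiff 1)^[m] f 0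

theorem altSum_eval {r : ℕ} (p : Polynomial ℚ) (hp : p.natDegree < r) :
    altSum r (fun n : ℕ => p.eval (n : ℚ)) = p.eval (-1) := by
  have h (m : ℕ) : (fwdDiff 1)^[m] (fun n : ℕ => p.eval (n : ℚ)) 0 =
      (fwdDiff 1)^[m] p.eval (-1) + (fwdDiff 1)^[m + 1] p.eval (-1) := by
    have h1 : (fwdDiff 1)^[m + 1] p.eval (-1) =
        (fwdDiff 1)^[m] p.eval (-1 + 1) - (fwdDiff 1)^[m] p.eval (-1) := by
      rw [Function.iterate_succ_apply', fwdDiff]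
    rw [h1, add_sub_cancel, neg_add_cancel, fwdDiff_iter_eq_sum_shift, fwdDiff_iter_eq_sum_shift]
    simp
  -- by the first identity, the alternating sum telescopes
  have h2 (k : ℕ) : ∑ m ∈ Finset.range k, (-1 : ℤ) ^ m •
      (fwdDiff 1)^[m] (fun n : ℕ => p.eval (n : ℚ)) 0 =
      p.eval (-1) - (-1 : ℤ) ^ k • (fwdDiff 1)^[k] p.eval (-1) := by
    induction k with
    | zero => simp
    | succ k ih =>
      rw [Finset.sum_range_succ, ih, h, pow_succ, mul_neg_one, neg_smul, smul_add]
      abel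
  rw [altSum, h2, Polynomial.fwdDiff_iter_eq_zero_of_degree_lt hp]
  simp

theorem altSum_int_cast (r : ℕ) (f : ℕ → ℤ) :
    ((altSum r f : ℤ) : ℚ) = altSum r (fun n => (f n : ℚ)) := by
  simp [altSum, fwdDiff_iter_eq_sum_shift]

theorem altSum_add (r : ℕ) (f g : ℕ → A) : altSum r (f + g) = altSum r f + altSum r g := by
  simp only [altSum, fwdDiff_iter_add, Pi.add_apply, smul_add, Finset.sum_add_distrib]

theorem altSum_smul (r : ℕ) (c : ℕ → ℤ) (x : A) :
    altSum r (fun n => c n • x) = altSum r c • x := by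
  simp only [altSum, fwdDiff_iter_eq_sum_shift, Finset.sum_smul, smul_smul, Finset.smul_sum,
    smul_eq_mul, Finset.mul_sum]

theorem altSum_sum_smul (r : ℕ) {ι : Type*} (s : Finset ι) (c : ι → ℕ → ℤ) (x : ι → A) :
    altSum r (fun n => ∑ i ∈ s, c i n • x i) = ∑ i ∈ s, altSum r (c i) • x i := by
  induction s using Finset.cons_induction with
  | empty => simp [altSum, fwdDiff_iter_eq_sum_shift]
  | cons i s hi ih =>
    rw [Finset.sum_cons, ← ih, ← altSum_smul, ← altSum_add]
    simp only [Finset.sum_cons]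
    rfl

theorem altSum_const {r : ℕ} (hr : 1 ≤ r) (x : A) : altSum r (fun _ => x) = x := by
  obtain ⟨r, rfl⟩ := Nat.exists_eq_add_of_le' hr
  rw [altSum, Finset.sum_range_succ', Finset.sum_eq_zero]
  · simp
  · intro m _
    have : ∀ k, (fwdDiff 1)^[k] (fun _ : ℕ => (0 : A)) = fun _ => 0 := fun k => by
      induction k with
      | zero => rfl
      | succ k ih => rw [Function.iterate_succ_apply', ih, fwdDiff_const]
    rw [Function.iterate_succ_apply, fwdDiff_const, this, smul_zero]

theorem altSum_choose {r m : ℕ} (hm : m < r) (t : ℕ) :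
    altSum r (fun s => (((t + 1) * (s + 1) - 1).choose m : ℤ)) = (-1) ^ m := by
  -- the binomial coefficient is a polynomial in its upper entry, which equals `-1` for `s = -1`
  let p : Polynomial ℚ := ((Polynomial.C ((m.factorial : ℚ)⁻¹)) * descPochhammer ℚ m).comp
    (Polynomial.C (t + 1 : ℚ) * Polynomial.X + Polynomial.C (t : ℚ))
  have hp : p.natDegree < r := by
    refine lt_of_le_of_lt (Polynomial.natDegree_comp_le.trans ?_) hm
    refine (Nat.mul_le_mul ((Polynomial.natDegree_C_mul_le _ _).trans
      (descPochhammer_natDegree ℚ m).le) Polynomial.natDegree_linear_le).trans (mul_one m).le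
  have h0 : (m.factorial : ℚ) ≠ 0 := by exact_mod_cast m.factorial_ne_zero
  have h1 (k : ℕ) : (descPochhammer ℚ k).eval (-1) = (-1) ^ k * k.factorial := by
    induction k with
    | zero => simp
    | succ k ih =>
      rw [descPochhammer_succ_eval, ih, Nat.factorial_succ]
      push_cast
      ring
  have h2 (s : ℕ) : ((((t + 1) * (s + 1) - 1).choose m : ℤ) : ℚ) = p.eval (s : ℚ) := by
    have : (t + 1) * (s + 1) - 1 = (t + 1) * s + t := by
      rw [mul_add, mul_one, ← add_assoc, Nat.add_sub_cancel]
    rw [this, Polynomial.eval_comp]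
    have h3 : (Polynomial.C (t + 1 : ℚ) * Polynomial.X + Polynomial.C (t : ℚ)).eval (s : ℚ) =
        (((t + 1) * s + t : ℕ) : ℚ) := by simp
    rw [h3, Polynomial.eval_C_mul, descPochhammer_eval_eq_descFactorial,
      Nat.descFactorial_eq_factorial_mul_choose]
    push_cast
    rw [inv_mul_cancel_left₀ h0]
  refine Int.cast_injective (α := ℚ) ?_
  rw [altSum_int_cast]
  simp only [h2]
  rw [altSum_eval p hp, Polynomial.eval_comp]
  have h3 : (Polynomial.C (t + 1 : ℚ) * Polynomial.X + Polynomial.C (t : ℚ)).eval (-1) = -1 := by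
    simp
  rw [h3, Polynomial.eval_C_mul, h1, mul_left_comm, inv_mul_cancel₀ h0]
  simp

/-- A function `φ` whose differences of order at least `r` vanish at `0` is polynomial, and for `s =
-1` the argument `(t + 1)(s + 1) - 1` equals `-1` for all `t`. -/
theorem altSum_altSum {r : ℕ} (hr : 1 ≤ r) (φ : ℕ → A)
    (hφ : ∀ m, r ≤ m → (fwdDiff 1)^[m] φ 0 = 0) :
    altSum r (fun t => altSum r fun s => φ ((t + 1) * (s + 1) - 1)) = altSum r φ := by
  have h (N : ℕ) : φ N = ∑ m ∈ Finset.range r, (N.choose m : ℤ) • (fwdDiff 1)^[m] φ 0 := by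
    have := shift_eq_sum_fwdDiff_iter 1 φ N 0
    rw [zero_add, smul_eq_mul, mul_one] at this
    rw [this]
    simp only [natCast_zsmul]
    have h1 (k l : ℕ) (hk : ∀ m, k ≤ m → (N.choose m) • (fwdDiff 1)^[m] φ 0 = 0) (hkl : k ≤ l) :
        ∑ m ∈ Finset.range l, N.choose m • (fwdDiff 1)^[m] φ 0 =
          ∑ m ∈ Finset.range k, N.choose m • (fwdDiff 1)^[m] φ 0 := by
      refine (Finset.sum_subset (Finset.range_subset_range.2 hkl) fun m _ hm => hk m ?_).symm
      simpa using hm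
    rw [← h1 (N + 1) (max (N + 1) r) (fun m hm => ?_) (le_max_left _ _),
      h1 r _ (fun m hm => ?_) (le_max_right _ _)]
    · rw [hφ m hm, smul_zero]
    · rw [Nat.choose_eq_zero_of_lt hm, zero_smul]
  have h2 (t : ℕ) : altSum r (fun s => φ ((t + 1) * (s + 1) - 1)) = altSum r φ := by
    simp only [h _]
    rw [altSum_sum_smul]
    refine Finset.sum_congr rfl fun m hm => ?_
    rw [altSum_choose (Finset.mem_range.1 hm)]
  simp only [h2]
  exact altSum_const hr _

end

end
end GraysonK

namespace GraysonK
noncomputable section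

/-! ### The functor `N H Γ` on two-term complexes of two-term complexes -/

open BinaryComplex ZeroObject

attribute [local instance] HasFiniteBiproducts.of_hasFiniteCoproducts
  HasBinaryBiproducts.of_hasBinaryCoproducts

theorem map_moebius {I A B : Type*} [DecidableEq I] [AddCommGroup A] [AddCommGroup B] (g : A →+ B)
    (f : Finset I → A) (L T : Finset I) : g (moebius f L T) = moebius (fun S => g (f S)) L T := by
  simp only [moebius, map_sum, map_zsmul]

section

variable {C : Type u} [Category.{v} C] [Preadditive C] [HasFiniteColimits C]
variable {D : Type u} [Category.{v} D] [Preadditive D] [HasFiniteColimits D]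

open AlgebraicTopology AlgebraicTopology.DoldKan in
theorem DoldKan.gradedMap_sum_app {ι : Type*} (s : Finset ι) {X Y : ℕ → C}
    (f : ι → ∀ k, X k ⟶ Y k) (Δ : SimplexCategoryᵒᵖ) :
    (Γ₀.map (gradedMap fun k => ∑ i ∈ s, f i k)).app Δ = ∑ i ∈ s, (Γ₀.map (gradedMap (f i))).app Δ := by
  refine Sigma.hom_ext _ _ fun A => (ι_map_app _ _ A).trans ?_
  refine Eq.trans ?_ (Preadditive.comp_sum _ _ _).symm
  refine (Preadditive.sum_comp _ _ _).trans (Finset.sum_congr rfl fun i _ => ?_)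
  exact (ι_map_app (gradedMap (f i)) Δ A).symm

/-- The functor `N H Γ` has the same degree as `H`, since `Γ` is additive. -/
theorem DegreeLE.functor {H : C ⥤ D} {r : ℕ} (hr : DegreeLE r H) :
    DegreeLE r (DoldKan.functor H) := by
  intro m hm X Y f
  refine BinaryComplex.hom_ext fun k => ?_
  refine (cancel_epi (DoldKan.proj H X.X k)).1 ?_
  let g1 : ((DoldKan.functor H).obj X ⟶ (DoldKan.functor H).obj Y) →+
      (H.obj _ ⟶ DoldKan.obj H Y.X k) :=
    AddMonoidHom.mk' (fun φ => DoldKan.proj H X.X k ≫ φ.f k) fun φ ψ => Preadditive.comp_add ..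
  let g2 := Preadditive.rightComp (H.obj ((AlgebraicTopology.DoldKan.Γ₀.obj
    (DoldKan.graded X.X)).obj (Opposite.op (SimplexCategory.mk k)))) (DoldKan.proj H Y.X k)
  refine (map_moebius g1 _ _ _).trans (Eq.trans ?_ comp_zero.symm)
  have h := congrArg g2 (hr m hm fun i => (AlgebraicTopology.DoldKan.Γ₀.map
    (DoldKan.gradedMap (f i).f)).app (Opposite.op (SimplexCategory.mk k)))
  refine Eq.trans ?_ (h.trans (map_zero g2))
  refine Eq.trans ?_ (map_moebius g2 _ _ _).symm
  congr 1
  funext S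
  refine (DoldKan.proj_map H (Hom.f (∑ i ∈ S, f i : X ⟶ Y)) k).trans ?_
  refine congrArg (fun φ => H.map φ ≫ _) ?_
  rw [← DoldKan.gradedMap_sum_app]
  congr 3
  funext k
  exact sum_f _ _ _

theorem DoldKan.functor_map_zero {H : C ⥤ D} (h0 : ∀ X Y : C, H.map (0 : X ⟶ Y) = 0)
    (X Y : BinaryComplex C) : (DoldKan.functor H).map (0 : X ⟶ Y) = 0 := by
  refine BinaryComplex.hom_ext fun k => ?_
  refine (cancel_epi (DoldKan.proj H X.X k)).1 ?_
  refine (DoldKan.proj_map H (Hom.f (0 : X ⟶ Y)) k).trans ?_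
  have h := DoldKan.gradedMap_sum_app (X := X.X) (Y := Y.X) (∅ : Finset Empty) (fun _ _ => 0)
    (Opposite.op (SimplexCategory.mk k))
  rw [Finset.sum_empty] at h
  refine (congrArg (fun φ => H.map φ ≫ _) h).trans ?_
  exact (congrArg (· ≫ _) (h0 _ _)).trans (zero_comp.trans comp_zero.symm)

end

theorem Power.inc_diag {B : Type*} [Category* B] [Preadditive B] {I : Type*} [Fintype I] {W Z : B}
    (P : Power I W Z) (f : I → (W ⟶ W)) (i : I) : P.inc i ≫ P.diag f = f i ≫ P.inc i :=
  P.hom_ext fun j => by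
    classical
    rw [Category.assoc, Category.assoc, P.diag_ρ]
    by_cases h : i = j
    · subst h
      rw [P.inc_ρ_self, Category.comp_id, ← Category.assoc, P.inc_ρ_self, Category.id_comp]
    · rw [P.inc_ρ_ne h, comp_zero, ← Category.assoc, P.inc_ρ_ne h, zero_comp]

/-- Two-term complexes on powers are powers of two-term complexes. -/
def endDiagramPower {J : Type*} [Category* J] {C : Type*} [Category* C] [Preadditive C]
    [HasZeroObject C] {W Z : J ⥤ C} {I : Type*} [Fintype I] (P : Power I W Z) (α : W ⟶ W) :
    Power I (endDiagram α) (endDiagram (P.diag fun _ => α)) where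
  ρ i := endDiagramMap (P.ρ i) (P.diag_ρ _ i)
  inc i := endDiagramMap (P.inc i) (P.inc_diag (fun _ => α) i).symm
  inc_ρ_self i := endDiagram_hom_ext
    (fun j => congrArg (fun f => NatTrans.app f j) (P.inc_ρ_self i))
    (fun j => congrArg (fun f => NatTrans.app f j) (P.inc_ρ_self i))
  inc_ρ_ne h := endDiagram_hom_ext
    (fun j => congrArg (fun f => NatTrans.app f j) (P.inc_ρ_ne h))
    (fun j => congrArg (fun f => NatTrans.app f j) (P.inc_ρ_ne h))
  total := endDiagram_hom_ext
    (fun j => by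
      rw [NatTrans.app_sum, sum_f]
      exact (NatTrans.app_sum _ _ _).symm.trans (congrArg (fun f => NatTrans.app f j) P.total))
    (fun j => by
      rw [NatTrans.app_sum, sum_f]
      exact (NatTrans.app_sum _ _ _).symm.trans (congrArg (fun f => NatTrans.app f j) P.total))

theorem endDiagramPower_diag {J : Type*} [Category* J] {C : Type*} [Category* C] [Preadditive C]
    [HasZeroObject C] {W Z : J ⥤ C} {I : Type*} [Fintype I] (P : Power I W Z) {a : Aut W}
    (f : I → Aut W) (h : ∀ i, Commute a (f i)) :
    (endDiagramPower P a.hom).diag (fun i => endDiagramMap (α := a.hom) (β := a.hom) (f i).hom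
      (congrArg Iso.hom (h i).eq.symm)) =
    endDiagramMap (P.diagAut f).hom (congrArg Iso.hom (P.commute_diagAut h).eq.symm) :=
  (endDiagramPower P a.hom).hom_ext fun i => by
    rw [Power.diag_ρ]
    exact endDiagram_hom_ext
      (fun j => congrArg (fun f => NatTrans.app f j) (P.diagAut_ρ f i).symm)
      (fun j => congrArg (fun f => NatTrans.app f j) (P.diagAut_ρ f i).symm)

theorem Power.act_aut {B I : Type*} [Category* B] [Preadditive B] [Fintype I] [DecidableEq I]
    {V Z : B} (P : Power I V Z) (i : I) (a : Aut V) :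
    P.act i a.hom = (P.diagAut fun j => if j = i then a else 1).hom := by
  rw [Power.act, Power.diagAut_hom]
  congr 1
  funext j
  split_ifs <;> rfl

section

variable {C : Type u} [Category.{v} C] [Preadditive C] [HasFiniteColimits C] [HasZeroObject C]
  {D : Type u} [Category.{v} D] [Preadditive D]
  {J : Type*} [Category* J] {E : ExactData D} {H : C ⥤ D} {r : ℕ}

/-- The hypothesis on all simplices of `Γ` is a hypothesis on all powers of `W`. -/
theorem good_of_power {W : C} (hW : ∀ m, E.good (H.obj (DoldKan.gam m W))) {I : Type*} [Fintype I]
    [Nonempty I] {Z : C} (P : Power I W Z) : E.good (H.obj Z) := by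
  obtain ⟨N, hN⟩ := Nat.exists_eq_add_of_le' (Fintype.card_pos (α := I))
  exact E.good_of_iso (H.mapIso (P.iso (DoldKan.gamPower W N) (Fintype.equivFinOfCardEq hN))) (hW N)

variable [HasFiniteColimits D] [HasZeroObject D]

/-- The restriction of `N H Γ` of a diagram with two commuting automorphisms. -/
theorem Inv.val_normDiagram_loop {A : Type*} [AddCommGroup A]
    (χ : Inv (E.binary.binary.functor J) A) (h0 : ∀ X Y : C, H.map (0 : X ⟶ Y) = 0)
    (hr : DegreeLE r H) {Z : J ⥤ C} (hZ : ∀ m j, E.good (H.obj (DoldKan.gam m (Z.obj j))))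
    {x y : Aut Z} (h : Commute x y) :
    χ.loop.val (DoldKan.normDiagram H (Loop.map h).hom) =
      χ.val (endDiagram (Functor.whiskerRight (endDiagramMap (α := x.hom) (β := x.hom) y.hom
        (congrArg Iso.hom h.eq.symm)) (DoldKan.functor H))) := by
  have i1 : IsIso (Functor.whiskerRight (endDiagramMap (α := x.hom) (β := x.hom) y.hom
        (congrArg Iso.hom h.eq.symm)) (DoldKan.functor H)) := isIso_whiskerRight _ _
  refine χ.val_loop (DoldKan.normDiagram H (Loop.map h).hom)
    (Functor.isoWhiskerRight (Loop.inclEndDiagram h) (DoldKan.functor H)) ?_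
    (good_normDiagram x.hom h0 hr hZ)
  exact NatTrans.ext (funext fun j => ((DoldKan.functor H).map_comp _ _).symm.trans
    ((congrArg (fun f => (DoldKan.functor H).map (NatTrans.app f j))
      (Loop.aut_inclEndDiagram h)).trans ((DoldKan.functor H).map_comp _ _)))

theorem DoldKan.diagAut_app {Z : J ⥤ C} (y : Aut Z) {s : ℕ} (j : J) :
    ((DoldKan.gamDiagramPower Z s).diagAut fun _ => y).hom.app j =
      DoldKan.gamHom (y.hom.app j) s :=
  (DoldKan.gamPower (Z.obj j) s).hom_ext fun i =>
    (congrArg (fun f => NatTrans.app f j)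
      ((DoldKan.gamDiagramPower Z s).diagAut_ρ (fun _ => y) i)).trans
        (DoldKan.gamHom_ρ (y.hom.app j) i).symm

/-- Passing to powers commutes with the adjunction of an automorphism. -/
def Loop.diagramGam (H : C ⥤ D) (Z : J ⥤ C) (y : Aut Z) (s : ℕ) :
    Loop.diagram Z y ⋙ DoldKan.gamFunctor s ⋙ H ≅ Loop.diagram ((Z ⋙ DoldKan.gamFunctor s) ⋙ H)
      (whiskerAut H ((DoldKan.gamDiagramPower Z s).diagAut fun _ => y)) :=
  NatIso.ofComponents (fun p => Iso.refl _) fun {p q} f => by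
    refine (Category.comp_id _).trans (Eq.trans ?_ (Category.id_comp _).symm)
    change H.map (DoldKan.gamHom ((y ^ _).hom.app p.2 ≫ Z.map f.2) s) =
      (whiskerAut H ((DoldKan.gamDiagramPower Z s).diagAut fun _ => y) ^ _).hom.app p.2 ≫
        H.map (DoldKan.gamHom (Z.map f.2) s)
    rw [← map_zpow, ← map_zpow]
    refine Eq.trans ?_ (H.map_comp _ _)
    refine congrArg H.map (((DoldKan.gamFunctor s).map_comp _ _).trans (congrArg (· ≫ _) ?_))
    exact (DoldKan.diagAut_app (y ^ _) p.2).symm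

theorem Loop.diagramGam_comm (H : C ⥤ D) {Z : J ⥤ C} {x y : Aut Z} (h : Commute x y) (s : ℕ)
    (h' : Commute (whiskerAut H ((DoldKan.gamDiagramPower Z s).diagAut fun q => if q = 0 then x else 1))
      (whiskerAut H ((DoldKan.gamDiagramPower Z s).diagAut fun _ => y))) :
    Functor.whiskerRight ((DoldKan.gamDiagramPower (Loop.diagram Z y) s).act 0 (Loop.map h).hom) H ≫
      (Loop.diagramGam H Z y s).hom = (Loop.diagramGam H Z y s).hom ≫ (Loop.map h').hom := by
  refine NatTrans.ext (funext fun p => ?_)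
  refine (Category.comp_id _).trans (Eq.trans ?_ (Category.id_comp _).symm)
  refine congrArg H.map ((DoldKan.act_app _ _ _).trans ?_)
  rw [← Power.act_aut]
  exact (DoldKan.act_app x.hom s p.2).symm

/-- The values for `x` on the first one of `s + 1` copies, as a function of `s`, with the other
automorphism `y` acting on all copies. -/
theorem Inv.powerVal_loop {A : Type*} [AddCommGroup A]
    (χ : Inv (E.binary.binary.functor J) A) {Z : J ⥤ C}
    (hZ : ∀ m j, E.good (H.obj (DoldKan.gam m (Z.obj j))))
    {x y : Aut Z} (h : Commute x y) (s : ℕ)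
    (h' : Commute (whiskerAut H ((DoldKan.gamDiagramPower Z s).diagAut fun q => if q = 0 then x else 1))
      (whiskerAut H ((DoldKan.gamDiagramPower Z s).diagAut fun _ => y))) :
    χ.loop.powerVal H (Loop.map h).hom s = χ.val₂ _ _ h' := by
  rw [χ.val₂_eq_loop (R := (Z ⋙ DoldKan.gamFunctor s) ⋙ H) (hZ s)]
  refine χ.loop.val_endDiagram_iso (fun p => hZ s p.2) (Loop.diagramGam H Z y s)
    (Loop.diagramGam_comm H h s h')

/-- For a two-term complex of two-term complexes, the binary complex `N (N H Γ) Γ` has the same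
value as the two-term complex that results from applying `N H Γ` to its terms. -/
theorem Inv.val_normDiagram_functor {A : Type*} [AddCommGroup A]
    (χ : Inv (E.binary.binary.functor J) A) (h0 : ∀ X Y : C, H.map (0 : X ⟶ Y) = 0)
    (hr1 : 1 ≤ r) (hr : DegreeLE r H) {W : J ⥤ C}
    (hW : ∀ m j, E.good (H.obj (DoldKan.gam m (W.obj j)))) {a b : Aut W} (h : Commute a b) :
    χ.val (DoldKan.normDiagram (DoldKan.functor H) (endDiagramMap (α := a.hom) (β := a.hom) b.hom
        (congrArg Iso.hom h.eq.symm))) =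
      χ.val (endDiagram (Functor.whiskerRight (endDiagramMap (α := a.hom) (β := a.hom) b.hom
        (congrArg Iso.hom h.eq.symm)) (DoldKan.functor H))) := by
  let P t := DoldKan.gamDiagramPower W t
  have hW2 (t m j) : E.good (H.obj (DoldKan.gam m ((W ⋙ DoldKan.gamFunctor t).obj j))) :=
    good_of_power (fun m => hW m j)
      ((DoldKan.gamPower (DoldKan.gam t (W.obj j)) m).comp (DoldKan.gamPower (W.obj j) t))
  have hW3 (m j) : E.binary.good ((DoldKan.functor H).obj
      (DoldKan.gam m ((endDiagram a.hom).obj j))) := by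
    let e := (DoldKan.gamDiagramPower (endDiagram a.hom) m).iso (endDiagramPower (P m) a.hom)
      (Equiv.refl _)
    have := (P m).isIso_diag (fun _ => a.hom) fun _ => inferInstance
    exact E.binary.good_of_iso ((DoldKan.functor H).mapIso (e.app j))
      (good_normDiagram ((P m).diag fun _ => a.hom) h0 hr (hW2 m) j)
  have hc (N : ℕ) : Commute
      (whiskerAut H ((P N).diagAut fun q => if q = 0 then a else 1))
      (whiskerAut H ((P N).diagAut fun _ => b)) :=
    ((P N).commute_diagAut fun i => by split_ifs; exacts [h, Commute.one_left _]).map _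
  -- the value for `a` on the first one of `N + 1` copies and `b` on all of them
  let φ (N : ℕ) : A := χ.val₂ _ _ (hc N)
  have hφ (N : ℕ) : χ.loop.powerVal H (Loop.map h).hom N = φ N := χ.powerVal_loop hW h N (hc N)
  have hφ' : χ.loop.powerVal H (Loop.map h).hom = φ := funext hφ
  rw [← χ.val_normDiagram_loop h0 hr hW h, χ.loop.val_normDiagram (Loop.map h).hom h0 hr
    (fun m p => hW m p.2), hφ', χ.val_normDiagram _ (DoldKan.functor_map_zero h0) hr.functor hW3]
  -- the outer alternating sum runs over powers `W^{t+1}` with `b` on the first factor and `a` on all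
  -- of them; the value of `N H Γ` on such a power is an alternating sum over grids
  have key (t : ℕ) : χ.powerVal (DoldKan.functor H) (endDiagramMap (α := a.hom) (β := a.hom) b.hom
        (congrArg Iso.hom h.eq.symm)) t = altSum r fun s => φ ((t + 1) * (s + 1) - 1) := by
    have hxy (i : Fin (t + 1)) : Commute a (if i = 0 then b else 1) := by
      split_ifs
      exacts [h, Commute.one_right _]
    have hc' := (P t).commute_diagAut hxy
    rw [← (χ.powerVal_eq _ hW3 (endDiagramPower (P t) a.hom)).2]
    have e1 : (endDiagramPower (P t) a.hom).act 0 (endDiagramMap (α := a.hom) (β := a.hom) b.hom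
        (congrArg Iso.hom h.eq.symm)) = endDiagramMap ((P t).diagAut _).hom
          (congrArg Iso.hom hc'.eq.symm) := by
      refine Eq.trans ?_ (endDiagramPower_diag (P t) _ hxy)
      rw [Power.act]
      congr 1
      funext i
      split_ifs
      · rfl
      · exact endDiagram_hom_ext (fun _ => rfl) (fun _ => rfl)
    rw [e1]
    refine (χ.val_normDiagram_loop h0 hr (hW2 t) hc').symm.trans ?_
    refine (χ.loop.val_normDiagram (Loop.map hc').hom h0 hr (fun m p => hW2 t m p.2)).trans ?_
    refine congrArg (altSum r) (funext fun s => ?_)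
    let P' := DoldKan.gamDiagramPower (W ⋙ DoldKan.gamFunctor t) s
    have hc'' : Commute
        (whiskerAut H (P'.diagAut fun q => if q = 0 then (P t).diagAut (fun _ => a) else 1))
        (whiskerAut H (P'.diagAut fun _ => (P t).diagAut fun p => if p = 0 then b else 1)) :=
      (P'.commute_diagAut fun i => by split_ifs; exacts [hc', Commute.one_left _]).map _
    refine (χ.powerVal_loop (hW2 t) hc' s hc'').trans ?_
    exact χ.val₂_grid H h (P t) P' (P ((t + 1) * (s + 1) - 1))
      (Nat.sub_add_cancel (Nat.mul_pos t.succ_pos s.succ_pos)) (hW _) _ _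
  refine Eq.trans ?_ (altSum_altSum hr1 φ fun m hm => ?_)
  · exact congrArg (altSum r) (funext key)
  · rw [← hφ']
    exact χ.loop.fwdDiff_powerVal (Loop.map h).hom hr (fun m p => hW m p.2) hm

end

end
end GraysonK

namespace GraysonK
noncomputable section

/-! ### Cross-effects -/

open BinaryComplex ZeroObject

section

variable {C : Type u} [Category.{v} C] [Abelian C] (k : ℕ)

/-- The inclusion `(P_1, P_3, …) ⟶ (P_1 ⊕ P_2, P_3, …)`. -/
def mergeInl : dropSnd (C := C) k ⟶ merge k :=
  NatTrans.pi' (Fin.cases (biprod.inl : _ ⟶ Pi.eval (fun _ : Fin (k + 2) => C) 0 ⊞ Pi.eval _ 1)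
    fun j => 𝟙 (Pi.eval (fun _ : Fin (k + 2) => C) j.succ.succ))

/-- The inclusion `(P_2, P_3, …) ⟶ (P_1 ⊕ P_2, P_3, …)`. -/
def mergeInr : dropFst (C := C) k ⟶ merge k :=
  NatTrans.pi' (Fin.cases (biprod.inr : _ ⟶ Pi.eval (fun _ : Fin (k + 2) => C) 0 ⊞ Pi.eval _ 1)
    fun j => 𝟙 (Pi.eval (fun _ : Fin (k + 2) => C) j.succ.succ))

theorem mergeInl_fst : mergeInl (C := C) k ≫ mergeFst k = 𝟙 _ := by
  refine NatTrans.ext (funext fun P => funext fun j => ?_)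
  induction j using Fin.cases with
  | zero => exact NatTrans.congr_app (biprod.inl_fst (X := Pi.eval (fun _ : Fin (k + 2) => C) 0)
      (Y := Pi.eval (fun _ : Fin (k + 2) => C) 1)) P
  | succ j => exact Category.id_comp _

theorem mergeInr_snd : mergeInr (C := C) k ≫ mergeSnd k = 𝟙 _ := by
  refine NatTrans.ext (funext fun P => funext fun j => ?_)
  induction j using Fin.cases with
  | zero => exact NatTrans.congr_app (biprod.inr_snd (X := Pi.eval (fun _ : Fin (k + 2) => C) 0)
      (Y := Pi.eval (fun _ : Fin (k + 2) => C) 1)) P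
  | succ j => exact Category.id_comp _

theorem mergeInl_snd_zero (P : Fin (k + 2) → C) :
    (mergeInl k ≫ mergeSnd k).app P 0 = 0 :=
  NatTrans.congr_app (biprod.inl_snd (X := Pi.eval (fun _ : Fin (k + 2) => C) 0)
      (Y := Pi.eval (fun _ : Fin (k + 2) => C) 1)) P

theorem mergeInr_fst_zero (P : Fin (k + 2) → C) :
    (mergeInr k ≫ mergeFst k).app P 0 = 0 :=
  NatTrans.congr_app (biprod.inr_fst (X := Pi.eval (fun _ : Fin (k + 2) => C) 0)
      (Y := Pi.eval (fun _ : Fin (k + 2) => C) 1)) P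

theorem merge_map_eq {P Q : Fin (k + 2) → C} (f : P ⟶ Q) (h : f 0 = 0) :
    (merge k).map f = (mergeSnd k).app P ≫ (dropFst k).map f ≫ (mergeInr k).app Q := by
  funext j
  induction j using Fin.cases with
  | zero =>
    let A : (Fin (k + 2) → C) ⥤ C := Pi.eval _ 0
    let B : (Fin (k + 2) → C) ⥤ C := Pi.eval _ 1
    have h1 := congrArg (fun f => NatTrans.app f P) (biprod.total (X := A) (Y := B))
    have h2 := (biprod.fst (X := A) (Y := B)).naturality f
    have h3 := (biprod.inl (X := A) (Y := B)).naturality f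
    have h4 := (biprod.inr (X := A) (Y := B)).naturality f
    change (A ⊞ B).map f = (biprod.snd (X := A) (Y := B)).app P ≫ B.map f ≫
      (biprod.inr (X := A) (Y := B)).app Q
    rw [h4]
    have h5 : A.map f = 0 := h
    rw [h5, zero_comp] at h3
    refine (Category.id_comp _).symm.trans ((congrArg (· ≫ _) h1.symm).trans ?_)
    refine (Preadditive.add_comp ..).trans ?_
    rw [NatTrans.comp_app, NatTrans.comp_app, Category.assoc, Category.assoc, ← h3, comp_zero,
      zero_add]
  | succ j => exact (Category.id_comp _).symm.trans (congrArg _ (Category.comp_id _).symm)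

end

section

variable {C : Type u} [Category.{v} C] [Abelian C] {D : Type u} [Category.{v} D] [Abelian D]
  {F : C ⥤ D} (h0 : ∀ X Y : C, F.map (0 : X ⟶ Y) = 0)

/-- The map to the direct sum whose kernel is the next cross-effect. -/
abbrev crossEffectMap (F : C ⥤ D) (k : ℕ) :
    merge k ⋙ crossEffect F k ⟶ (dropSnd k ⋙ crossEffect F k) ⊞ (dropFst k ⋙ crossEffect F k) :=
  biprod.lift (Functor.whiskerRight (mergeFst k) (crossEffect F k))
      (Functor.whiskerRight (mergeSnd k) (crossEffect F k))

include h0 in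
/-- The cross-effects are functors that vanish on morphisms with a zero component; only the first
component is needed. -/
theorem crossEffect_map_eq_zero : ∀ (k : ℕ) {P Q : Fin (k + 1) → C} (f : P ⟶ Q), f 0 = 0 →
    (crossEffect F k).map f = 0
  | 0, _, _, f, h => (congrArg F.map h).trans (h0 _ _)
  | k + 1, P, Q, f, h => by
    let ι : crossEffect F (k + 1) ⟶ merge k ⋙ crossEffect F k := kernel.ι (crossEffectMap F k)
    have i1 : Mono ι := inferInstanceAs (Mono (kernel.ι _))
    have i2 : Mono (ι.app Q) := inferInstance
    have h1 := congrArg (· ≫ biprod.snd) (kernel.condition (crossEffectMap F k))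
    have h2 := congrArg (fun f => NatTrans.app f P)
      ((Category.assoc _ _ _).symm.trans (h1.trans zero_comp))
    rw [crossEffectMap, biprod.lift_snd] at h2
    refine (cancel_mono (ι.app Q)).1 ((ι.naturality f).trans ?_)
    refine (congrArg (fun g => ι.app P ≫ (crossEffect F k).map g) (merge_map_eq k f h)).trans ?_
    rw [Functor.map_comp]
    exact (Category.assoc _ _ _).symm.trans
      ((congrArg (· ≫ _) h2).trans (zero_comp.trans zero_comp.symm))

include h0 in
/-- The inclusions of the two summands split the map to the direct sum; the mixed terms vanish by
`crossEffect_map_eq_zero`. -/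
theorem isSplit_crossEffect (k : ℕ) :
    IsSplit (kernel.ι (crossEffectMap F k)) (crossEffectMap F k) := by
  let Φ := crossEffect F k
  let s : (dropSnd k ⋙ Φ) ⊞ (dropFst k ⋙ Φ) ⟶ merge k ⋙ Φ :=
    biprod.desc (Functor.whiskerRight (mergeInl k) Φ) (Functor.whiskerRight (mergeInr k) Φ)
  have hs : s ≫ crossEffectMap F k = 𝟙 _ := by
    refine biprod.hom_ext' _ _ (biprod.hom_ext _ _ ?_ ?_) (biprod.hom_ext _ _ ?_ ?_)
    all_goals
      simp only [s, crossEffectMap, Category.assoc, biprod.lift_fst, biprod.lift_snd,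
        biprod.inl_desc_assoc, biprod.inr_desc_assoc, Category.comp_id]
    · rw [← Functor.whiskerRight_comp, mergeInl_fst, Functor.whiskerRight_id']
      exact biprod.inl_fst.symm
    · trans 0
      swap
      · exact biprod.inl_snd.symm
      refine NatTrans.ext (funext fun P => ?_)
      rw [← Functor.whiskerRight_comp]
      exact crossEffect_map_eq_zero h0 k _ (mergeInl_snd_zero k P)
    · trans 0
      swap
      · exact biprod.inr_fst.symm
      refine NatTrans.ext (funext fun P => ?_)
      rw [← Functor.whiskerRight_comp]
      exact crossEffect_map_eq_zero h0 k _ (mergeInr_fst_zero k P)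
    · rw [← Functor.whiskerRight_comp, mergeInr_snd, Functor.whiskerRight_id']
      exact biprod.inr_snd.symm
  refine ⟨kernel.condition _, kernel.lift _ (𝟙 _ - crossEffectMap F k ≫ s) ?_, s, ?_, hs, ?_⟩
  · rw [Preadditive.sub_comp, Category.id_comp, Category.assoc, hs, Category.comp_id, sub_self]
  · rw [← cancel_mono (kernel.ι _), Category.assoc, kernel.lift_ι, Preadditive.comp_sub,
      kernel.condition_assoc, zero_comp, sub_zero, Category.comp_id, Category.id_comp]
  · rw [kernel.lift_ι, sub_add_cancel]

end

/-- The direct sum of a power and one further copy. -/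
def Power.snoc {B : Type*} [Category* B] [Preadditive B] {W Z V Y : B} {t : ℕ}
    (P : Power (Fin (t + 1)) W Z) (e : V ≅ W) (fst : Y ⟶ Z) (snd : Y ⟶ V) (inl : Z ⟶ Y)
    (inr : V ⟶ Y) (h1 : inl ≫ fst = 𝟙 Z) (h2 : inl ≫ snd = 0) (h3 : inr ≫ fst = 0)
    (h4 : inr ≫ snd = 𝟙 V) (h5 : fst ≫ inl + snd ≫ inr = 𝟙 Y) : Power (Fin (t + 1 + 1)) W Y where
  ρ := Fin.lastCases (snd ≫ e.hom) fun i => fst ≫ P.ρ i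
  inc := Fin.lastCases (e.inv ≫ inr) fun i => P.inc i ≫ inl
  inc_ρ_self i := by
    induction i using Fin.lastCases with
    | last => simp [reassoc_of% h4]
    | cast i => simp [reassoc_of% h1, P.inc_ρ_self]
  inc_ρ_ne {i j} h := by
    induction i using Fin.lastCases with
    | last =>
      induction j using Fin.lastCases with
      | last => exact (h rfl).elim
      | cast j => simp [reassoc_of% h3]
    | cast i =>
      induction j using Fin.lastCases with
      | last => simp [reassoc_of% h2]
      | cast j =>
        have : i ≠ j := fun e => h (congrArg _ e)
        simp [reassoc_of% h1, P.inc_ρ_ne this]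
  total := by
    rw [Fin.sum_univ_castSucc]
    simp only [Fin.lastCases_castSucc, Fin.lastCases_last, Category.assoc, e.hom_inv_id_assoc]
    rw [← h5]
    congr 1
    simp_rw [← Category.assoc (P.ρ _), ← Preadditive.comp_sum, ← Preadditive.sum_comp, P.total,
      Category.id_comp]

/-- An object as a power of itself. -/
def Power.single {B : Type*} [Category* B] [Preadditive B] (W : B) : Power (Fin 1) W W where
  ρ _ := 𝟙 W
  inc _ := 𝟙 W
  inc_ρ_self _ := Category.comp_id _
  inc_ρ_ne h := (h (Subsingleton.elim _ _)).elim
  total := by simp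

theorem Inv.val_endDiagram_ses {J : Type*} [Category* J] {D : Type*} [Category* D] [Preadditive D]
    [HasZeroObject D] {E : ExactData D} {A : Type*} [AddCommGroup A]
    (χ : Inv (E.binary.functor J) A) {W₁ W₂ W₃ : J ⥤ D} (h₂ : (E.functor J).good W₂)
    (f : W₁ ⟶ W₂) (g : W₂ ⟶ W₃) (h : IsSplit f g) (α₁ : W₁ ⟶ W₁) (α₂ : W₂ ⟶ W₂) (α₃ : W₃ ⟶ W₃)
    [IsIso α₁] [IsIso α₂] [IsIso α₃] (hf : α₁ ≫ f = f ≫ α₂) (hg : α₂ ≫ g = g ≫ α₃) :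
    χ.val (endDiagram α₂) = χ.val (endDiagram α₁) + χ.val (endDiagram α₃) := by
  obtain ⟨r, s, h1, h2, _⟩ := h.2
  refine χ.add (endDiagramMap f hf) (endDiagramMap g hg)
    (E.good_endDiagram _ ((E.functor J).good_of_retract f r h1 h₂)) (E.good_endDiagram _ h₂)
    (E.good_endDiagram _ ((E.functor J).good_of_retract s g h2 h₂)) fun j k => ?_
  match k with
  | 0 => exact E.ses_of_isSplit _ _ (app_isSplit h j)
  | 1 => exact E.ses_of_isSplit _ _ (app_isSplit h j)
  | _ + 2 =>
    exact E.ses_of_isSplit _ _ (isSplit_of_isZero _ _ (isZero_zero D) (isZero_zero D) (isZero_zero D))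

theorem IsSplit.whiskerLeft {J B D : Type*} [Category* J] [Category* B] [Category* D]
    [Preadditive D] {X Y Z : B ⥤ D} {f : X ⟶ Y} {g : Y ⟶ Z} (h : IsSplit f g) (T : J ⥤ B) :
    IsSplit (Functor.whiskerLeft T f) (Functor.whiskerLeft T g) := by
  obtain ⟨h0, r, s, h1, h2, h3⟩ := h
  exact ⟨congrArg (Functor.whiskerLeft T) h0, Functor.whiskerLeft T r, Functor.whiskerLeft T s,
    congrArg (Functor.whiskerLeft T) h1, congrArg (Functor.whiskerLeft T) h2,
    congrArg (Functor.whiskerLeft T) h3⟩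

theorem isSplit_biprod {B : Type*} [Category* B] [Preadditive B] (X Y : B) [HasBinaryBiproduct X Y] :
    IsSplit (biprod.inl : X ⟶ X ⊞ Y) biprod.snd :=
  ⟨biprod.inl_snd, biprod.fst, biprod.inr, biprod.inl_fst, biprod.inr_snd, biprod.total⟩

section

variable {C : Type u} [Category.{v} C] [Abelian C] {D : Type u} [Category.{v} D] [Abelian D]
  {J : Type*} [Category* J] {E : ExactData D} {A : Type*} [AddCommGroup A]
  (χ : Inv (E.binary.functor J) A) {F : C ⥤ D} (h0 : ∀ X Y : C, F.map (0 : X ⟶ Y) = 0)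
  {W : J ⥤ C} (α : W ⟶ W) [IsIso α] (hW : ∀ m j, E.good (F.obj (DoldKan.gam m (W.obj j))))

include h0 hW in
/-- The values on the cross-effects are the iterated differences of the values on powers. Here the
first variable is `W^{t+1}` with `α` on the first factor, and the other variables are `W` with the
identity. -/
theorem Inv.val_crossEffect (k : ℕ) : ∀ (t : ℕ) (T : J ⥤ (Fin (k + 1) → C)) (θ : T ⟶ T) [IsIso θ]
    (P : Power (Fin (t + 1)) W (T ⋙ Pi.eval _ 0))
    (_ : Functor.whiskerRight θ (Pi.eval _ 0) = P.act 0 α)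
    (_ : ∀ j : Fin k, T ⋙ Pi.eval _ j.succ ≅ W)
    (_ : ∀ j : Fin k, Functor.whiskerRight θ (Pi.eval _ j.succ) = 𝟙 _),
    (E.functor J).good (T ⋙ crossEffect F k) ∧
      χ.val (endDiagram (Functor.whiskerRight θ (crossEffect F k))) =
        (fwdDiff 1)^[k] (χ.powerVal F α) t := by
  induction k with
  | zero =>
    intro t T θ _ P hP _ _
    obtain ⟨h1, h2⟩ := χ.powerVal_eq α hW P
    refine ⟨h1, Eq.trans ?_ h2⟩
    rw [← hP]
    rfl
  | succ k ih =>
    intro t T θ _ P hP e he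
    let Φ := crossEffect F k
    let A₀ : (Fin (k + 2) → C) ⥤ C := Pi.eval _ 0
    let A₁ : (Fin (k + 2) → C) ⥤ C := Pi.eval _ 1
    have i1 := isIso_whiskerRight (merge k) θ
    have i2 := isIso_whiskerRight (dropSnd k) θ
    -- in the middle term, the first variable is a power with one more factor
    let Pm : Power (Fin (t + 1 + 1)) W ((T ⋙ merge k) ⋙ Pi.eval _ 0) :=
      P.snoc (e 0) (Functor.whiskerLeft T (biprod.fst : A₀ ⊞ A₁ ⟶ A₀))
        (Functor.whiskerLeft T (biprod.snd : A₀ ⊞ A₁ ⟶ A₁))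
        (Functor.whiskerLeft T (biprod.inl : A₀ ⟶ A₀ ⊞ A₁))
        (Functor.whiskerLeft T (biprod.inr : A₁ ⟶ A₀ ⊞ A₁))
        (congrArg (Functor.whiskerLeft T) biprod.inl_fst)
        (congrArg (Functor.whiskerLeft T) biprod.inl_snd)
        (congrArg (Functor.whiskerLeft T) biprod.inr_fst)
        (congrArg (Functor.whiskerLeft T) biprod.inr_snd)
        (congrArg (Functor.whiskerLeft T) biprod.total)
    have hPm : Functor.whiskerRight (Functor.whiskerRight θ (merge k)) (Pi.eval _ 0) =
        Pm.act 0 α := by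
      refine Pm.hom_ext fun i => ?_
      refine Eq.trans ?_ (Pm.diag_ρ _ i).symm
      induction i using Fin.lastCases with
      | last =>
        refine Eq.trans ?_ ((congrArg (Pm.ρ (Fin.last _) ≫ ·)
          (if_neg (Fin.last_pos.ne'))).trans (Category.comp_id _)).symm
        simp only [Pm, Power.snoc, Fin.lastCases_last]
        refine NatTrans.ext (funext fun x => ?_)
        have h1 := (biprod.snd : A₀ ⊞ A₁ ⟶ A₁).naturality (θ.app x)
        have h2 : A₁.map (θ.app x) = 𝟙 _ := NatTrans.congr_app (he 0) x
        rw [h2, Category.comp_id] at h1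
        exact (Category.assoc _ _ _).symm.trans (congrArg (· ≫ (e 0).hom.app x) h1)
      | cast i =>
        simp only [Pm, Power.snoc, Fin.lastCases_castSucc]
        have h3 := congrArg (· ≫ P.ρ i) hP
        refine NatTrans.ext (funext fun x => ?_)
        have h1 := (biprod.fst : A₀ ⊞ A₁ ⟶ A₀).naturality (θ.app x)
        have h2 := NatTrans.congr_app (h3.trans (P.diag_ρ _ i)) x
        refine (Category.assoc _ _ _).symm.trans ((congrArg (· ≫ (P.ρ i).app x) h1).trans ?_)
        refine (Category.assoc _ _ _).trans ((congrArg (_ ≫ ·) h2).trans ?_)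
        simp only [Fin.castSucc_eq_zero_iff]
        exact (Category.assoc _ _ _).symm
    obtain ⟨m1, m2⟩ := ih (t + 1) (T ⋙ merge k) (Functor.whiskerRight θ (merge k)) Pm hPm
      (fun j => e j.succ) (fun j => he j.succ)
    obtain ⟨d1, d2⟩ := ih t (T ⋙ dropSnd k) (Functor.whiskerRight θ (dropSnd k)) P hP
      (fun j => e j.succ) (fun j => he j.succ)
    have f1 : (E.functor J).good (T ⋙ dropFst k ⋙ Φ) :=
      (E.functor J).good_of_retract
        (Functor.whiskerLeft T (Functor.whiskerRight (mergeInr k) Φ))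
        (Functor.whiskerLeft T (Functor.whiskerRight (mergeSnd k) Φ))
        (by
          rw [← Functor.whiskerLeft_comp, ← Functor.whiskerRight_comp, mergeInr_snd,
            Functor.whiskerRight_id']
          rfl) m1
    have hθ : Functor.whiskerRight θ (dropFst k) = 𝟙 _ := by
      refine NatTrans.ext (funext fun x => funext fun j => ?_)
      induction j using Fin.cases with
      | zero => exact NatTrans.congr_app (he 0) x
      | succ j => exact NatTrans.congr_app (he j.succ) x
    -- the summand without the first variable is diagonal, as `θ` is the identity there
    have f2 : χ.val (endDiagram (Functor.whiskerRight θ (dropFst k ⋙ Φ))) = 0 := by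
      refine χ.diag none _ (E.good_endDiagram _ f1) fun j => funext fun m => ?_
      have : (Functor.whiskerRight θ (dropFst k ⋙ Φ)).app j = 𝟙 _ :=
        (congrArg Φ.map (NatTrans.congr_app hθ j)).trans (Φ.map_id _)
      change endD _ m = endD (𝟙 _) m
      rw [this]
    have hs := (isSplit_crossEffect h0 k).whiskerLeft T
    obtain ⟨r, s, hr, hs', _⟩ := hs.2
    have b1 := (E.functor J).good_of_retract s _ hs' m1
    refine ⟨(E.functor J).good_of_retract _ r hr m1, ?_⟩
    have i3 := isIso_whiskerRight (kernel (crossEffectMap F k)) θ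
    have i4 := isIso_whiskerRight ((dropSnd k ⋙ Φ) ⊞ (dropFst k ⋙ Φ)) θ
    have i5 := isIso_whiskerRight (dropSnd k ⋙ Φ) θ
    have i6 := isIso_whiskerRight (dropFst k ⋙ Φ) θ
    have i7 := isIso_whiskerRight (merge k ⋙ Φ) θ
    have e1 := χ.val_endDiagram_ses m1 _ _ hs
      (Functor.whiskerRight θ (kernel (crossEffectMap F k))) (Functor.whiskerRight θ (merge k ⋙ Φ))
      (Functor.whiskerRight θ ((dropSnd k ⋙ Φ) ⊞ (dropFst k ⋙ Φ)))
      (NatTrans.ext (funext fun x => (NatTrans.naturality _ (θ.app x))))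
      (NatTrans.ext (funext fun x => ((crossEffectMap F k).naturality (θ.app x))))
    have e2 := χ.val_endDiagram_ses b1 _ _
      ((isSplit_biprod (dropSnd k ⋙ Φ) (dropFst k ⋙ Φ)).whiskerLeft T)
      (Functor.whiskerRight θ (dropSnd k ⋙ Φ))
      (Functor.whiskerRight θ ((dropSnd k ⋙ Φ) ⊞ (dropFst k ⋙ Φ)))
      (Functor.whiskerRight θ (dropFst k ⋙ Φ))
      (NatTrans.ext (funext fun x =>
        (biprod.inl : dropSnd k ⋙ Φ ⟶ (dropSnd k ⋙ Φ) ⊞ (dropFst k ⋙ Φ)).naturality (θ.app x)))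
      (NatTrans.ext (funext fun x =>
        (biprod.snd : (dropSnd k ⋙ Φ) ⊞ (dropFst k ⋙ Φ) ⟶ dropFst k ⋙ Φ).naturality (θ.app x)))
    -- the other two terms are the values of `Δ^k f` at `t + 1` and `t`
    rw [Function.iterate_succ_apply', fwdDiff, ← m2, ← d2]
    rw [e2, f2, add_zero] at e1
    exact eq_sub_of_add_eq e1.symm

end

end
end GraysonK

namespace GraysonK
noncomputable section

/-! ### Objects with commuting automorphisms -/

open BinaryComplex ZeroObject

namespace CommAut

section

variable {C : Type*} [Category* C] [Preadditive C] {n : ℕ} {P Q : CommAut C n}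

instance : Zero (P ⟶ Q) := ⟨{ hom := 0, comm := by simp }⟩
instance : Add (P ⟶ Q) := ⟨fun a b => { hom := a.hom + b.hom, comm := by simp [Hom.comm] }⟩
instance : Neg (P ⟶ Q) := ⟨fun a => { hom := -a.hom, comm := by simp [Hom.comm] }⟩
instance : Sub (P ⟶ Q) := ⟨fun a b => { hom := a.hom - b.hom, comm := by simp [Hom.comm] }⟩
instance : SMul ℕ (P ⟶ Q) := ⟨fun n a => { hom := n • a.hom, comm := by simp [Hom.comm] }⟩
instance : SMul ℤ (P ⟶ Q) := ⟨fun n a => { hom := n • a.hom, comm := by simp [Hom.comm] }⟩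

instance : AddCommGroup (P ⟶ Q) :=
  Function.Injective.addCommGroup (fun a : P ⟶ Q => a.hom) (fun _ _ h => Hom.ext h)
    rfl (fun _ _ => rfl) (fun _ => rfl) (fun _ _ => rfl) (fun _ _ => rfl) (fun _ _ => rfl)

theorem add_hom (a b : P ⟶ Q) : (a + b).hom = a.hom + b.hom := rfl

instance : Preadditive (CommAut C n) where
  add_comp _ _ _ _ _ _ := Hom.ext (Preadditive.add_comp ..)
  comp_add _ _ _ _ _ _ := Hom.ext (Preadditive.comp_add ..)

theorem sum_hom {ι : Type*} (s : Finset ι) (f : ι → (P ⟶ Q)) : (∑ i ∈ s, f i).hom = ∑ i ∈ s, (f i).hom :=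
  map_sum (AddMonoidHom.mk' (fun a : P ⟶ Q => a.hom) add_hom) f s

/-- The diagonal action on a power. -/
def ofPower (P : CommAut C n) {I : Type*} [Fintype I] {Z : C} (p : Power I P.obj Z) :
    CommAut C n where
  obj := Z
  aut i := p.diagAut fun _ => P.aut i
  comm i j := p.commute_diagAut fun _ => P.comm i j

/-- A power with the diagonal action is a power. -/
def power (P : CommAut C n) {I : Type*} [Fintype I] {Z : C} (p : Power I P.obj Z) :
    Power I P (P.ofPower p) where
  ρ i := { hom := p.ρ i, comm := fun _ => p.diag_ρ _ _ }
  inc i :=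
    { hom := p.inc i
      comm := fun j => (p.inc_diag (fun _ => (P.aut j).hom) i).symm }
  inc_ρ_self i := Hom.ext (p.inc_ρ_self i)
  inc_ρ_ne h := Hom.ext (p.inc_ρ_ne h)
  total := Hom.ext ((sum_hom _ _).trans p.total)

end

section

variable {C : Type*} [Category* C] {n : ℕ} {J : Type*} [Category* J]

/-- The last automorphism of a diagram. -/
def lastAut (P : J ⥤ CommAut C (n + 1)) : Aut (P ⋙ init) :=
  NatIso.ofComponents (fun j =>
    { hom := (P.obj j).lastEnd
      inv :=
        { hom := ((P.obj j).aut (Fin.last n)).inv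
          comm := fun i => congrArg Iso.hom
            (((P.obj j).comm (Fin.last n) i.castSucc).inv_left).eq }
      hom_inv_id := Hom.ext (Iso.hom_inv_id _)
      inv_hom_id := Hom.ext (Iso.inv_hom_id _) })
    fun f => (lastEnd_naturality (P.map f)).symm

end

end CommAut

/-- Additive functors preserve powers. -/
def Power.map {B B' : Type*} [Category* B] [Preadditive B] [Category* B'] [Preadditive B'] (F : B ⥤ B')
    (h0 : ∀ X Y : B, F.map (0 : X ⟶ Y) = 0)
    (hF : ∀ {X Y : B} (f g : X ⟶ Y), F.map (f + g) = F.map f + F.map g)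
    {I : Type*} [Fintype I] {W Z : B} (P : Power I W Z) : Power I (F.obj W) (F.obj Z) where
  ρ i := F.map (P.ρ i)
  inc i := F.map (P.inc i)
  inc_ρ_self i := by rw [← F.map_comp, P.inc_ρ_self, F.map_id]
  inc_ρ_ne h := by rw [← F.map_comp, P.inc_ρ_ne h, h0]
  total := by
    have h := map_sum (AddMonoidHom.mk' (fun f : Z ⟶ Z => F.map f) hF) (fun i => P.ρ i ≫ P.inc i)
      Finset.univ
    rw [P.total] at h
    simp only [← F.map_comp]
    exact h.symm.trans (F.map_id _)

section

variable {X : Scheme.{u}}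

theorem cube_map_add : ∀ {n : ℕ} {P Q : CommAut X.Modules n} (f g : P ⟶ Q),
    (cube X n).map (f + g) = (cube X n).map f + (cube X n).map g
  | 0, _, _, _, _ => rfl
  | _ + 1, _, _, f, g => BinaryComplex.hom_ext fun k => match k with
    | 0 => cube_map_add (CommAut.init.map f) (CommAut.init.map g)
    | 1 => cube_map_add (CommAut.init.map f) (CommAut.init.map g)
    | _ + 2 => (isZero_zero _).eq_of_src _ _

theorem cube_map_zero {n : ℕ} (P Q : CommAut X.Modules n) : (cube X n).map (0 : P ⟶ Q) = 0 := by
  have := cube_map_add (0 : P ⟶ Q) 0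
  rw [add_zero] at this
  exact left_eq_add.1 this

/-- The exact structure on multicomplexes obtained from an exact structure on modules. -/
def multiData (E : ExactData X.Modules) : ∀ n, ExactData (Multi X n)
  | 0 => E
  | n + 1 => ExactData.binary (multiData E n)

variable {J : Type*} [Category* J]

/-- The cross-effects of the exterior power as functors on objects with automorphisms. -/
def crossEffectFunctor (X : Scheme.{u}) (r k n : ℕ) : CommAut X.Modules n ⥤ CommAut X.Modules n where
  obj P := crossEffectAut X r k P
  map {P Q} f :=
    { hom := (crossEffect (extPow X r) k).map fun _ => f.hom
      comm := fun i => ((crossEffect (extPow X r) k).map_comp _ _).symm.trans ((congrArg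
        (crossEffect (extPow X r) k).map (funext fun t => by
          change (ite _ (1 : Aut P.obj) (P.aut i)).hom ≫ f.hom =
            f.hom ≫ (ite _ (1 : Aut Q.obj) (Q.aut i)).hom
          split_ifs
          · exact (Category.id_comp _).trans (Category.comp_id _).symm
          · exact f.comm i)).trans ((crossEffect (extPow X r) k).map_comp _ _)) }
  map_id P := CommAut.Hom.ext ((crossEffect (extPow X r) k).map_id _)
  map_comp f g := CommAut.Hom.ext ((crossEffect (extPow X r) k).map_comp (fun _ => f.hom) fun _ => g.hom)

theorem lastAut_crossEffect (r k n : ℕ) (P : J ⥤ CommAut X.Modules (n + 2)) :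
    (CommAut.lastAut (P ⋙ crossEffectFunctor X r k (n + 2))).hom =
      Functor.whiskerRight (CommAut.lastAut P).hom (crossEffectFunctor X r k (n + 1)) := by
  refine NatTrans.ext (funext fun j => CommAut.Hom.ext ?_)
  refine congrArg (crossEffect (extPow X r) k).map (funext fun t => ?_)
  change (ite _ (1 : Aut (P.obj j).obj) ((P.obj j).aut (Fin.last (n + 1)))).hom = _
  rw [if_neg (fun h => Nat.succ_ne_zero n h.1)]
  rfl

section

variable (E : ExactData X.Modules)

theorem good_gam {M : X.Modules} (hM : E.good M) (m : ℕ) : E.good (DoldKan.gam m M) := by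
  induction m with
  | zero => exact E.good_of_iso ((DoldKan.gamPower M 0).iso (Power.single M) (Equiv.refl _)) hM
  | succ m ih =>
    let P := DoldKan.gamPower M (m + 1)
    let P' := DoldKan.gamPower M m
    refine E.good_of_isSplit (P.lift (Fin.cases 0 P'.ρ)) (P.ρ 0) ⟨P.lift_ρ _ 0,
      P'.lift (fun i => P.ρ i.succ), P.inc 0, P'.hom_ext fun i => ?_, P.inc_ρ_self 0,
      P.hom_ext fun i => ?_⟩ ih hM
    · rw [Category.assoc, P'.lift_ρ, Category.id_comp]
      exact P.lift_ρ _ i.succ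
    · rw [Preadditive.add_comp, Category.assoc, Category.assoc, P.lift_ρ, Category.id_comp]
      induction i using Fin.cases with
      | zero =>
        rw [P.inc_ρ_self, Category.comp_id]
        exact (congrArg (· + _) comp_zero).trans (zero_add _)
      | succ i =>
        rw [P.inc_ρ_ne (Fin.succ_ne_zero i).symm, comp_zero, add_zero]
        exact P'.lift_ρ _ i

theorem good_power {M Z : X.Modules} (hM : E.good M) {I : Type*} [Fintype I] [Nonempty I]
    (P : Power I M Z) : E.good Z :=
  good_of_power (H := 𝟭 X.Modules) (good_gam E hM) P

variable {E} {r : ℕ} (hE : ∀ M, E.good M → E.good ((extPow X r).obj M))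
  (h0 : ∀ M N : X.Modules, (extPow X r).map (0 : M ⟶ N) = 0) (hr : DegreeLE r (extPow X r))

include h0 in
theorem extMulti_map_zero : ∀ (k : ℕ) (P Q : Multi X k), (extMulti X r k).map (0 : P ⟶ Q) = 0
  | 0 => h0
  | k + 1 => DoldKan.functor_map_zero (extMulti_map_zero k)

include hr in
theorem degreeLE_extMulti : ∀ k : ℕ, DegreeLE r (extMulti X r k)
  | 0 => hr
  | k + 1 => (degreeLE_extMulti k).functor

/-- Powers of cubes are cubes of powers. -/
theorem good_extMulti_gam_of {k : ℕ} (h : ∀ P : CommAut X.Modules k, E.good P.obj →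
      (multiData E k).good ((extMulti X r k).obj ((cube X k).obj P)))
    {P : CommAut X.Modules k} (hP : E.good P.obj) (m : ℕ) :
    (multiData E k).good ((extMulti X r k).obj (DoldKan.gam m ((cube X k).obj P))) := by
  let p := P.power (DoldKan.gamPower P.obj m)
  refine (multiData E k).good_of_iso ((extMulti X r k).mapIso
    ((DoldKan.gamPower ((cube X k).obj P) m).iso (p.map (cube X k) cube_map_zero cube_map_add)
      (Equiv.refl _))) (h _ (good_power E hP (DoldKan.gamPower P.obj m)))

include hE h0 hr in
theorem good_extMulti : ∀ (k : ℕ) (P : CommAut X.Modules k), E.good P.obj →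
    (multiData E k).good ((extMulti X r k).obj ((cube X k).obj P))
  | 0, P, hP => hE _ hP
  | k + 1, P, hP => by
    -- a single object is regarded as a constant diagram, in order to apply `good_normDiagram`
    let Q : Discrete PUnit.{1} ⥤ CommAut X.Modules (k + 1) := (Functor.const _).obj P
    have := isIso_whiskerRight (cube X k) (CommAut.lastAut Q).hom
    exact good_normDiagram (Functor.whiskerRight (CommAut.lastAut Q).hom (cube X k))
      (extMulti_map_zero h0 k) (degreeLE_extMulti hr k)
      (fun m j => good_extMulti_gam_of (good_extMulti k) (P := CommAut.init.obj P) hP m) ⟨⟨⟩⟩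

include hE h0 hr in
theorem good_extMulti_gam {k : ℕ} {P : CommAut X.Modules k} (hP : E.good P.obj) (m : ℕ) :
    (multiData E k).good ((extMulti X r k).obj (DoldKan.gam m ((cube X k).obj P))) :=
  good_extMulti_gam_of (good_extMulti hE h0 hr k) hP m

theorem good_cube (E : ExactData X.Modules) : ∀ {k : ℕ} {P : CommAut X.Modules k}, E.good P.obj →
    (multiData E k).good ((cube X k).obj P)
  | 0, _, hP => hP
  | k + 1, P, hP => by
    let Q : Discrete PUnit.{1} ⥤ CommAut X.Modules (k + 1) := (Functor.const _).obj P
    have := isIso_whiskerRight (cube X k) (CommAut.lastAut Q).hom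
    exact (multiData E k).good_endDiagram (Functor.whiskerRight (CommAut.lastAut Q).hom (cube X k))
      (fun _ => good_cube E (P := CommAut.init.obj P) hP) ⟨⟨⟩⟩

/-- The diagonal of a diagram of automorphisms, as used for cross-effects. -/
def tupleDiagram (W : J ⥤ X.Modules) (k : ℕ) : J ⥤ (Fin (k + 1) → X.Modules) :=
  Functor.pi' fun _ => W

include hE h0 in
/-- The case of `Inv.val_crossEffect` in which all variables are equal. -/
theorem crossEffect_good_and_val {A : Type*} [AddCommGroup A]
    (χ : Inv ((multiData E 1).functor J) A) (P : J ⥤ CommAut X.Modules 1)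
    (hP : ∀ j, E.good (P.obj j).obj) (k : ℕ) :
    (∀ j, E.good (crossEffectAut X r k (P.obj j)).obj) ∧
      χ.val (P ⋙ crossEffectFunctor X r k 1 ⋙ cube X 1) =
        (fwdDiff 1)^[k] (χ.powerVal (extPow X r) (Functor.whiskerRight (CommAut.lastAut P).hom
          (cube X 0))) 0 := by
  let W : J ⥤ X.Modules := P ⋙ CommAut.init ⋙ cube X 0
  let α : W ⟶ W := Functor.whiskerRight (CommAut.lastAut P).hom (cube X 0)
  have : IsIso α := isIso_whiskerRight (cube X 0) (CommAut.lastAut P).hom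
  let θ : Aut (tupleDiagram W k) := NatIso.ofComponents
    (fun j => tupleAut fun t : Fin (k + 1) =>
      if ((0 : Fin 1) : ℕ) = 0 ∧ (t : ℕ) ≠ 0 then 1 else (P.obj j).aut 0)
    fun {j j'} f => funext fun t => by
      change (P.map f).hom ≫ (ite _ (1 : Aut (P.obj j').obj) _).hom =
        (ite _ (1 : Aut (P.obj j).obj) _).hom ≫ (P.map f).hom
      split_ifs
      · exact (Category.comp_id _).trans (Category.id_comp _).symm
      · exact ((P.map f).comm 0).symm
  exact Inv.val_crossEffect (C := X.Modules) (D := X.Modules) (E := E) χ h0 α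
    (fun m j => hE _ (good_gam E (hP j) m)) k 0 (tupleDiagram W k) θ.hom (Power.single W)
    ((Power.single W).hom_ext fun i => (Category.comp_id _).trans (Eq.trans
      (by rw [if_pos (Subsingleton.elim i 0)]; exact (Category.id_comp α).symm)
      ((Power.single W).diag_ρ _ i).symm))
    (fun j => Iso.refl _) (fun j => rfl)

include hE h0 hr in
/-- The case of one automorphism. -/
theorem Inv.val_extMulti_one {A : Type*} [AddCommGroup A]
    (χ : Inv ((multiData E 1).functor J) A) (P : J ⥤ CommAut X.Modules 1)
    (hP : ∀ j, E.good (P.obj j).obj) :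
    χ.val (P ⋙ cube X 1 ⋙ extMulti X r 1) = ∑ i : Fin r,
      (-1 : ℤ) ^ (i : ℕ) • χ.val (P ⋙ crossEffectFunctor X r i 1 ⋙ cube X 1) := by
  have := isIso_whiskerRight (cube X 0) (CommAut.lastAut P).hom
  refine (χ.val_normDiagram (Functor.whiskerRight (CommAut.lastAut P).hom (cube X 0)) h0 hr
    (fun m j => hE _ (good_gam E (hP j) m))).trans ?_
  rw [← Fin.sum_univ_eq_sum_range (fun m => (-1 : ℤ) ^ m • (fwdDiff 1)^[m] _ 0)]
  exact Finset.sum_congr rfl fun i _ =>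
    congrArg _ (crossEffect_good_and_val hE h0 χ P hP i).2.symm

/-- Restriction to the original diagram of the functor of a diagram with an automorphism. -/
theorem Inv.val_loop_diagram {B D : Type*} [Category* B] [Category* D] [Preadditive D]
    [HasZeroObject D] {E : ExactData D} {A : Type*} [AddCommGroup A]
    (χ : Inv (E.binary.functor J) A) (R : J ⥤ B) (b : Aut R) (G : B ⥤ D)
    (hR : (E.functor J).good (R ⋙ G)) :
    χ.loop.val (Loop.diagram R b ⋙ G) = χ.val (endDiagram (Functor.whiskerRight b.hom G)) := by
  have := isIso_whiskerRight G b.hom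
  refine χ.val_loop _ (Functor.isoWhiskerRight (Loop.inclDiagram R b) G) ?_ hR
  exact NatTrans.ext (funext fun j => (G.map_comp _ _).symm.trans
    ((congrArg G.map (NatTrans.congr_app (Loop.aut_diagram R b) j)).trans (G.map_comp _ _)))

include hE h0 hr in
/-- The formula for arbitrary additive invariants on diagrams. In the induction step, the functor in
the last direction is applied termwise by `Inv.val_normDiagram_functor`, and the last automorphism
becomes a part of the diagram. This is compatible with the claim, since all automorphisms but the
first one act diagonally on the variables of the cross-effects. -/
theorem Inv.val_extMulti (hr1 : 1 ≤ r) {A : Type*} [AddCommGroup A] (k : ℕ) :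
    ∀ {J : Type} [Category.{0} J] (χ : Inv ((multiData E (k + 1)).functor J) A)
    (P : J ⥤ CommAut X.Modules (k + 1)) (_ : ∀ j, E.good (P.obj j).obj)
    (_ : ∀ (i : Fin r) j, E.good (crossEffectAut X r i (P.obj j)).obj),
    χ.val (P ⋙ cube X (k + 1) ⋙ extMulti X r (k + 1)) = ∑ i : Fin r,
      (-1 : ℤ) ^ (i : ℕ) • χ.val (P ⋙ crossEffectFunctor X r i (k + 1) ⋙ cube X (k + 1)) := by
  induction k with
  | zero => exact fun χ P hP _ => χ.val_extMulti_one hE h0 hr P hP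
  | succ k ih =>
    intro J _ χ P hP hcr
    -- `c` and `d` are the last but one and the last automorphism, and `a` and `b` are the induced
    -- automorphisms of the cubes for the remaining ones
    let W : J ⥤ Multi X k := P ⋙ CommAut.init ⋙ CommAut.init ⋙ cube X k
    let c : Aut (P ⋙ CommAut.init ⋙ CommAut.init) := CommAut.lastAut (P ⋙ CommAut.init)
    let d : Aut (P ⋙ CommAut.init ⋙ CommAut.init) := whiskerAut CommAut.init (CommAut.lastAut P)
    have hcd : Commute c d := Iso.ext (NatTrans.ext (funext fun j => CommAut.Hom.ext
      (congrArg Iso.hom ((P.obj j).comm (Fin.last k).castSucc (Fin.last (k + 1))).eq)))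
    let a : Aut W := whiskerAut (cube X k) c
    let b : Aut W := whiskerAut (cube X k) d
    have hab : Commute a b := hcd.map _
    have e1 : endDiagramMap (α := a.hom) (β := a.hom) b.hom (congrArg Iso.hom hab.eq.symm) =
      Functor.whiskerRight (CommAut.lastAut P).hom (cube X (k + 1)) :=
      endDiagram_hom_ext (fun _ => rfl) (fun _ => rfl)
    have B := Inv.val_normDiagram_functor (E := multiData E k) χ (extMulti_map_zero h0 k) hr1
      (degreeLE_extMulti hr k)
      (fun m j => good_extMulti_gam hE h0 hr (k := k)
        (P := CommAut.init.obj (CommAut.init.obj (P.obj j))) (hP j) m) hab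
    rw [e1] at B
    refine B.trans ?_
    -- the last automorphism becomes a part of the diagram
    refine (χ.val_loop_diagram (E := multiData E (k + 1)) (P ⋙ CommAut.init) (CommAut.lastAut P)
      (cube X (k + 1) ⋙ extMulti X r (k + 1))
      (fun j => good_extMulti hE h0 hr (k + 1) (CommAut.init.obj (P.obj j)) (hP j))).symm.trans ?_
    refine (ih (χ.loop (E := multiData E (k + 1)))
      (Loop.diagram (P ⋙ CommAut.init) (CommAut.lastAut P)) (fun p => hP p.2)
      (fun i p => hcr i p.2)).trans ?_
    refine Finset.sum_congr rfl fun i _ => congrArg _ ?_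
    refine (χ.val_loop_diagram (E := multiData E (k + 1)) (P ⋙ CommAut.init) (CommAut.lastAut P)
      (crossEffectFunctor X r i (k + 1) ⋙ cube X (k + 1))
      (fun j => good_cube E (k := k + 1) (hcr i j))).trans ?_
    exact congrArg (fun f : (P ⋙ CommAut.init) ⋙ crossEffectFunctor X r i (k + 1) ⟶
        (P ⋙ CommAut.init) ⋙ crossEffectFunctor X r i (k + 1) =>
      χ.val (endDiagram (Functor.whiskerRight f (cube X (k + 1))))) (lastAut_crossEffect r i k P).symm

end

end

end
end GraysonK

namespace GraysonK
noncomputable section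

/-! ### From additive invariants to Grayson's K-groups -/

open BinaryComplex ZeroObject

section

variable {B : Type u} [Category.{v} B] [Preadditive B] [HasFiniteColimits B]

/-- A contractible complex is acyclic: the idempotents `h d` split off the cycles. -/
theorem Contractible.isAcyclic {E : ExactData B} {mem : B → Prop}
    {ses : ∀ {P Q R : B}, (P ⟶ Q) → (Q ⟶ R) → Prop} (hmem : ∀ P, E.good P → mem P)
    (hses : ∀ {P Q R : B} (f : P ⟶ Q) (g : Q ⟶ R), E.ses f g → ses f g)
    {X : ℕ → B} {d : ∀ k, X (k + 1) ⟶ X k} (hX : ∀ k, E.good (X k))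
    (hd : ∀ k, d (k + 1) ≫ d k = 0) (h : Contractible X d) : IsAcyclic mem ses X d := by
  obtain ⟨h, h0, hs⟩ := h
  have h1 (k : ℕ) : d k ≫ h k ≫ d k = d k := by
    have := congrArg (· ≫ d k) (hs k)
    simpa [Preadditive.add_comp, hd] using this
  let s (k : ℕ) : IdemSplit (h k ≫ d k) := IdemSplit.ofCokernel (by rw [Category.assoc, h1])
  have h2 (k : ℕ) : (s (k + 1)).ι ≫ d k = 0 := by
    rw [← (s (k + 1)).ι_comp, Category.assoc, Category.assoc, hd, comp_zero, comp_zero]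
  refine ⟨fun k => (s k).obj, fun k => (s k).ι, fun k => d k ≫ (s k).π, fun k => ?_, fun k => ?_,
    fun k => ?_, ?_⟩
  · exact hmem _ (E.good_of_retract (s k).ι (s k).π (s k).ι_π (hX k))
  · rw [Category.assoc, (s k).π_ι, h1]
  · refine hses _ _ (E.ses_of_isSplit _ _ ⟨?_, (s (k + 1)).π, (s k).ι ≫ h k, (s (k + 1)).ι_π, ?_, ?_⟩)
    · rw [← Category.assoc, h2, zero_comp]
    · have := (s k).comp_π
      rw [Category.assoc] at this
      rw [Category.assoc, this, (s k).ι_π]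
    · have := (s k).π_ι_assoc (h k)
      rw [Category.assoc, (s (k + 1)).π_ι, this, Category.assoc, reassoc_of% (h1 k)]
      exact (add_comm _ _).trans (hs k)
  · exact ⟨(s 0).π, (s 0).ι_π, (s 0).π_ι.trans h0⟩

end

section

variable {X : Scheme.{u}} (E : ExactData X.Modules)

theorem isSES_of_ses (hs : ∀ {P Q R : X.Modules} (f : P ⟶ Q) (g : Q ⟶ R), E.ses f g ↔ IsSES X 0 f g) :
    ∀ (n : ℕ) {P Q R : Multi X n} (f : P ⟶ Q) (g : Q ⟶ R),
    (multiData E n).ses f g ↔ IsSES X n f g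
  | 0, _, _, _, f, g => hs f g
  | n + 1, _, _, _, _, _ => forall_congr' fun _ => isSES_of_ses hs n _ _

variable {E} (hg : ∀ M : X.Modules, E.good M ↔ IsLocallyFreeFinite M)
  (hs : ∀ {P Q R : X.Modules} (f : P ⟶ Q) (g : Q ⟶ R), E.ses f g ↔ IsSES X 0 f g)

include hg hs in
/-- Good objects belong to the category in which `K_n(X)` is formed. -/
theorem isAcyclicMulti_of_good : ∀ (n : ℕ) (P : Multi X n), (multiData E n).good P →
    IsAcyclicMulti X n P
  | 0, P, h => (hg P).1 h
  | n + 1, P, h => by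
    obtain ⟨h1, h2, h3, h4⟩ := h
    exact ⟨fun k => isAcyclicMulti_of_good n _ (h1 k), h2,
      h3.isAcyclic (E := multiData E n) (isAcyclicMulti_of_good n)
        (fun f g => (isSES_of_ses E hs n f g).1) h1 (BinaryComplex.dTop_comp P),
      h4.isAcyclic (E := multiData E n) (isAcyclicMulti_of_good n)
        (fun f g => (isSES_of_ses E hs n f g).1) h1 (BinaryComplex.dBot_comp P)⟩

variable (E) in
/-- The numbering of the directions of multicomplexes. -/
def dirFin [IsEmpty E.dir] : ∀ n, (multiData E n).dir → Fin n
  | 0, i => isEmptyElim (α := E.dir) i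
  | _ + 1, none => 0
  | n + 1, some i => (dirFin n i).succ

theorem isDiagonalIn_of_isDiag [IsEmpty E.dir] : ∀ (n : ℕ) (i : (multiData E n).dir) (P : Multi X n),
    (multiData E n).isDiag i P → IsDiagonalIn X n (dirFin E n i) P
  | 0, i, _, _ => isEmptyElim (α := E.dir) i
  | _ + 1, none, _, h => h
  | n + 1, some i, _, h => fun k => isDiagonalIn_of_isDiag n i _ (h k)

open Classical in
/-- The class in `K_n(X)` as an additive invariant; the value on other multicomplexes is `0`. -/
def clsInv [IsEmpty E.dir] (n : ℕ) : Inv (multiData E n) (K X n) where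
  val P := if h : IsAcyclicMulti X n P then cls P h else 0
  add {P Q R} f g hP hQ hR h := by
    have hP := isAcyclicMulti_of_good hg hs n P hP
    have hQ := isAcyclicMulti_of_good hg hs n Q hQ
    have hR := isAcyclicMulti_of_good hg hs n R hR
    rw [dif_pos hP, dif_pos hQ, dif_pos hR]
    have : FreeAbelianGroup.of ⟨Q, hQ⟩ - FreeAbelianGroup.of ⟨P, hP⟩ - FreeAbelianGroup.of ⟨R, hR⟩ ∈
        AddSubgroup.closure (relations X n) := AddSubgroup.subset_closure
      (Or.inl ⟨⟨P, hP⟩, ⟨Q, hQ⟩, ⟨R, hR⟩, f, g, (isSES_of_ses E hs n f g).1 h, rfl⟩)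
    have h' := (QuotientAddGroup.eq_zero_iff _).2 this
    rw [QuotientAddGroup.mk_sub, QuotientAddGroup.mk_sub, sub_sub, sub_eq_zero] at h'
    exact h'
  diag i P hP h := by
    have hP := isAcyclicMulti_of_good hg hs n P hP
    rw [dif_pos hP]
    exact (QuotientAddGroup.eq_zero_iff _).2 (AddSubgroup.subset_closure
      (Or.inr ⟨⟨P, hP⟩, ⟨_, isDiagonalIn_of_isDiag n i P h⟩, rfl⟩))

theorem clsInv_val [IsEmpty E.dir] {n : ℕ} {P : Multi X n} (h : IsAcyclicMulti X n P) :
    (clsInv hg hs n).val P = cls P h := dif_pos h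

theorem ExactData.preserves_evaluation {J D : Type*} [Category* J] [Category* D] [Preadditive D]
    (E : ExactData D) (j : J) :
    (E.functor J).Preserves E ((evaluation J D).obj j) id where
  good _ h := h j
  ses _ _ _ _ _ h := h j
  diag _ _ _ h := h j

include hg hs in
/-- The formula in `K_n(X)`, given the required properties of exterior powers and of locally free
sheaves. -/
theorem cls_extMulti_cube [IsEmpty E.dir] {r : ℕ} (hr1 : 1 ≤ r)
    (hE : ∀ M, E.good M → E.good ((extPow X r).obj M))
    (h0 : ∀ M N : X.Modules, (extPow X r).map (0 : M ⟶ N) = 0) (hr : DegreeLE r (extPow X r))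
    {n : ℕ} (hn : 1 ≤ n) (P : CommAut X.Modules n) (hP : IsLocallyFreeFinite P.obj) :
    ∃ (_ : IsAcyclicMulti X n ((cube X n).obj P))
      (hL : IsAcyclicMulti X n ((extMulti X r n).obj ((cube X n).obj P)))
      (hR : ∀ i : Fin r, IsAcyclicMulti X n ((cube X n).obj (crossEffectAut X r i P))),
      cls _ hL = ∑ i : Fin r, (-1 : ℤ) ^ (i : ℕ) • cls _ (hR i) := by
  obtain ⟨n, rfl⟩ := Nat.exists_eq_add_of_le' hn
  have hP' := (hg _).2 hP
  -- a constant diagram on the category with one object, in order to use the result on diagrams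
  let Q : Discrete PUnit.{1} ⥤ CommAut X.Modules (n + 1) := (Functor.const _).obj P
  have hcr (i : ℕ) : E.good (crossEffectAut X r i P).obj := by
    -- whether a cross-effect is good does not depend on the automorphisms or on the invariant
    let Q' : Discrete PUnit.{1} ⥤ CommAut X.Modules 1 :=
      (Functor.const _).obj ⟨P.obj, fun _ => 1, fun _ _ => Commute.one_left _⟩
    let χ : Inv ((multiData E 1).functor (Discrete PUnit.{1})) ℤ :=
      ⟨fun _ => 0, fun _ _ _ _ _ _ => rfl, fun _ _ _ _ => rfl⟩
    exact (crossEffect_good_and_val hE h0 χ Q' (fun _ => hP') i).1 ⟨⟨⟩⟩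
  have hL := isAcyclicMulti_of_good hg hs _ _ (good_extMulti hE h0 hr (n + 1) P hP')
  have hR (i : Fin r) := isAcyclicMulti_of_good hg hs (n + 1) _ (good_cube E (hcr i))
  refine ⟨isAcyclicMulti_of_good hg hs (n + 1) _ (good_cube E hP'), hL, hR, ?_⟩
  have := ((clsInv hg hs (n + 1)).comap _ _ ((multiData E (n + 1)).preserves_evaluation
    (⟨⟨⟩⟩ : Discrete PUnit.{1}))).val_extMulti hE h0 hr hr1 n Q (fun _ => hP') (fun i _ => hcr i)
  refine (clsInv_val hg hs hL).symm.trans (this.trans (Finset.sum_congr rfl fun i _ => ?_))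
  exact congrArg _ (clsInv_val hg hs (hR i))

end

end
end GraysonK

namespace GraysonK

noncomputable section

/-! ### Local bases of sections -/

open BinaryComplex ZeroObject

/-- Restriction of sections of an `𝒪_X`-module to a smaller open set. -/
def res {X : Scheme.{u}} (M : X.Modules) {V U : X.Opens} (h : V ≤ U) : Γ(M, U) →+ Γ(M, V) :=
  (M.presheaf.map (homOfLE h).op).hom

theorem res_res {X : Scheme.{u}} (M : X.Modules) {W V U : X.Opens} (h : V ≤ U) (k : W ≤ V)
    (s : Γ(M, U)) : res M k (res M h s) = res M (k.trans h) s := by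
  change (M.presheaf.map (homOfLE h).op ≫ M.presheaf.map (homOfLE k).op) s = _
  rw [← Functor.map_comp]
  rfl

theorem res_self {X : Scheme.{u}} (M : X.Modules) {U : X.Opens} (h : U ≤ U) (s : Γ(M, U)) :
    res M h s = s := by
  have : (homOfLE h).op = 𝟙 _ := rfl
  unfold res
  rw [this, CategoryTheory.Functor.map_id]
  rfl

theorem res_smul {X : Scheme.{u}} (M : X.Modules) {V U : X.Opens} (h : V ≤ U) (c : Γ(X, U))
    (s : Γ(M, U)) : res M h (c • s) = X.presheaf.map (homOfLE h).op c • res M h s :=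
  Scheme.Modules.map_smul M _ c s

theorem app_res {X : Scheme.{u}} {M N : X.Modules} (f : M ⟶ N) {V U : X.Opens} (h : V ≤ U)
    (s : Γ(M, U)) : f.app V (res M h s) = res N h (f.app U s) :=
  congr($(f.mapPresheaf.naturality (homOfLE h).op) s)

/-- The linear combination of the restrictions to `V` of sections `s i` over `U`. -/
def combo {X : Scheme.{u}} {M : X.Modules} {U : X.Opens} {I : Type*} [Fintype I]
    (s : I → Γ(M, U)) {V : X.Opens} (h : V ≤ U) (c : I → Γ(X, V)) : Γ(M, V) :=
  ∑ i, c i • res M h (s i)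

/-- A finite family of sections over `U` which restricts to a basis of the sections over every
open subset of `U`; in other words, an isomorphism of `M` over `U` with a free sheaf. -/
def IsBasisOn {X : Scheme.{u}} {M : X.Modules} {U : X.Opens} {I : Type*} [Fintype I]
    (s : I → Γ(M, U)) : Prop :=
  ∀ ⦃V : X.Opens⦄ (h : V ≤ U), Function.Bijective (combo s h)

theorem app_combo {X : Scheme.{u}} {M N : X.Modules} (f : M ⟶ N) {U : X.Opens} {I : Type*}
    [Fintype I] (s : I → Γ(M, U)) {V : X.Opens} (h : V ≤ U) (c : I → Γ(X, V)) :
    f.app V (combo s h c) = combo (fun i => f.app U (s i)) h c := by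
  simp [combo, map_sum, app_res]

theorem IsBasisOn.restrict {X : Scheme.{u}} {M : X.Modules} {U : X.Opens} {I : Type*} [Fintype I]
    {s : I → Γ(M, U)} (hs : IsBasisOn s) {V : X.Opens} (h : V ≤ U) :
    IsBasisOn (fun i => res M h (s i)) := fun W k => by
  have : combo (fun i => res M h (s i)) k = combo s (k.trans h) := by
    funext c
    simp [combo, res_res]
  rw [this]
  exact hs _

theorem IsBasisOn.map {X : Scheme.{u}} {M N : X.Modules} (e : M ≅ N) {U : X.Opens} {I : Type*}
    [Fintype I] {s : I → Γ(M, U)} (hs : IsBasisOn s) :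
    IsBasisOn (fun i => e.hom.app U (s i)) := fun V h => by
  have : combo (fun i => e.hom.app U (s i)) h = e.hom.app V ∘ combo s h := by
    funext c
    simp [app_combo]
  rw [this]
  exact (ConcreteCategory.bijective_of_isIso (e.hom.app V)).comp (hs h)

theorem IsBasisOn.reindex {X : Scheme.{u}} {M : X.Modules} {U : X.Opens} {I J : Type*} [Fintype I]
    [Fintype J] {s : I → Γ(M, U)} (hs : IsBasisOn s) (e : J ≃ I) : IsBasisOn (s ∘ e) :=
  fun V h => by
    have : combo (s ∘ e) h = combo s h ∘ (e.arrowCongr (Equiv.refl _)) := by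
      funext c
      simp only [combo, Function.comp_apply]
      exact Fintype.sum_equiv e _ _ (fun i => by simp [Equiv.arrowCongr])
    rw [this]
    exact (hs h).comp (Equiv.bijective _)

section Free

variable (X : Scheme.{u})

/-- The structure sheaf as a module over itself. -/
def unitMod : X.Modules := SheafOfModules.unit X.ringCatSheaf

/-- The free `𝒪_X`-module on a type. -/
def freeMod (I : Type u) : X.Modules := SheafOfModules.free (R := X.ringCatSheaf) I

variable {X} {I : Type u}

/-- The inclusion of a summand of a free sheaf. -/
def freeIncl (i : I) : unitMod X ⟶ freeMod X I := SheafOfModules.ιFree i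

theorem freeMod_hom_ext {M : X.Modules} {f g : freeMod X I ⟶ M}
    (h : ∀ i, freeIncl i ≫ f = freeIncl i ≫ g) : f = g :=
  Cofan.IsColimit.hom_ext (SheafOfModules.isColimitFreeCofan I) _ _ h

/-- The standard sections of a free sheaf. -/
def stdSection (i : I) (U : X.Opens) : Γ(freeMod X I, U) :=
  (freeIncl i).app U (1 : Γ(X, U))

theorem freeIncl_app (i : I) {U : X.Opens} (c : Γ(X, U)) :
    (freeIncl i).app U (c : Γ(unitMod X, U)) = c • stdSection i U :=
  (congrArg ((freeIncl i).app U) (mul_one c).symm).trans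
    (Scheme.Modules.Hom.app_smul (freeIncl i) c (1 : Γ(X, U)))

theorem res_stdSection (i : I) {U V : X.Opens} (h : V ≤ U) :
    res _ h (stdSection (X := X) i U) = stdSection i V :=
  (app_res (freeIncl i) h _).symm.trans
    (congrArg ((freeIncl i).app V) (map_one (X.presheaf.map (homOfLE h).op).hom))

/-- The morphism from a free sheaf given by a compatible family of sections. -/
def freeDesc {M : X.Modules} (t : I → Γ(M, ⊤)) : freeMod X I ⟶ M :=
  (SheafOfModules.freeHomEquiv M).symm fun i =>
    ⟨fun V => res M (le_top : V.unop ≤ ⊤) (t i), fun f => res_res M _ (leOfHom f.unop) (t i)⟩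

theorem freeDesc_app {M : X.Modules} (t : I → Γ(M, ⊤)) (i : I) (V : X.Opens) :
    (freeDesc t).app V (stdSection i V) = res M le_top (t i) := by
  have h : SheafOfModules.freeHomEquiv M (freeDesc t) i = _ :=
    congrFun ((SheafOfModules.freeHomEquiv M).apply_symm_apply _) i
  exact congr(($h).1 (Opposite.op V))

variable [DecidableEq I]

/-- The projection of a free sheaf onto a summand. -/
def freeProj (j : I) : freeMod X I ⟶ unitMod X :=
  Cofan.IsColimit.desc (SheafOfModules.isColimitFreeCofan I)
    (fun i => (if i = j then 𝟙 _ else 0 : unitMod X ⟶ unitMod X))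

theorem freeIncl_freeProj (i j : I) :
    freeIncl i ≫ freeProj (X := X) j = if i = j then 𝟙 _ else 0 :=
  Cofan.IsColimit.fac (SheafOfModules.isColimitFreeCofan I)
    (fun i => (if i = j then 𝟙 _ else 0 : unitMod X ⟶ unitMod X)) i

variable [Fintype I]

theorem sum_freeProj_freeIncl : ∑ j : I, freeProj (X := X) j ≫ freeIncl j = 𝟙 _ :=
  freeMod_hom_ext fun i => by
    simp [Preadditive.comp_sum, ← Category.assoc, freeIncl_freeProj, ite_comp]

theorem sum_app {M N : X.Modules} {J : Type*} (s : Finset J) (f : J → (M ⟶ N)) (U : X.Opens)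
    (x : Γ(M, U)) : (∑ j ∈ s, f j).app U x = ∑ j ∈ s, (f j).app U x := by
  classical
  induction s using Finset.induction_on with
  | empty => simp
  | insert a s ha ih => rw [Finset.sum_insert ha, Finset.sum_insert ha, ← ih]; rfl

theorem bijective_stdSection (U : X.Opens) :
    Function.Bijective (fun c : I → Γ(X, U) => ∑ i, c i • stdSection i U) := by
  refine Function.bijective_iff_has_inverse.2 ⟨fun y j => (freeProj j).app U y, fun c => ?_,
    fun y => ?_⟩
  · funext j
    simp only [← freeIncl_app, map_sum]
    rw [Finset.sum_eq_single j]
    · change (freeIncl j ≫ freeProj j).app U (c j) = c j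
      rw [freeIncl_freeProj, if_pos rfl]
      rfl
    · intro i _ h
      change (freeIncl i ≫ freeProj j).app U (c i) = _
      rw [freeIncl_freeProj, if_neg h]
      rfl
    · simp
  · refine Eq.trans ?_ congr(($(sum_freeProj_freeIncl (X := X) (I := I))).app U y)
    rw [sum_app]
    exact Finset.sum_congr rfl fun j _ => (freeIncl_app j _).symm

theorem isBasisOn_stdSection (U : X.Opens) : IsBasisOn (fun i : I => stdSection (X := X) i U) :=
  fun V h => by
    have := bijective_stdSection (X := X) (I := I) V
    simp only [← res_stdSection _ h] at this
    exact this

theorem isIso_freeDesc {M : X.Modules} {t : I → Γ(M, ⊤)} (ht : IsBasisOn t) :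
    IsIso (freeDesc t) := by
  rw [Scheme.Modules.Hom.isIso_iff_isIso_app]
  intro V
  rw [ConcreteCategory.isIso_iff_bijective,
    ← Function.Bijective.of_comp_iff _ (bijective_stdSection (X := X) (I := I) V)]
  refine Eq.mp ?_ (ht (le_top : V ≤ ⊤))
  congr 1
  funext c
  simp [combo, map_sum, freeDesc_app]

end Free

section

variable {X : Scheme.{u}} {M : X.Modules} {U : X.Opens}

theorem restrict_smul {W : (U : Scheme.{u}).Opens} (c : Γ(X, U.ι ''ᵁ W))
    (x : Γ(M, U.ι ''ᵁ W)) :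
    (show Γ((U : Scheme.{u}), W) from c) • (show Γ(M.restrict U.ι, W) from x) = c • x := by
  have h : (U.ι.appIso W).inv c = c := by
    rw [Scheme.Opens.ι_appIso]
    rfl
  exact congr($h • x)

/-- The restrictions to `U` itself of sections over `U`, as sections of the restricted module. -/
def toRestrict {I : Type*} (s : I → Γ(M, U)) (i : I) : Γ(M.restrict U.ι, ⊤) :=
  res M (U.ι_image_le ⊤) (s i)

theorem res_toRestrict {I : Type*} (s : I → Γ(M, U)) (i : I) {W : (U : Scheme.{u}).Opens} :
    res (M.restrict U.ι) (le_top : W ≤ ⊤) (toRestrict s i) = res M (U.ι_image_le W) (s i) :=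
  res_res M (U.ι_image_le ⊤) (U.ι.image_mono le_top) (s i)

/-- A basis over `⊤` of the restriction to `U` is a basis over `U`. -/
theorem isBasisOn_toRestrict {I : Type*} [Fintype I] {s : I → Γ(M, U)} :
    IsBasisOn (toRestrict s) ↔ IsBasisOn s := by
  have key (W : (U : Scheme.{u}).Opens) :
      combo (toRestrict s) (le_top : W ≤ ⊤) = combo s (U.ι_image_le W) := by
    funext c
    refine Finset.sum_congr rfl fun i _ => ?_
    rw [res_toRestrict]
    exact restrict_smul (c i) _
  constructor
  · intro h V hV
    obtain ⟨W, rfl⟩ : ∃ W, U.ι ''ᵁ W = V := ⟨U.ι ⁻¹ᵁ V, by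
      rw [Scheme.Hom.image_preimage_eq_opensRange_inf]; simpa using hV⟩
    exact key W ▸ h le_top
  · intro h W hW
    exact (key W).symm ▸ h _

/-- Isomorphisms of the restriction to `U` with a free sheaf are the same as bases over `U`. -/
theorem isLocallyFreeFinite_iff : IsLocallyFreeFinite M ↔
    ∀ x : X, ∃ U : X.Opens, x ∈ U ∧ ∃ (m : ℕ) (s : Fin m → Γ(M, U)), IsBasisOn s := by
  classical
  refine forall_congr' fun x => exists_congr fun U => and_congr_right fun _ =>
    exists_congr fun m => ⟨fun ⟨e⟩ => ?_, fun ⟨s, hs⟩ => ?_⟩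
  · let e' : freeMod (U : Scheme.{u}) (ULift.{u} (Fin m)) ≅ M.restrict U.ι := e.symm
    have h := ((isBasisOn_stdSection (I := ULift.{u} (Fin m)) ⊤).map e').reindex
      Equiv.ulift.symm
    let s (i : Fin m) : Γ(M, U) := res M U.ι_image_top.ge (e'.hom.app ⊤ (stdSection ⟨i⟩ ⊤))
    have hs : toRestrict s = (fun i => e'.hom.app ⊤ (stdSection i ⊤)) ∘ Equiv.ulift.symm :=
      funext fun i => (res_res M U.ι_image_top.ge _ _).trans (res_self M _ _)
    exact ⟨s, isBasisOn_toRestrict.1 (hs ▸ h)⟩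
  · have := isIso_freeDesc ((isBasisOn_toRestrict.2 hs).reindex (Equiv.ulift.{u}))
    exact ⟨(asIso (freeDesc (toRestrict s ∘ Equiv.ulift.{u}))).symm⟩

end

end

end GraysonK

namespace GraysonK

noncomputable section

/-! ### Locally free sheaves: direct sums and direct summands -/

open BinaryComplex ZeroObject

theorem isLocallyFreeFinite_of_isBasisOn {X : Scheme.{u}} {M : X.Modules}
    (h : ∀ x : X, ∃ U : X.Opens, x ∈ U ∧ ∃ (I : Type) (_ : Fintype I) (s : I → Γ(M, U)),
      IsBasisOn s) : IsLocallyFreeFinite M := by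
  refine isLocallyFreeFinite_iff.2 fun x => ?_
  obtain ⟨U, hU, I, _, s, hs⟩ := h x
  exact ⟨U, hU, _, _, hs.reindex (Fintype.equivFin I).symm⟩

theorem isLocallyFreeFinite_of_isZero {X : Scheme.{u}} {M : X.Modules} (hM : IsZero M) :
    IsLocallyFreeFinite M := by
  refine isLocallyFreeFinite_of_isBasisOn fun x => ⟨⊤, trivial, PEmpty, inferInstance,
    PEmpty.elim, fun V h => ⟨fun _ _ _ => funext fun i => i.elim, fun y => ⟨PEmpty.elim, ?_⟩⟩⟩
  have h (z : Γ(M, V)) : z = 0 := congr($(hM.eq_of_src (𝟙 M) 0).app V z)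
  rw [h y, h (combo _ _ _)]

/-- Local bases of the two ends form a local basis of the middle. -/
theorem isLocallyFreeFinite_of_isSplit {X : Scheme.{u}} {P Q R : X.Modules} {f : P ⟶ Q}
    {g : Q ⟶ R} (h : IsSplit f g) (hP : IsLocallyFreeFinite P) (hR : IsLocallyFreeFinite R) :
    IsLocallyFreeFinite Q := by
  obtain ⟨h0, r, s, hr, hs, h1⟩ := h
  refine isLocallyFreeFinite_of_isBasisOn fun x => ?_
  obtain ⟨U, hxU, m, p, hp⟩ := isLocallyFreeFinite_iff.1 hP x
  obtain ⟨V, hxV, n, q, hq⟩ := isLocallyFreeFinite_iff.1 hR x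
  refine ⟨U ⊓ V, ⟨hxU, hxV⟩, Fin m ⊕ Fin n, inferInstance,
    Sum.elim (fun i => f.app _ (res P inf_le_left (p i)))
      (fun j => s.app _ (res R inf_le_right (q j))), fun W hW => ?_⟩
  have hp' := hp.restrict (inf_le_left : U ⊓ V ≤ U) hW
  have hq' := hq.restrict (inf_le_right : U ⊓ V ≤ V) hW
  set p' := fun i => res P (inf_le_left : U ⊓ V ≤ U) (p i)
  set q' := fun i => res R (inf_le_right : U ⊓ V ≤ V) (q i)
  have key (c : Fin m ⊕ Fin n → Γ(X, W)) :
      combo (Sum.elim (fun i => f.app _ (p' i)) (fun j => s.app _ (q' j))) hW c =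
        f.app W (combo p' hW (c ∘ Sum.inl)) + s.app W (combo q' hW (c ∘ Sum.inr)) := by
    rw [app_combo, app_combo]
    simp [combo]
  have h0' (y : Γ(P, W)) : g.app W (f.app W y) = 0 := congr(($h0).app W y)
  have hr' (y : Γ(P, W)) : r.app W (f.app W y) = y := congr(($hr).app W y)
  have hs' (y : Γ(R, W)) : g.app W (s.app W y) = y := congr(($hs).app W y)
  have h1' (y : Γ(Q, W)) : f.app W (r.app W y) + s.app W (g.app W y) = y := congr(($h1).app W y)
  constructor
  · intro c d hcd
    rw [key, key] at hcd
    have hR : combo q' hW (c ∘ Sum.inr) = combo q' hW (d ∘ Sum.inr) := by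
      simpa [h0', hs'] using congrArg (g.app W) hcd
    rw [hR, add_left_inj] at hcd
    have hL : combo p' hW (c ∘ Sum.inl) = combo p' hW (d ∘ Sum.inl) := by
      simpa [hr'] using congrArg (r.app W) hcd
    funext i
    cases i with
    | inl i => exact congrFun (hp'.1 hL) i
    | inr i => exact congrFun (hq'.1 hR) i
  · intro y
    obtain ⟨a, ha⟩ := hp'.2 (r.app W y)
    obtain ⟨b, hb⟩ := hq'.2 (g.app W y)
    refine ⟨Sum.elim a b, ?_⟩
    rw [key, Sum.elim_comp_inl, Sum.elim_comp_inr, ha, hb, h1']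

/-- Expansion of the determinant of a product of two rectangular matrices. -/
theorem det_mul_eq_sum {R : Type*} [CommRing R] {m J : Type*} [Fintype m] [DecidableEq m]
    [Fintype J] (A : Matrix m J R) (B : Matrix J m R) :
    (A * B).det = ∑ a : m → J, (∏ k, B (a k) k) * (A.submatrix id a).det := by
  classical
  have h : (A * B).transpose = fun k => ∑ j, B j k • A.transpose j := by
    funext k i
    simp [Matrix.mul_apply, mul_comm]
  rw [← Matrix.det_transpose, h]
  refine (MultilinearMap.map_sum (Matrix.detRowAlternating (R := R) (n := m)).toMultilinearMap
    (fun k j => B j k • A.transpose j)).trans (Finset.sum_congr rfl fun a _ => ?_)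
  rw [MultilinearMap.map_smul_univ, smul_eq_mul, ← Matrix.det_transpose (A.submatrix id a)]
  rfl

section

variable {X : Scheme.{u}} {M : X.Modules} {U : X.Opens}

/-- Change of coefficients for a family that is given by a matrix in terms of another one. -/
theorem combo_smul_sum {I J : Type*} [Fintype I] [Fintype J] (s : I → Γ(M, U))
    (A : Matrix I J Γ(X, U)) {V : X.Opens} (h : V ≤ U) (c : J → Γ(X, V)) :
    combo (fun j => ∑ i, A i j • s i) h c =
      combo s h ((A.map (X.presheaf.map (homOfLE h).op).hom).mulVec c) := by
  simp only [combo, map_sum, res_smul, Finset.smul_sum, Matrix.mulVec, dotProduct,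
    Finset.sum_smul, smul_smul, Matrix.map_apply]
  rw [Finset.sum_comm]
  refine Finset.sum_congr rfl fun i _ => Finset.sum_congr rfl fun j _ => ?_
  rw [mul_comm]

theorem IsBasisOn.exists_eq {I : Type*} [Fintype I] {s : I → Γ(M, U)} (hs : IsBasisOn s)
    (y : Γ(M, U)) : ∃ c : I → Γ(X, U), y = ∑ i, c i • s i := by
  obtain ⟨c, rfl⟩ := (hs le_rfl).2 y
  exact ⟨c, by simp [combo, res_self]⟩

theorem IsBasisOn.eq_of_sum_eq {I : Type*} [Fintype I] {s : I → Γ(M, U)} (hs : IsBasisOn s)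
    {c d : I → Γ(X, U)} (h : ∑ i, c i • s i = ∑ i, d i • s i) : c = d :=
  (hs le_rfl).1 (by simpa [combo, res_self] using h)

/-- Near a point, a basis can be extracted from a finite family which generates a free sheaf. -/
theorem IsBasisOn.exists_subfamily {I J : Type*} [Fintype I] [Fintype J] {q : I → Γ(M, U)}
    (hq : IsBasisOn q) (s : J → Γ(M, U)) (hs : ∀ i, ∃ b : J → Γ(X, U), q i = ∑ j, b j • s j)
    {x : X} (hx : x ∈ U) :
    ∃ (V : X.Opens) (h : V ≤ U) (a : I → J), x ∈ V ∧ IsBasisOn (fun i => res M h (s (a i))) := by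
  classical
  choose B hB using hs
  choose A hA using fun j => hq.exists_eq (s j)
  let A' : Matrix I J Γ(X, U) := fun i j => A j i
  let B' : Matrix J I Γ(X, U) := fun j i => B i j
  have hAB : A' * B' = 1 := by
    ext i k
    refine congrFun (hq.eq_of_sum_eq (c := fun i => (A' * B') i k) (d := fun i => (1 : Matrix _ _ _) i k) ?_) i
    have h1 : ∑ i, (1 : Matrix I I Γ(X, U)) i k • q i = q k := by
      simp [Matrix.one_apply]
    rw [h1]
    refine Eq.trans ?_ (hB k).symm
    simp only [Matrix.mul_apply, Finset.sum_smul]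
    rw [Finset.sum_comm]
    refine Finset.sum_congr rfl fun j _ => ?_
    rw [hA j, Finset.smul_sum]
    exact Finset.sum_congr rfl fun i _ => by rw [smul_smul, mul_comm]
  -- the determinant `1` of `A' B'` is a combination of minors of `A'`, one of which is therefore
  -- invertible near `x`
  have hdet := det_mul_eq_sum A' B'
  rw [hAB, Matrix.det_one] at hdet
  obtain ⟨a, ha⟩ : ∃ a : I → J, x ∈ X.basicOpen (A'.submatrix id a).det := by
    by_contra! hcon
    have := congrArg (X.evaluation U x hx).hom hdet
    rw [map_one, map_sum, Finset.sum_eq_zero] at this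
    · exact one_ne_zero this
    · intro a _
      rw [map_mul, (Scheme.evaluation_eq_zero_iff_notMem_basicOpen X x hx _).2 (hcon a), mul_zero]
  refine ⟨X.basicOpen (A'.submatrix id a).det, X.basicOpen_le _, a, ha, ?_⟩
  have hs' : (fun i => s (a i)) = fun j => ∑ i, (A'.submatrix id a) i j • q i :=
    funext fun j => hA (a j)
  intro V hV
  have hU : V ≤ U := hV.trans (X.basicOpen_le _)
  have hcombo : combo (fun i => res M (X.basicOpen_le _) (s (a i))) hV = combo q hU ∘
      ((A'.submatrix id a).map (X.presheaf.map (homOfLE hU).op).hom).mulVec := by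
    funext c
    rw [Function.comp_apply, ← combo_smul_sum, ← hs']
    simp [combo, res_res]
  rw [hcombo]
  -- over the open set where the minor is invertible, the chosen sections differ from the basis `q`
  -- by an invertible matrix
  suffices hA : IsUnit ((A'.submatrix id a).map (X.presheaf.map (homOfLE hU).op).hom) from
    (hq hU).comp ⟨Matrix.mulVec_injective_of_isUnit hA, Matrix.mulVec_surjective_iff_isUnit.2 hA⟩
  rw [Matrix.isUnit_iff_isUnit_det, ← RingHom.mapMatrix_apply, ← RingHom.map_det]
  have h := (X.toRingedSpace.isUnit_res_basicOpen (A'.submatrix id a).det).map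
    (X.presheaf.map (homOfLE hV).op).hom
  convert h using 1
  exact congr($(X.presheaf.map_comp (homOfLE (X.basicOpen_le _)).op (homOfLE hV).op) _)

end

/-- Near every point there is a basis of `Q` that consists of sections of `P` and sections of its
complement; those of the first kind form a basis of `P`. -/
theorem isLocallyFreeFinite_of_retract {X : Scheme.{u}} {P Q : X.Modules} (i : P ⟶ Q) (p : Q ⟶ P)
    (h : i ≫ p = 𝟙 P) (hQ : IsLocallyFreeFinite Q) : IsLocallyFreeFinite P := by
  classical
  refine isLocallyFreeFinite_of_isBasisOn fun x => ?_
  obtain ⟨U, hxU, m, q, hq⟩ := isLocallyFreeFinite_iff.1 hQ x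
  have hip {W : X.Opens} (y : Γ(P, W)) : p.app W (i.app W y) = y := congr(($h).app W y)
  -- the sections `q j` are split into their components in `P` and in the complement of `P`
  let s : Fin m ⊕ Fin m → Γ(Q, U) := Sum.elim (fun j => i.app U (p.app U (q j)))
    (fun j => q j - i.app U (p.app U (q j)))
  obtain ⟨V, hV, a, hxV, ha⟩ := hq.exists_subfamily s
    (fun j => ⟨fun k => if k = .inl j ∨ k = .inr j then 1 else 0, by simp [s, ite_smul]⟩) hxU
  let J := {j : Fin m // (a j).isLeft}
  have hsJ (j : J) : i.app U (p.app U (s (a j))) = s (a j) := by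
    obtain ⟨j, hj⟩ := j
    obtain ⟨k, hk⟩ := Sum.isLeft_iff.1 hj
    simp [hk, s, hip]
  have hsJ' (j : {j // ¬ (a j).isLeft}) : p.app U (s (a j)) = 0 := by
    obtain ⟨j, hj⟩ := j
    obtain ⟨k, hk⟩ := Sum.isRight_iff.1 (Sum.not_isLeft.1 hj)
    simp [hk, s, hip]
  refine ⟨V, hxV, J, inferInstance, fun j => p.app V (res Q hV (s (a j))), fun W hW => ⟨?_, ?_⟩⟩
  · intro c d hcd
    have key (c : J → Γ(X, W)) :
        i.app W (combo (fun j : J => p.app V (res Q hV (s (a j)))) hW c) =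
          combo (fun j => res Q hV (s (a j))) hW
            (fun j => if h : (a j).isLeft then c ⟨j, h⟩ else 0) := by
      rw [app_combo]
      simp only [combo, app_res, hsJ]
      rw [← Fintype.sum_subtype_add_sum_subtype (fun j => ((a j).isLeft : Prop)),
        Finset.sum_eq_zero (s := (Finset.univ : Finset {j // ¬ (a j).isLeft})), add_zero]
      · exact Finset.sum_congr rfl fun j _ => by rw [dif_pos j.2]
      · intro j _
        rw [dif_neg j.2, zero_smul]
    have h := congrArg (i.app W) hcd
    rw [key, key] at h
    funext j
    simpa [j.2] using congrFun ((ha hW).1 h) j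
  · intro y
    obtain ⟨c, hc⟩ := (ha hW).2 (i.app W y)
    refine ⟨fun j => c j, ?_⟩
    rw [← hip y, ← hc, app_combo]
    simp only [combo, app_res]
    rw [← Fintype.sum_subtype_add_sum_subtype (fun j => ((a j).isLeft : Prop)),
      Finset.sum_eq_zero (s := (Finset.univ : Finset {j // ¬ (a j).isLeft})), add_zero]
    intro j _
    rw [hsJ', map_zero, map_zero, smul_zero]

end

end GraysonK

namespace GraysonK

noncomputable section

/-! ### Local bases of an associated sheaf -/

open BinaryComplex ZeroObject

section

variable {X : Scheme.{u}} {M : X.Modules} {U : X.Opens}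

theorem res_combo {I : Type*} [Fintype I] (s : I → Γ(M, U)) {V W : X.Opens} (h : V ≤ U)
    (k : W ≤ V) (c : I → Γ(X, V)) :
    res M k (combo s h c) =
      combo s (k.trans h) (fun i => X.presheaf.map (homOfLE k).op (c i)) := by
  simp [combo, res_smul, res_res]

/-- A family of sections which is everywhere linearly independent and locally generates is a
basis. -/
theorem isBasisOn_of_locally {I : Type*} [Fintype I] {s : I → Γ(M, U)}
    (hinj : ∀ ⦃V : X.Opens⦄ (h : V ≤ U), Function.Injective (combo s h))
    (hsurj : ∀ ⦃V : X.Opens⦄ (h : V ≤ U) (y : Γ(M, V)) (x : X), x ∈ V →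
      ∃ (W : X.Opens) (k : W ≤ V), x ∈ W ∧ ∃ c, combo s (k.trans h) c = res M k y) :
    IsBasisOn s := by
  intro V h
  refine ⟨hinj h, fun y => ?_⟩
  choose W hWV hxW c hc using fun x : V => hsurj h y x x.2
  have hcover : V ≤ iSup W := fun x hx => TopologicalSpace.Opens.mem_iSup.2 ⟨⟨x, hx⟩, hxW ⟨x, hx⟩⟩
  -- the local coefficients are unique, hence they glue
  have hcompat (i : I) : TopCat.Presheaf.IsCompatible X.presheaf W (fun x => c x i) := by
    intro x x'
    have h1 := res_combo s ((hWV x).trans h) (inf_le_left : W x ⊓ W x' ≤ W x) (c x)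
    have h2 := res_combo s ((hWV x').trans h) (inf_le_right : W x ⊓ W x' ≤ W x') (c x')
    rw [hc, res_res] at h1 h2
    exact congrFun (hinj (inf_le_left.trans ((hWV x).trans h)) (h1.symm.trans h2)) i
  choose d hd _ using fun i => TopCat.Sheaf.existsUnique_gluing' X.sheaf W V
    (fun x => homOfLE (hWV x)) hcover _ (hcompat i)
  refine ⟨d, ?_⟩
  refine TopCat.Sheaf.eq_of_locally_eq' ⟨M.presheaf, M.isSheaf⟩ W V
    (fun x => homOfLE (hWV x)) hcover _ _ fun x => ?_
  refine (res_combo s h (hWV x) d).trans (Eq.trans ?_ (hc x))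
  congr 1
  exact funext fun i => hd i x

end

section

variable {X : Scheme.{u}} (P : X.PresheafOfModules)

/-- The sections of a presheaf of modules over an open set. -/
abbrev Sec (V : X.Opens) : Type u := P.presheaf.obj (.op V)

instance (V : X.Opens) : Module Γ(X, V) (Sec P V) := (P.obj (.op V)).isModule

/-- Restriction of sections of a presheaf of modules. -/
def pres {V U : X.Opens} (h : V ≤ U) : Sec P U →+ Sec P V := (P.presheaf.map (homOfLE h).op).hom

/-- The canonical map from the sections of a presheaf to those of its associated sheaf. -/
def toSheaf (V : X.Opens) : Sec P V →+ Γ((sheafify X).obj P, V) :=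
  ((CategoryTheory.toSheafify (Opens.grothendieckTopology X) P.presheaf).app (.op V)).hom

theorem toSheaf_smul {V : X.Opens} (c : Γ(X, V)) (y : Sec P V) :
    toSheaf P V (c • y) = c • toSheaf P V y :=
  (((PresheafOfModules.sheafificationAdjunction (𝟙 X.ringCatSheaf.obj)).unit.app P).app
    (.op V)).hom.map_smul c y

theorem toSheaf_pres {V U : X.Opens} (h : V ≤ U) (y : Sec P U) :
    toSheaf P V (pres P h y) = res _ h (toSheaf P U y) :=
  congr($((CategoryTheory.toSheafify (Opens.grothendieckTopology X) P.presheaf).naturality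
    (homOfLE h).op) y)

theorem exists_pres_eq_of_toSheaf_eq {V : X.Opens} {y z : Sec P V}
    (h : toSheaf P V y = toSheaf P V z) {x : X} (hx : x ∈ V) :
    ∃ (W : X.Opens) (k : W ≤ V), x ∈ W ∧ pres P k y = pres P k z := by
  obtain ⟨W, f, hf, hxW⟩ := Presheaf.equalizerSieve_mem (Opens.grothendieckTopology X)
    (CategoryTheory.toSheafify (Opens.grothendieckTopology X) P.presheaf) y z h x hx
  exact ⟨W, leOfHom f, hxW, hf⟩

theorem exists_toSheaf_eq_res {V : X.Opens} (y : Γ((sheafify X).obj P, V)) {x : X} (hx : x ∈ V) :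
    ∃ (W : X.Opens) (k : W ≤ V), x ∈ W ∧ ∃ z : Sec P W, toSheaf P W z = res _ k y := by
  obtain ⟨W, f, ⟨z, hz⟩, hxW⟩ := Presheaf.imageSieve_mem (Opens.grothendieckTopology X)
    (CategoryTheory.toSheafify (Opens.grothendieckTopology X) P.presheaf) (U := .op V) y x hx
  exact ⟨W, leOfHom f, hxW, z, hz⟩

/-- A family that restricts to bases of the sections of a presheaf gives a basis of the associated
sheaf. -/
theorem isBasisOn_toSheaf {U : X.Opens} {I : Type*} [Fintype I] (s : I → Sec P U)
    (hs : ∀ ⦃V : X.Opens⦄ (h : V ≤ U),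
      Function.Bijective (fun c : I → Γ(X, V) => ∑ i, c i • pres P h (s i))) :
    IsBasisOn (fun i => toSheaf P U (s i)) := by
  have key {V : X.Opens} (h : V ≤ U) (c : I → Γ(X, V)) :
      combo (fun i => toSheaf P U (s i)) h c = toSheaf P V (∑ i, c i • pres P h (s i)) := by
    refine ((map_sum (toSheaf P V) _ _).trans (Finset.sum_congr rfl fun i _ => ?_)).symm
    exact (toSheaf_smul P _ _).trans (congrArg (c i • ·) (toSheaf_pres P h _))
  refine isBasisOn_of_locally ?_ ?_
  · intro V h c d hcd
    rw [key, key] at hcd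
    have hl (x : V) := exists_pres_eq_of_toSheaf_eq P hcd x.2
    choose W hWV hxW hW using hl
    have hcover : V ≤ iSup W :=
      fun x hx => TopologicalSpace.Opens.mem_iSup.2 ⟨⟨x, hx⟩, hxW ⟨x, hx⟩⟩
    funext i
    refine TopCat.Sheaf.eq_of_locally_eq' X.sheaf W V
      (fun x => homOfLE (hWV x)) hcover _ _ fun x => ?_
    have hp (c : I → Γ(X, V)) : pres P (hWV x) (∑ i, c i • pres P h (s i)) =
        ∑ i, X.presheaf.map (homOfLE (hWV x)).op (c i) • pres P ((hWV x).trans h) (s i) := by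
      rw [map_sum]
      refine Finset.sum_congr rfl fun i _ => ?_
      refine (P.map_smul (homOfLE (hWV x)).op (c i) (pres P h (s i))).trans ?_
      congr 1
      exact congr($(P.presheaf.map_comp (homOfLE h).op (homOfLE (hWV x)).op) (s i)).symm
    have hx := hW x
    rw [hp, hp] at hx
    exact congrFun ((hs ((hWV x).trans h)).1 hx) i
  · intro V h y x hx
    obtain ⟨W, k, hxW, z, hz⟩ := exists_toSheaf_eq_res P y hx
    obtain ⟨c, rfl⟩ := (hs (k.trans h)).2 z
    exact ⟨W, k, hxW, c, (key _ c).trans hz⟩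

end

end

end GraysonK

namespace GraysonK

noncomputable section

/-! ### Exterior powers of locally free sheaves, and the degree of the exterior power functor -/

open BinaryComplex ZeroObject

section

variable {X : Scheme.{u}}

/-- The presheaf `V ↦ Λ^r Γ(M, V)`. -/
def extPre (r : ℕ) (M : X.Modules) : X.PresheafOfModules :=
  (PresheafExt.extFunctor (R := X.presheaf) r).obj M.val

/-- The exterior product of sections. -/
def wedge {r : ℕ} {M : X.Modules} {V : X.Opens} (m : Fin r → Γ(M, V)) : Sec (extPre r M) V :=
  exteriorPower.ιMulti Γ(X, V) r m

theorem pres_wedge {r : ℕ} {M : X.Modules} {V U : X.Opens} (h : V ≤ U) (m : Fin r → Γ(M, U)) :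
    pres (extPre r M) h (wedge m) = wedge (fun i => res M h (m i)) :=
  ModuleCat.exteriorPower.desc_mk (R := Γ(X, U))
    (PresheafExt.restrictMk (R := X.presheaf) r M.val (homOfLE h).op) m

/-- The basis of the sections over a smaller open set given by a local basis. -/
def IsBasisOn.basis {M : X.Modules} {U : X.Opens} {I : Type*} [Fintype I]
    {s : I → Γ(M, U)} (hs : IsBasisOn s) {V : X.Opens} (h : V ≤ U) :
    Module.Basis I Γ(X, V) Γ(M, V) :=
  Module.Basis.ofEquivFun (LinearEquiv.ofBijective
    (Fintype.linearCombination Γ(X, V) (fun i => res M h (s i))) (hs h)).symm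

theorem IsBasisOn.basis_apply {M : X.Modules} {U : X.Opens} {I : Type*} [Fintype I]
    {s : I → Γ(M, U)} (hs : IsBasisOn s) {V : X.Opens} (h : V ≤ U) (i : I) :
    hs.basis h i = res M h (s i) := by
  classical
  simp only [IsBasisOn.basis, Module.Basis.coe_ofEquivFun, LinearEquiv.symm_symm]
  exact (Fintype.linearCombination_apply_single _ _ _ _).trans (one_smul _ _)

/-- The exterior products of the sections in a local basis form a local basis. -/
theorem isLocallyFreeFinite_extPow {M : X.Modules} (hM : IsLocallyFreeFinite M) (r : ℕ) :
    IsLocallyFreeFinite ((extPow X r).obj M) := by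
  refine isLocallyFreeFinite_of_isBasisOn fun x => ?_
  obtain ⟨U, hxU, m, s, hs⟩ := isLocallyFreeFinite_iff.1 hM x
  refine ⟨U, hxU, Set.powersetCard (Fin m) r, inferInstance, _, isBasisOn_toSheaf (extPre r M)
    (fun t => wedge (s ∘ Set.powersetCard.ofFinEmbEquiv.symm t)) fun V h => ?_⟩
  let b := (hs.basis h).exteriorPower r
  refine Eq.mp (congrArg Function.Bijective ?_) b.equivFun.symm.bijective
  funext c
  refine (b.equivFun_symm_apply c).trans (Finset.sum_congr rfl fun t _ => ?_)
  refine congrArg (c t • ·) ((exteriorPower.basis_apply Γ(X, V) r (hs.basis h) t).trans ?_)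
  refine Eq.trans ?_ (pres_wedge h _).symm
  refine congrArg (exteriorPower.ιMulti Γ(X, V) r) (funext fun i => ?_)
  exact hs.basis_apply h _

/-- Morphisms out of an exterior power are determined by their values on exterior products. -/
theorem extPow_hom_ext {r : ℕ} {M N : X.Modules} {φ ψ : (extPow X r).obj M ⟶ N}
    (h : ∀ (U : X.Opens) (m : Fin r → Γ(M, U)),
      φ.app U (toSheaf (extPre r M) U (wedge m)) = ψ.app U (toSheaf (extPre r M) U (wedge m))) :
    φ = ψ := by
  refine (PresheafOfModules.sheafificationHomEquiv (𝟙 X.ringCatSheaf.obj)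
    (P := extPre r M)).injective (PresheafOfModules.hom_ext fun U => ?_)
  refine ModuleCat.exteriorPower.hom_ext (R := Γ(X, U.unop)) ?_
  ext m
  exact h U.unop m

theorem extPow_map_app_wedge {r : ℕ} {M N : X.Modules} (f : M ⟶ N) {U : X.Opens}
    (m : Fin r → Γ(M, U)) :
    ((extPow X r).map f).app U (toSheaf (extPre r M) U (wedge m)) =
      toSheaf (extPre r N) U (wedge (fun i => f.app U (m i))) := by
  have h := (PresheafOfModules.sheafificationAdjunction (𝟙 X.ringCatSheaf.obj)).unit.naturality
    ((PresheafExt.extFunctor (R := X.presheaf) r).map f.val)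
  refine Eq.trans congr(($h).app (.op U) (wedge m)).symm ?_
  exact congrArg (toSheaf (extPre r N) U)
    (ModuleCat.exteriorPower.map_mk (R := Γ(X, U)) (f.val.app (.op U)) m)

theorem extPow_map_zero {r : ℕ} (hr : 1 ≤ r) (M N : X.Modules) :
    (extPow X r).map (0 : M ⟶ N) = 0 := by
  refine extPow_hom_ext fun U m => ?_
  rw [extPow_map_app_wedge]
  have h : wedge (fun i => (0 : M ⟶ N).app U (m i)) = 0 :=
    (exteriorPower.ιMulti Γ(X, U) r).map_coord_zero (⟨0, hr⟩ : Fin r) rfl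
  rw [h]
  exact map_zero _

/-- An alternating sum over subsets of values of an `r`-linear map on partial sums of more than
`r` vectors vanishes: no `r`-tuple of indices involves all of them. -/
theorem moebius_multilinear {R M N : Type*} [CommRing R] [AddCommGroup M] [Module R M]
    [AddCommGroup N] [Module R N] {r m : ℕ} (hm : r ≤ m)
    (φ : MultilinearMap R (fun _ : Fin r => M) N) (v : Fin (m + 1) → Fin r → M) :
    moebius (fun S => φ fun k => ∑ i ∈ S, v i k) Finset.univ Finset.univ = 0 := by
  classical
  have h (S : Finset (Fin (m + 1))) : φ (fun k => ∑ i ∈ Finset.univ \ S, v i k) =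
      ∑ g : Fin r → Fin (m + 1),
        if S ⊆ Finset.univ \ Finset.univ.image g then φ (fun k => v (g k) k) else 0 := by
    rw [MultilinearMap.map_sum_finset φ (fun k i => v i k), ← Finset.sum_filter]
    refine Finset.sum_congr ?_ fun _ _ => rfl
    ext g
    simp only [Fintype.mem_piFinset, Finset.mem_sdiff, Finset.mem_univ, true_and,
      Finset.mem_filter, Finset.subset_iff, Finset.mem_image, not_exists]
    exact ⟨fun h i hi k hk => h k (hk ▸ hi), fun h k hk => h hk k rfl⟩
  simp only [moebius, h, Finset.smul_sum]
  rw [Finset.sum_comm]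
  refine Finset.sum_eq_zero fun g _ => ?_
  obtain ⟨i, hi⟩ : (Finset.univ \ Finset.univ.image g).Nonempty := by
    rw [← Finset.card_pos, Finset.card_sdiff_of_subset (Finset.subset_univ _), Finset.card_univ,
      Fintype.card_fin]
    have := Finset.card_image_le (s := (Finset.univ : Finset (Fin r))) (f := g)
    rw [Finset.card_univ, Fintype.card_fin] at this
    omega
  simp only [smul_ite, smul_zero, ← Finset.sum_filter]
  rw [← Finset.sum_smul]
  have hf : (Finset.univ.powerset.filter (· ⊆ Finset.univ \ Finset.univ.image g)) =
      (Finset.univ \ Finset.univ.image g).powerset := by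
    ext S
    simp
  rw [hf, Finset.sum_powerset_neg_one_pow_card_of_nonempty ⟨i, hi⟩, zero_smul]

/-- Evaluation of morphisms at a section. -/
def evalSection (M N : X.Modules) {U : X.Opens} (y : Γ(M, U)) : (M ⟶ N) →+ Γ(N, U) where
  toFun φ := φ.app U y
  map_zero' := rfl
  map_add' _ _ := rfl

/-- On exterior products of sections, this is `moebius_multilinear`. -/
theorem degreeLE_extPow (r : ℕ) : DegreeLE r (extPow X r) := by
  intro m hm M N f
  refine extPow_hom_ext fun U y => ?_
  refine (map_moebius (evalSection _ _ (toSheaf (extPre r M) U (wedge y))) _ _ _).trans ?_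
  have h := moebius_multilinear hm (exteriorPower.ιMulti Γ(X, U) r
    (M := Γ(N, U))).toMultilinearMap (fun i k => (f i).app U (y k))
  refine Eq.trans ?_ ((congrArg (toSheaf (extPre r N) U) h).trans (map_zero _))
  refine Eq.trans ?_ (map_moebius (toSheaf (extPre r N) U) _ _ _).symm
  congr 1
  funext S
  refine (extPow_map_app_wedge _ y).trans (congrArg (fun z => toSheaf (extPre r N) U (wedge z)) ?_)
  funext k
  exact sum_app S f U (y k)

end

/-- The class of locally free sheaves of finite rank with the usual short exact sequences. -/
def sheafData (X : Scheme.{u}) : ExactData X.Modules where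
  good := IsLocallyFreeFinite
  ses f g := IsSES X 0 f g
  dir := PEmpty
  isDiag i := i.elim
  good_of_retract := isLocallyFreeFinite_of_retract
  good_of_isZero := isLocallyFreeFinite_of_isZero
  good_of_isSplit _ _ := isLocallyFreeFinite_of_isSplit
  ses_of_isSplit f g h := by
    obtain ⟨h0, r, s, hr, hs, h1⟩ := h
    refine ⟨h0, ShortComplex.Splitting.shortExact ⟨r, s, hr, hs, h1⟩⟩
  isDiag_of_isZero i := i.elim

end

end GraysonK

theorem mainTheorem1 (X : Scheme.{u}) [CompactSpace X] (r n : ℕ) (hr : 1 ≤ r) (hn : 1 ≤ n)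
    (P : GraysonK.CommAut X.Modules n) (hP : GraysonK.IsLocallyFreeFinite P.obj) :
    ∃ (hC : GraysonK.IsAcyclicMulti X n ((GraysonK.cube X n).obj P))
      (hL : GraysonK.IsAcyclicMulti X n
        ((GraysonK.extMulti X r n).obj ((GraysonK.cube X n).obj P)))
      (hR : ∀ i : Fin r, GraysonK.IsAcyclicMulti X n
        ((GraysonK.cube X n).obj (GraysonK.crossEffectAut X r i P))),
      GraysonK.cls _ hL = ∑ i : Fin r, (-1 : ℤ) ^ (i : ℕ) • GraysonK.cls _ (hR i) ∧
      ∀ lam : GraysonK.K X n →+ GraysonK.K X n, GraysonK.IsExteriorPowerOperation X r n lam →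
        lam (GraysonK.cls _ hC) = ∑ i : Fin r, (-1 : ℤ) ^ (i : ℕ) • GraysonK.cls _ (hR i) := by
  have : IsEmpty (GraysonK.sheafData X).dir := inferInstanceAs (IsEmpty PEmpty)
  obtain ⟨hC, hL, hR, h⟩ := GraysonK.cls_extMulti_cube (E := GraysonK.sheafData X)
    (fun _ => Iff.rfl) (fun _ _ => Iff.rfl) hr
    (fun _ hM => GraysonK.isLocallyFreeFinite_extPow hM r)
    (GraysonK.extPow_map_zero hr) (GraysonK.degreeLE_extPow r) hn P hP
  refine ⟨hC, hL, hR, h, fun lam hlam => ?_⟩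
  obtain ⟨h', e⟩ := hlam _ hC
  exact e.trans h
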